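/- We work in the smooth category. A closed surface in $S^3$ is a nonempty compact orientable smoothly embedded surface $F\subset S^3$ without boundary, not necessarily connected. For a knot $K\subset S^3$ let $c(K;F)\in\mathbb N\cup\{\infty\}$ be the surface crossing number: the minimal number of double points of $p(K')$, where $N(F)\cong F\times[-1,1]$ is a closed regular neighbourhood of $F=F\times\{0\}$ with projection $p\colon N(F)\to F$, and $K'$ ranges over the knots in the interior of $N(F)$ that are ambient isotopic to $K$ in $S^3$ and for which $p|_{K'}$ is an immersion whose only singularities are finitely many transverse double points. Let $c(K)$ be the classical crossing number, i.e. the minimal number of double points of a regular projection to $\mathbb R^2$ of a knot in $\mathbb R^3=S^3\setminus\{\mathrm{pt}\}$ that is ambient isotopic to $K$ in $S^3$. A compressing disk for $F$ is a smoothly embedded disk $D\subset S^3$ with $D\cap F=\partial D$, transverse to $F$ along $\partial D$, such that $\partial D$ does not bound a disk in $F$. The surface $F'$ is obtained from $F$ by a compression if, up to ambient isotopy, it arises by removing from $F$ an open annulus neighbourhood of $\partial D$, for some compressing disk $D$, gluing in two parallel copies of $D$, and smoothing the corners. **Proposition.** Let $K\subset S^3$ be a knot. 1. If $F$ and $F'$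 are closed surfaces in $S^3$ and $F'$ is obtained from $F$ by a compression, then $c(K;F)\le c(K;F')$. 2. For every closed surface $F\subset S^3$, $c(K;F)\le c(K)$. Moreover $c(K;S^2)=c(K)$ for the standard sphere $S^2\subset S^3$, so that $c(K;F)\le c(K;S^2)=c(K)$. -/

import Mathlib

open Set Metric Module
open scoped Manifold ContDiff

noncomputable section

namespace SurfaceCrossing

/-- Euclidean `n`-space. -/
abbrev E (n : ℕ) : Type := EuclideanSpace ℝ (Fin n)

instance factFinrankFour : Fact (finrank ℝ (E 4) = 3 + 1) := ⟨by simp⟩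

/-- The 3-sphere, as the unit sphere of `ℝ⁴`, with Mathlib's smooth structure. -/
abbrev S3 : Type := Metric.sphere (0 : E 4) 1

/-! ### Knots and ambient isotopies -/

/-- The velocity at time `t` of the loop `t ↦ c (exp (i t))`. -/
def velocity {n : ℕ} (c : Circle → E n) (t : ℝ) : E n :=
  deriv (fun s : ℝ => c (Circle.exp s)) t

/-- A knot in the 3-sphere: a smooth embedding of the circle (an injective immersion, the circle
being compact). -/
structure Knot where
  toFun : Circle → S3
  smooth : ContMDiff (𝓡 1) (𝓡 3) ∞ toFun
  injective : Function.Injective toFun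
  immersion : ∀ t : ℝ, velocity (fun z => (toFun z : E 4)) t ≠ 0

/-- A smooth ambient isotopy of the 3-sphere; its end map is the one at time `1`. -/
structure AmbientIsotopy where
  toDiffeo : ℝ → (S3 ≃ₘ^∞⟮𝓡 3, 𝓡 3⟯ S3)
  smooth : ContMDiff (𝓘(ℝ, ℝ).prod (𝓡 3)) (𝓡 3) ∞ (fun q : ℝ × S3 => toDiffeo q.1 q.2)
  map_zero : ∀ x : S3, toDiffeo 0 x = x

/-- The end map of an ambient isotopy. -/
def AmbientIsotopy.final (Φ : AmbientIsotopy) (x : S3) : S3 := Φ.toDiffeo 1 x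

/-! ### Regular projections -/

/-- The set of multiple points of a loop. -/
def crossings {n : ℕ} (c : Circle → E n) : Set (E n) :=
  {x | ∃ z w : Circle, z ≠ w ∧ c z = x ∧ c w = x}

/-- A loop is in general position: it is an immersion whose only singularities are finitely many
transverse double points. For a loop that lies on a smooth surface in `ℝⁿ`, two branches through a
point are transverse in the surface exactly when their velocities are linearly independent. -/
structure IsRegularCurve {n : ℕ} (c : Circle → E n) : Prop where
  immersion : ∀ t : ℝ, velocity c t ≠ 0
  finite : (crossings c).Finite
  double : ∀ x, (c ⁻¹' {x}).encard ≤ 2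
  transverse : ∀ s t : ℝ, Circle.exp s ≠ Circle.exp t → c (Circle.exp s) = c (Circle.exp t) →
    LinearIndependent ℝ ![velocity c s, velocity c t]

/-! ### Closed surfaces in the 3-sphere -/

/-- `f` is a smooth function on the open set `U` of which `F ∩ U` is the zero set, and its
differential does not vanish along `F ∩ U`. -/
structure IsLocalDefiningFunction (F U : Set S3) (f : S3 → ℝ) : Prop where
  isOpen : IsOpen U
  smooth : ContMDiffOn (𝓡 3) 𝓘(ℝ, ℝ) ∞ f U
  zeroSet : F ∩ U = {x | x ∈ U ∧ f x = 0}
  regular : ∀ x ∈ F ∩ U, mfderiv (𝓡 3) 𝓘(ℝ, ℝ) f x ≠ 0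

/-- A closed surface in the 3-sphere: a nonempty compact smoothly embedded orientable surface
without boundary, not necessarily connected. A surface in the (orientable) 3-sphere is orientable
exactly when it is transversely orientable, i.e. carries a continuous field of tangent vectors of
the 3-sphere which is nowhere tangent to the surface. -/
structure IsClosedSurface (F : Set S3) : Prop where
  nonempty : F.Nonempty
  compact : IsCompact F
  embedded : ∀ x ∈ F, ∃ (U : Set S3) (f : S3 → ℝ), x ∈ U ∧ IsLocalDefiningFunction F U f
  orientable : ∃ X : (x : S3) → TangentSpace (𝓡 3) x,
    ContinuousOn (fun x => (⟨x, X x⟩ : TangentBundle (𝓡 3) S3)) F ∧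
    ∀ x ∈ F, ∀ (U : Set S3) (f : S3 → ℝ), x ∈ U → IsLocalDefiningFunction F U f →
      mfderiv (𝓡 3) 𝓘(ℝ, ℝ) f x (X x) ≠ 0

/-- The standard (equatorial) 2-sphere in the 3-sphere. -/
def standardSphere : Set S3 := {x | (x : E 4) 3 = 0}

/-! ### Diagrams on a surface and the surface crossing number -/

/-- A closed regular neighbourhood `N(F) ≅ F × [-1, 1]` of `F` in the 3-sphere, together with its
product structure, given by the two projections `proj : N(F) → F` and `height : N(F) → [-1, 1]`.
Both are smooth (on an open set containing `N(F)`), together they map the compact set `N(F)`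
bijectively and with injective differential to `F × [-1, 1]`, that is, diffeomorphically; and the
points of `F` correspond to `F × {0}`. -/
structure RegularNeighborhood (F : Set S3) where
  carrier : Set S3
  domain : Set S3
  proj : S3 → S3
  height : S3 → ℝ
  compact : IsCompact carrier
  isOpen_domain : IsOpen domain
  carrier_subset : carrier ⊆ domain
  smooth_proj : ContMDiffOn (𝓡 3) (𝓡 3) ∞ proj domain
  smooth_height : ContMDiffOn (𝓡 3) 𝓘(ℝ, ℝ) ∞ height domain
  bijOn : BijOn (fun x => (proj x, height x)) carrier (F ×ˢ Icc (-1 : ℝ) 1)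
  immersion : ∀ x ∈ carrier, ∀ v : TangentSpace (𝓡 3) x,
    mfderiv (𝓡 3) (𝓡 3) proj x v = 0 → mfderiv (𝓡 3) 𝓘(ℝ, ℝ) height x v = 0 → v = 0
  core : ∀ x ∈ F, x ∈ carrier ∧ proj x = x ∧ height x = 0

/-- The projection to `F` of the loop `c`. -/
def RegularNeighborhood.shadow {F : Set S3} (N : RegularNeighborhood F) (c : Circle → S3) :
    Circle → E 4 :=
  fun z => (N.proj (c z) : E 4)

/-- The loop `c` lies in the interior of `N(F)` and is in regular position with respect to `F`.
(Over/under information at the crossings is given by the height; if `c` is injective, the two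
heights at a crossing are different.) -/
def RegularNeighborhood.InRegularPosition {F : Set S3} (N : RegularNeighborhood F)
    (c : Circle → S3) : Prop :=
  (∀ z, c z ∈ interior N.carrier) ∧ IsRegularCurve (N.shadow c)

/-- The surface crossing number `c(K; F)`: the least number of crossings of a regular diagram on
`F` obtained by an ambient isotopy of `K` into a regular neighbourhood of `F`. -/
def surfaceCrossingNumber (K : Knot) (F : Set S3) : ℕ∞ :=
  ⨅ (N : RegularNeighborhood F) (Φ : AmbientIsotopy)
    (_ : N.InRegularPosition (Φ.final ∘ K.toFun)),
    (crossings (N.shadow (Φ.final ∘ K.toFun))).encard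

/-! ### The classical crossing number -/

/-- Stereographic projection from the pole `(0, 0, 0, 1)` to `ℝ³`. -/
def stereo (x : S3) : E 3 :=
  !₂[(x : E 4) 0 / (1 - (x : E 4) 3), (x : E 4) 1 / (1 - (x : E 4) 3),
    (x : E 4) 2 / (1 - (x : E 4) 3)]

/-- The orthogonal projection of `ℝ³` to the plane of the first two coordinates. -/
def planeProj (y : E 3) : E 2 := !₂[y 0, y 1]

/-- The planar projection of a loop in the 3-sphere minus the pole, i.e. in `ℝ³`. -/
def planarShadow (c : Circle → S3) : Circle → E 2 := fun z => planeProj (stereo (c z))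

/-- The classical crossing number `c(K)`: the least number of crossings of a regular planar diagram
of `K`, that is, of a regular projection to `ℝ²` of a knot in `ℝ³ = S³ - {pole}` that is ambient
isotopic to `K` in the 3-sphere. -/
def crossingNumber (K : Knot) : ℕ∞ :=
  ⨅ (Φ : AmbientIsotopy)
    (_ : (∀ z, (Φ.final (K.toFun z) : E 4) 3 ≠ 1) ∧
      IsRegularCurve (planarShadow (Φ.final ∘ K.toFun))),
    (crossings (planarShadow (Φ.final ∘ K.toFun))).encard

/-! ### Compressions -/

/-- The open solid cylinder `{x² + y² < 4, |t| < 2}` in `ℝ³`. -/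
def box : Set (E 3) := {x | x 0 ^ 2 + x 1 ^ 2 < 4 ∧ |x 2| < 2}

/-- The square of the radius, at level `t`, of the surface `{x² + y² = capProfile t}` that
replaces the cylinder `{x² + y² = 1}`. The function is smooth and even, equals `1` for `|t| ≥ 1`,
has a simple zero at `±1/√2` and is negative in between. Thus the surface consists of the two ends
of the cylinder, each of them closed off by a smooth parallel copy of the disk `{t = 0}`. -/
def capProfile (t : ℝ) : ℝ := 2 * Real.smoothTransition (t ^ 2) - 1

/-- A compressing disk for `F` with a product neighbourhood: a smooth embedding `φ` of the solid
cylinder in the 3-sphere in which `F` appears as `{x² + y² = 1}`. The disk is the image of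
`{x² + y² ≤ 1, t = 0}`; it meets `F` exactly in its boundary, transversely, and its boundary is
essential in `F`, that is, does not bound a disk in `F`. -/
structure IsCompressingDisk (F : Set S3) (φ : E 3 → S3) : Prop where
  smooth : ContMDiffOn (𝓡 3) (𝓡 3) ∞ φ box
  injOn : InjOn φ box
  immersion : ∀ x ∈ box, Function.Injective (mfderiv (𝓡 3) (𝓡 3) φ x)
  inter_eq : F ∩ φ '' box = φ '' {x | x ∈ box ∧ x 0 ^ 2 + x 1 ^ 2 = 1}
  essential : ¬ ∃ j : E 2 → S3, ContinuousOn j (closedBall 0 1) ∧ InjOn j (closedBall 0 1) ∧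
    j '' closedBall 0 1 ⊆ F ∧
    j '' sphere 0 1 = φ '' {x | x 0 ^ 2 + x 1 ^ 2 = 1 ∧ x 2 = 0}

/-- The result of surgery on `F` along the disk described by `φ`: an annulus of `F` around the
boundary of the disk is removed and replaced by two parallel copies of the disk, the corners being
smoothed. -/
def surgery (F : Set S3) (φ : E 3 → S3) : Set S3 :=
  (F \ φ '' box) ∪ φ '' {x | x ∈ box ∧ x 0 ^ 2 + x 1 ^ 2 = capProfile (x 2)}

/-- `F'` is obtained from `F` by a compression. As smoothing the corners is well defined up to
isotopy only, `F'` is taken up to ambient isotopy. -/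
def IsCompression (F F' : Set S3) : Prop :=
  ∃ (φ : E 3 → S3) (Ψ : AmbientIsotopy), IsCompressingDisk F φ ∧ F' = Ψ.final '' surgery F φ

end SurfaceCrossing

end

open Set Metric Module Topology Filter
open scoped Manifold ContDiff

noncomputable section

namespace SurfaceCrossing

set_option linter.unusedSectionVars false

/-! ### The inverse function theorem on manifolds -/

/-! A diagram survives whenever the knot is moved along the fibres of a projection, or the
projection is changed by an isotopy of the whole picture. All three assertions are reduced to such
moves.

Planar diagrams on a surface. A regular neighbourhood of any surface contains a product chart, in
which the projection to the surface is the vertical projection of `ℝ³`. By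
`exists_ambientIsotopy_chart_to_chart` a compact subset of a convex chart can be isotoped into any
other chart by a map that is a diagonal linear map in coordinates. Diagonal maps respect vertical
lines, so the planar diagram becomes a diagram on the surface with the same crossings. This gives
`surfaceCrossingNumber_le_crossingNumber`.

The standard sphere. A smooth curve misses a point `q` of the sphere, for reasons of dimension. Over
the complement of `q` the neighbourhood is `ℝ² × (-1, 1)`, again a convex chart with vertical
projection, and the same theorem moves the knot to `ℝ³`. This gives
`crossingNumber_le_surfaceCrossingNumber`.

Compressions. Let `F'` be the surgered surface. A diagram on `F'` can be pushed off the centres of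
the two parallel disks by an isotopy preserving `F'` (`exists_push`), and then by compactness it
avoids a neighbourhood of these centres. Squeezing the cylinder of `F` towards its axis makes `F`
coincide with `F'` outside a thin solid tube that the diagram does not meet
(`IsCompressingDisk.exists_squeeze`). So the diagram lies on the common part of two surfaces. A
regular neighbourhood of the squeezed surface is chosen whose projection agrees with the old one
near the diagram (`IsTube.glue`), and the knot is shrunk along the old fibres into it
(`surfaceCrossingNumber_le_of_agree`). The number of crossings is unchanged.

Two tools underlie this. Isotopies are composed from compactly supported perturbations `id + g` with
`g` of Lipschitz constant less than one, moves along the fibres of a product neighbourhood being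
built in the same way from perturbations of the interval; larger moves are obtained by iteration,
without integrating vector fields. Regular neighbourhoods come from a tube, that is, a defining
function together with a smooth retraction. For a closed surface the transverse field yields a
global defining function, and following its gradient to the zero set yields the retraction. -/

theorem injective_mfderiv_of_leftInverse {V V' H H' M N : Type*} [NormedAddCommGroup V]
    [NormedSpace ℝ V] [NormedAddCommGroup V'] [NormedSpace ℝ V'] [TopologicalSpace H]
    [TopologicalSpace H'] {I : ModelWithCorners ℝ V H} {J : ModelWithCorners ℝ V' H'}
    [TopologicalSpace M] [ChartedSpace H M] [TopologicalSpace N] [ChartedSpace H' N]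
    {f : M → N} {g : N → M} {x : M} (hf : MDifferentiableAt I J f x)
    (hg : MDifferentiableAt J I g (f x)) (h : ∀ᶠ y in 𝓝 x, g (f y) = y) :
    Function.Injective (mfderiv I J f x) := by
  have h1 : mfderiv I I (g ∘ f) x = mfderiv I I (id : M → M) x :=
    Filter.EventuallyEq.mfderiv_eq h
  rw [mfderiv_comp x hg hf, mfderiv_id] at h1
  intro v w hvw
  have hv := congrArg (fun L => L v) h1
  have hw := congrArg (fun L => L w) h1
  simp only [ContinuousLinearMap.comp_apply] at hv hw
  rw [hvw] at hv
  exact hv.symm.trans hw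

section InverseFunction


variable {V V' : Type*} [NormedAddCommGroup V] [NormedSpace ℝ V] [CompleteSpace V]
  [NormedAddCommGroup V'] [NormedSpace ℝ V']

/-- The usual inverse function theorem gives smoothness of the inverse at one point. Shrinking the
source to the open set where the derivative is invertible gives it on the whole target. -/
theorem exists_openPartialHomeomorph_of_isInvertible {f : V → V'} {U : Set V} (hU : IsOpen U)
    (hf : ContDiffOn ℝ ∞ f U) {a : V} (ha : a ∈ U) (hinv : (fderiv ℝ f a).IsInvertible) :
    ∃ e : OpenPartialHomeomorph V V', a ∈ e.source ∧ e.source ⊆ U ∧ (∀ x, e x = f x) ∧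
      ContDiffOn ℝ ∞ e e.source ∧ ContDiffOn ℝ ∞ e.symm e.target := by
  have hfa : ∀ x ∈ U, ContDiffAt ℝ ∞ f x := fun x hx => hf.contDiffAt (hU.mem_nhds hx)
  obtain ⟨f', hf'⟩ := hinv
  have hd : HasFDerivAt f (f' : V →L[ℝ] V') a := by
    rw [hf']; exact ((hfa a ha).differentiableAt (by simp)).hasFDerivAt
  set e0 := (hfa a ha).toOpenPartialHomeomorph f hd (by simp) with he0
  have hcont : ContinuousOn (fderiv ℝ f) U := hf.continuousOn_fderiv_of_isOpen hU (by simp)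
  have hW : IsOpen (U ∩ fderiv ℝ f ⁻¹' range ((↑) : (V ≃L[ℝ] V') → (V →L[ℝ] V'))) :=
    hcont.isOpen_inter_preimage hU (ContinuousLinearEquiv.isOpen (E := V) (F := V'))
  set W := U ∩ fderiv ℝ f ⁻¹' range ((↑) : (V ≃L[ℝ] V') → (V →L[ℝ] V')) with hWdef
  have haW : a ∈ W := ⟨ha, f', hf'⟩
  refine ⟨e0.restrOpen W hW, ⟨?_, haW⟩, fun x hx => hx.2.1, fun x => rfl, ?_, ?_⟩
  · exact (hfa a ha).mem_toOpenPartialHomeomorph_source hd (by simp)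
  · intro x hx
    exact (hfa x hx.2.1).contDiffWithinAt
  · intro y hy
    have hy' := (e0.restrOpen W hW).map_target hy
    obtain ⟨L, hL⟩ := hy'.2.2
    refine ((e0.restrOpen W hW).contDiffAt_symm hy (f₀' := L) ?_ ?_).contDiffWithinAt
    · rw [hL]; exact ((hfa _ hy'.2.1).differentiableAt (by simp)).hasFDerivAt
    · exact hfa _ hy'.2.1

variable [FiniteDimensional ℝ V] [FiniteDimensional ℝ V'] {M N : Type*} [TopologicalSpace M] [ChartedSpace V M]
  [IsManifold 𝓘(ℝ, V) ∞ M]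
  [TopologicalSpace N] [ChartedSpace V' N] [IsManifold 𝓘(ℝ, V') ∞ N]

theorem isLocalDiffeomorphAt_of_injective_mfderiv {f : M → N} {U : Set M} (hU : IsOpen U)
    (hf : ContMDiffOn 𝓘(ℝ, V) 𝓘(ℝ, V') ∞ f U) {x : M} (hx : x ∈ U)
    (hdim : finrank ℝ V = finrank ℝ V')
    (hinv : Function.Injective (mfderiv 𝓘(ℝ, V) 𝓘(ℝ, V') f x)) :
    IsLocalDiffeomorphAt 𝓘(ℝ, V) 𝓘(ℝ, V') ∞ f x := by
  have hfx : ContMDiffAt 𝓘(ℝ, V) 𝓘(ℝ, V') ∞ f x := hf.contMDiffAt (hU.mem_nhds hx)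
  set c := chartAt V x
  set c' := chartAt V' (f x)
  set W : Set M := (U ∩ f ⁻¹' c'.source) with hW
  have hWo : IsOpen W := hf.continuousOn.isOpen_inter_preimage hU c'.open_source
  set g : V → V' := fun v => c' (f (c.symm v)) with hg
  set O : Set V := c.target ∩ c.symm ⁻¹' W with hO
  have hOo : IsOpen O := c.isOpen_inter_preimage_symm hWo
  have hcs : ContMDiffOn 𝓘(ℝ, V) 𝓘(ℝ, V) ∞ c.symm c.target := contMDiffOn_chart_symm
  have hc's : ContMDiffOn 𝓘(ℝ, V') 𝓘(ℝ, V') ∞ c' c'.source := contMDiffOn_chart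
  have hgO : ContDiffOn ℝ ∞ g O := by
    rw [← contMDiffOn_iff_contDiffOn]
    refine hc's.comp (hf.comp (hcs.mono inter_subset_left) fun v hv => hv.2.1) fun v hv => hv.2.2
  have hxs : x ∈ c.source := mem_chart_source V x
  have hcx : c x ∈ O := ⟨c.map_source hxs, by
    simp only [mem_preimage, c.left_inv hxs]; exact ⟨hx, mem_chart_source V' (f x)⟩⟩
  have hinv' : (fderiv ℝ g (c x)).IsInvertible := by
    have h1 : MDifferentiableAt 𝓘(ℝ, V) 𝓘(ℝ, V') f x := hfx.mdifferentiableAt (by simp)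
    -- The manifold derivative at `x` is by definition the derivative read in the preferred charts
    -- at `x` and `f x`, which is `g`.
    have h2 : (fderiv ℝ g (c x) : V →L[ℝ] V') = mfderiv 𝓘(ℝ, V) 𝓘(ℝ, V') f x := by
      have h3 := h1.mfderiv
      refine Eq.trans ?_ h3.symm
      have h4 : range (𝓘(ℝ, V) : V → V) = univ := by simp
      rw [h4, fderivWithin_univ]
      rfl
    have h5 : Function.Injective (fderiv ℝ g (c x) : V →L[ℝ] V') := by
      rw [h2]; exact hinv
    exact ⟨(LinearEquiv.ofInjectiveOfFinrankEq (fderiv ℝ g (c x) : V →ₗ[ℝ] V') h5 hdim).toContinuousLinearEquiv, by ext; rfl⟩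
  obtain ⟨e, hea, heO, heg, hes, het⟩ :=
    exists_openPartialHomeomorph_of_isInvertible hOo hgO hcx hinv'
  set E := (c.trans e).trans c'.symm with hE
  have hsrc : ∀ y ∈ E.source, y ∈ c.source ∧ y ∈ W ∧ c y ∈ e.source := by
    intro y hy
    simp only [hE, OpenPartialHomeomorph.trans_source, mem_inter_iff, mem_preimage] at hy
    have := heO hy.1.2
    simp only [hO, mem_inter_iff, mem_preimage, c.left_inv hy.1.1] at this
    exact ⟨hy.1.1, this.2, hy.1.2⟩
  have hEf : ∀ y ∈ E.source, E y = f y := by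
    intro y hy
    obtain ⟨h1, h2, h3⟩ := hsrc y hy
    simp only [hE, OpenPartialHomeomorph.coe_trans, Function.comp_apply, heg, hg, c.left_inv h1]
    exact c'.left_inv h2.2
  refine ⟨{ toPartialEquiv := E.toPartialEquiv, open_source := E.open_source,
            open_target := E.open_target, contMDiffOn_toFun := ?_, contMDiffOn_invFun := ?_ },
          ?_, fun y hy => (hEf y hy).symm⟩
  · exact (hf.mono fun y hy => (hsrc y hy).2.1.1).congr fun y hy => hEf y hy
  · have h1 : ContMDiffOn 𝓘(ℝ, V') 𝓘(ℝ, V) ∞ e.symm e.target := het.contMDiffOn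
    have h1s : E.target ⊆ c'.source := by intro y hy; simp [hE] at hy; exact hy.1
    refine (hcs.comp (h1.comp (hc's.mono (h1s : E.target ⊆ c'.source)) ?_) ?_)
    · intro y hy; simp [hE] at hy; exact hy.2.1
    · intro y hy; simp [hE] at hy; exact hy.2.2
  · change x ∈ E.source
    simp only [hE, OpenPartialHomeomorph.trans_source, mem_inter_iff, mem_preimage,
      OpenPartialHomeomorph.coe_trans, Function.comp_apply, heg, hg, c.left_inv hxs,
      OpenPartialHomeomorph.symm_source]
    exact ⟨⟨hxs, hea⟩, c'.map_source (mem_chart_source V' (f x))⟩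

/-- An injective smooth map that is a local diffeomorphism along an open set, as a partial
diffeomorphism. -/
theorem exists_partialDiffeomorph [Nonempty M] {f : M → N} {U : Set M} (hU : IsOpen U) (hinj : InjOn f U)
    (hloc : ∀ x ∈ U, IsLocalDiffeomorphAt 𝓘(ℝ, V) 𝓘(ℝ, V') ∞ f x) :
    ∃ Φ : PartialDiffeomorph 𝓘(ℝ, V) 𝓘(ℝ, V') M N ∞, Φ.source = U ∧ (∀ x, Φ x = f x) ∧
      Φ.target = f '' U := by
  -- These local inverses take values in `U` near `f x`. They give openness of the image, and by
  -- injectivity they agree with the global inverse, which is therefore smooth.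
  have hinv : ∀ x ∈ U, ∃ g : N → M, ContMDiffAt 𝓘(ℝ, V') 𝓘(ℝ, V) ∞ g (f x) ∧
      ∀ᶠ y in 𝓝 (f x), g y ∈ U ∧ f (g y) = y := by
    intro x hx
    refine ⟨(hloc x hx).localInverse, (hloc x hx).localInverse_contMDiffAt, ?_⟩
    have h1 : ContinuousAt (hloc x hx).localInverse (f x) :=
      (hloc x hx).localInverse_contMDiffAt.continuousAt
    have h2 : (hloc x hx).localInverse (f x) = x :=
      (hloc x hx).localInverse_left_inv (hloc x hx).localInverse_mem_target
    have h3 := h1.eventually (by rw [h2]; exact hU.mem_nhds hx)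
    filter_upwards [h3, (hloc x hx).localInverse_eventuallyEq_right] with y hy hy'
    exact ⟨hy, hy'⟩
  have hopen : IsOpen (f '' U) := by
    rw [isOpen_iff_mem_nhds]
    rintro _ ⟨x, hx, rfl⟩
    obtain ⟨g, -, hg⟩ := hinv x hx
    filter_upwards [hg] with y hy using ⟨g y, hy.1, hy.2⟩
  refine ⟨{ toPartialEquiv := InjOn.toPartialEquiv f U hinj, open_source := hU, open_target := hopen
            contMDiffOn_toFun := fun x hx => (hloc x hx).contMDiffAt.contMDiffWithinAt
            contMDiffOn_invFun := ?_ }, rfl, fun x => rfl, rfl⟩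
  rintro _ ⟨x, hx, rfl⟩
  obtain ⟨g, hg1, hg⟩ := hinv x hx
  refine (hg1.congr_of_eventuallyEq ?_).contMDiffWithinAt
  filter_upwards [hg] with y hy
  conv_lhs => rw [← hy.2]
  exact (InjOn.toPartialEquiv f U hinj).left_inv hy.1

/-- A smooth map with a smooth left inverse, between manifolds of the same dimension, is a partial
diffeomorphism. -/
theorem exists_partialDiffeomorph_of_leftInverse [Nonempty M] {f : M → N} {g : N → M} {U : Set M} {W : Set N}
    (hU : IsOpen U) (hW : IsOpen W) (hf : ContMDiffOn 𝓘(ℝ, V) 𝓘(ℝ, V') ∞ f U)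
    (hg : ContMDiffOn 𝓘(ℝ, V') 𝓘(ℝ, V) ∞ g W) (hUW : MapsTo f U W)
    (hgf : ∀ x ∈ U, g (f x) = x) (hdim : finrank ℝ V = finrank ℝ V') :
    ∃ Φ : PartialDiffeomorph 𝓘(ℝ, V) 𝓘(ℝ, V') M N ∞, Φ.source = U ∧ (∀ x, Φ x = f x) ∧
      Φ.target = f '' U := by
  refine exists_partialDiffeomorph hU (fun x hx y hy h => ?_) fun x hx => ?_
  · rw [← hgf x hx, h, hgf y hy]
  refine isLocalDiffeomorphAt_of_injective_mfderiv hU hf hx hdim ?_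
  have h1 : MDifferentiableAt 𝓘(ℝ, V) 𝓘(ℝ, V') f x :=
    (hf.contMDiffAt (hU.mem_nhds hx)).mdifferentiableAt (by simp)
  have h2 : MDifferentiableAt 𝓘(ℝ, V') 𝓘(ℝ, V) g (f x) :=
    (hg.contMDiffAt (hW.mem_nhds (hUW hx))).mdifferentiableAt (by simp)
  exact injective_mfderiv_of_leftInverse h1 h2
    (by filter_upwards [hU.mem_nhds hx] with y hy using hgf y hy)

end InverseFunction

/-! ### Small perturbations of the identity -/

/-- A perturbation with Lipschitz constant `k < 1` approximates the identity well enough for the map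
to be a global homeomorphism. Its derivative `1 + dg` is injective because `‖dg‖ ≤ k < 1`, hence the
inverse is smooth. -/
theorem exists_diffeomorph_id_add {V : Type*} [NormedAddCommGroup V] [NormedSpace ℝ V]
    [FiniteDimensional ℝ V] {g : V → V} (hg : ContDiff ℝ ∞ g) {k : NNReal}
    (hk : k < 1) (hlip : LipschitzWith k g) :
    ∃ G : V ≃ₘ^∞⟮𝓘(ℝ, V), 𝓘(ℝ, V)⟯ V, ∀ x, G x = x + g x := by
  have hcomp : CompleteSpace V := FiniteDimensional.complete ℝ V
  have happ : ApproximatesLinearOn (fun x => x + g x)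
      ((ContinuousLinearEquiv.refl ℝ V : V ≃L[ℝ] V) : V →L[ℝ] V) univ k := by
    intro x _ y _
    have := hlip.dist_le_mul x y
    rw [dist_eq_norm, dist_eq_norm] at this
    convert! this using 2
    simp
    abel
  have hc : Subsingleton V ∨
      k < ‖((ContinuousLinearEquiv.refl ℝ V).symm : V →L[ℝ] V)‖₊⁻¹ := by
    rcases subsingleton_or_nontrivial V with h | h
    · exact Or.inl h
    · right
      have : ‖((ContinuousLinearEquiv.refl ℝ V).symm : V →L[ℝ] V)‖₊ = 1 := by
        apply NNReal.eq; exact ContinuousLinearMap.norm_id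
      rw [this]; simpa using hk
  set h := happ.toHomeomorph (fun x => x + g x) hc with hh
  have hsm : ContDiff ℝ ∞ (fun x => x + g x) := contDiff_id.add hg
  have hinj : ∀ x, Function.Injective (fderiv ℝ (fun x => x + g x) x) := by
    intro x
    have hdg : DifferentiableAt ℝ g x := hg.differentiable (by simp) x
    have h1 : fderiv ℝ (fun x => x + g x) x = ContinuousLinearMap.id ℝ V + fderiv ℝ g x := by
      rw [fderiv_fun_add differentiableAt_fun_id hdg, fderiv_fun_id]
    rw [h1, injective_iff_map_eq_zero]
    intro v hv
    have h2 : v = - fderiv ℝ g x v := eq_neg_of_add_eq_zero_left hv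
    have h3 : ‖fderiv ℝ g x v‖ ≤ k * ‖v‖ :=
      (fderiv ℝ g x).le_of_opNorm_le (norm_fderiv_le_of_lipschitz ℝ hlip) v
    have h4 : ‖v‖ = ‖fderiv ℝ g x v‖ := by conv_lhs => rw [h2, norm_neg]
    have h5 : (k : ℝ) < 1 := hk
    by_contra h6
    have := norm_pos_iff.2 h6
    nlinarith
  have hsymm : ContDiff ℝ ∞ h.symm := by
    refine h.contDiff_symm (f₀' := fun x => (LinearEquiv.ofInjectiveOfFinrankEq
      (fderiv ℝ (fun x => x + g x) x : V →ₗ[ℝ] V) (hinj x) rfl).toContinuousLinearEquiv) ?_ hsm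
    intro x
    exact (hsm.differentiable (by simp) x).hasFDerivAt
  exact ⟨{ toEquiv := h.toEquiv, contMDiff_toFun := hsm.contMDiff,
           contMDiff_invFun := hsymm.contMDiff }, fun x => rfl⟩

theorem exists_lipschitzWith_of_hasCompactSupport {V W : Type*} [NormedAddCommGroup V]
    [NormedSpace ℝ V] [NormedAddCommGroup W] [NormedSpace ℝ W] {g : V → W} (hg : ContDiff ℝ ∞ g)
    (hs : HasCompactSupport g) : ∃ k : NNReal, LipschitzWith k g :=
  hg.lipschitzWith_of_hasCompactSupport hs (by simp)

/-! ### Ambient isotopies -/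

namespace AmbientIsotopy

/-- The constant isotopy. -/
def refl : AmbientIsotopy where
  toDiffeo _ := Diffeomorph.refl (𝓡 3) S3 ∞
  smooth := contMDiff_snd
  map_zero _ := rfl

/-- The end map of an ambient isotopy, as a diffeomorphism. -/
def diffeo (Φ : AmbientIsotopy) : S3 ≃ₘ^∞⟮𝓡 3, 𝓡 3⟯ S3 := Φ.toDiffeo 1

theorem final_eq (Φ : AmbientIsotopy) (x : S3) : Φ.final x = Φ.diffeo x := rfl

theorem contMDiff_final (Φ : AmbientIsotopy) : ContMDiff (𝓡 3) (𝓡 3) ∞ Φ.final :=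
  Φ.diffeo.contMDiff

/-- First `Φ`, then `Ψ`. -/
def trans (Φ Ψ : AmbientIsotopy) : AmbientIsotopy where
  toDiffeo t := (Φ.toDiffeo t).trans (Ψ.toDiffeo t)
  smooth := Ψ.smooth.comp (contMDiff_fst.prodMk Φ.smooth)
  map_zero x := by
    change Ψ.toDiffeo 0 (Φ.toDiffeo 0 x) = x
    rw [Φ.map_zero, Ψ.map_zero]

@[simp] theorem trans_final (Φ Ψ : AmbientIsotopy) (x : S3) :
    (Φ.trans Ψ).final x = Ψ.final (Φ.final x) := rfl

/-- An ambient isotopy that ends with the inverse of the end map of `Φ`. -/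
def symm (Φ : AmbientIsotopy) : AmbientIsotopy where
  -- The path is run backwards after undoing its end, so that it starts at the identity; at time `1`
  -- the remaining factor is `Φ₀ = id`.
  toDiffeo t := (Φ.toDiffeo 1).symm.trans (Φ.toDiffeo (1 - t))
  smooth := by
    have h1 : ContMDiff (𝓘(ℝ, ℝ).prod (𝓡 3)) 𝓘(ℝ, ℝ) ∞ (fun q : ℝ × S3 => 1 - q.1) :=
      (contDiff_const.sub contDiff_id).contMDiff.comp contMDiff_fst
    exact Φ.smooth.comp (h1.prodMk ((Φ.toDiffeo 1).symm.contMDiff.comp contMDiff_snd))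
  map_zero x := by
    change Φ.toDiffeo (1 - 0) ((Φ.toDiffeo 1).symm x) = x
    rw [sub_zero]; exact (Φ.toDiffeo 1).apply_symm_apply x

@[simp] theorem symm_final (Φ : AmbientIsotopy) (x : S3) : Φ.symm.final x = Φ.diffeo.symm x := by
  change Φ.toDiffeo (1 - 1) ((Φ.toDiffeo 1).symm x) = _
  rw [sub_self, Φ.map_zero]; rfl

@[simp] theorem symm_final_final (Φ : AmbientIsotopy) (x : S3) : Φ.symm.final (Φ.final x) = x := by
  rw [symm_final]; exact Φ.diffeo.symm_apply_apply x

@[simp] theorem final_symm_final (Φ : AmbientIsotopy) (x : S3) : Φ.final (Φ.symm.final x) = x := by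
  rw [symm_final]; exact Φ.diffeo.apply_symm_apply x

theorem injective_final (Φ : AmbientIsotopy) : Function.Injective Φ.final := Φ.diffeo.injective

end AmbientIsotopy

/-- Parametrizations of open subsets of the 3-sphere by open subsets of `ℝ³`. -/
abbrev Chart : Type := PartialDiffeomorph (𝓡 3) (𝓡 3) (E 3) S3 ∞

/-- The self-map of the 3-sphere that is `G` in the chart `ψ` and the identity elsewhere. -/
def chartMap (ψ : Chart) (G : E 3 → E 3) (x : S3) : S3 :=
  open Classical in if x ∈ ψ.target then ψ (G (ψ.symm x)) else x

theorem chartMap_apply (ψ : Chart) (G : E 3 → E 3) {y : E 3} (hy : y ∈ ψ.source) :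
    chartMap ψ G (ψ y) = ψ (G y) := by
  rw [chartMap, if_pos (ψ.map_source hy)]
  congr 2
  exact ψ.left_inv hy

theorem chartMap_of_notMem (ψ : Chart) {G : E 3 → E 3} {Q : Set (E 3)}
    (hG : ∀ y ∉ Q, G y = y) {x : S3} (hx : x ∉ ψ '' Q) : chartMap ψ G x = x := by
  rw [chartMap]
  split_ifs with h
  · rw [hG]
    · exact ψ.right_inv h
    · intro h'
      exact hx ⟨_, h', ψ.right_inv h⟩
  · rfl

theorem mapsTo_of_eq_self {α : Type*} {G : α → α} (hinj : Function.Injective G) {Q U : Set α}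
    (hQU : Q ⊆ U) (hG : ∀ y ∉ Q, G y = y) : MapsTo G U U := by
  intro y hy
  by_contra h
  have h1 : G (G y) = G y := hG _ fun h' => h (hQU h')
  exact h (by rw [hinj h1]; exact hy)

/-- The chart domain and the complement of the compact, hence closed, image of `Q` form an open
cover. On the first the map is a composition of smooth maps, on the second it is the identity. -/
theorem contMDiff_chartMap (ψ : Chart) {Q : Set (E 3)} (hQ : IsCompact Q) (hQs : Q ⊆ ψ.source)
    {G : ℝ → E 3 → E 3} (hG : ContDiff ℝ ∞ fun q : ℝ × E 3 => G q.1 q.2)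
    (hmaps : ∀ s, MapsTo (G s) ψ.source ψ.source) (hid : ∀ s, ∀ y ∉ Q, G s y = y) :
    ContMDiff (𝓘(ℝ, ℝ).prod (𝓡 3)) (𝓡 3) ∞ (fun q : ℝ × S3 => chartMap ψ (G q.1) q.2) := by
  rintro ⟨s, x⟩
  by_cases hx : x ∈ ψ.target
  · have hU : IsOpen (univ ×ˢ ψ.target : Set (ℝ × S3)) := isOpen_univ.prod ψ.open_target
    have h1 : ContMDiffOn (𝓘(ℝ, ℝ).prod (𝓡 3)) (𝓡 3) ∞
        (fun q : ℝ × S3 => ψ (G q.1 (ψ.symm q.2))) (univ ×ˢ ψ.target) := by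
      have h2 : ContMDiffOn (𝓘(ℝ, ℝ).prod (𝓡 3)) (𝓡 3) ∞
          (fun q : ℝ × S3 => ψ.symm q.2) (univ ×ˢ ψ.target) :=
        ψ.symm.contMDiffOn.comp contMDiffOn_snd fun q hq => hq.2
      have h3 : ContMDiff (𝓘(ℝ, ℝ).prod (𝓡 3)) (𝓡 3) ∞ (fun q : ℝ × E 3 => G q.1 q.2) := by
        have := hG.contMDiff
        rwa [modelWithCornersSelf_prod, ← chartedSpaceSelf_prod] at this
      refine ψ.contMDiffOn.comp (h3.comp_contMDiffOn (contMDiffOn_fst.prodMk h2)) ?_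
      intro q hq
      exact hmaps q.1 (ψ.symm.map_source hq.2)
    refine ((h1.contMDiffAt (hU.mem_nhds ⟨mem_univ _, hx⟩)).congr_of_eventuallyEq ?_)
    filter_upwards [hU.mem_nhds ⟨mem_univ s, hx⟩] with q hq
    rw [chartMap, if_pos hq.2]
  · have hQc : IsClosed (ψ '' Q) :=
      (hQ.image_of_continuousOn (ψ.contMDiffOn.continuousOn.mono hQs)).isClosed
    have hU : IsOpen (univ ×ˢ (ψ '' Q)ᶜ : Set (ℝ × S3)) := isOpen_univ.prod hQc.isOpen_compl
    have hx' : x ∈ (ψ '' Q)ᶜ := by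
      rintro ⟨y, hy, rfl⟩
      exact hx (ψ.map_source (hQs hy))
    refine (contMDiff_snd (s, x)).congr_of_eventuallyEq ?_
    filter_upwards [hU.mem_nhds ⟨mem_univ s, hx'⟩] with q hq
    exact chartMap_of_notMem ψ (hid q.1) hq.2

/-- A family of diffeomorphisms of `ℝ³` with compact support in a chart gives an ambient
isotopy. -/
theorem exists_ambientIsotopy_of_diffeomorph (ψ : Chart) {Q : Set (E 3)} (hQ : IsCompact Q)
    (hQs : Q ⊆ ψ.source) (G : ℝ → (E 3 ≃ₘ^∞⟮𝓡 3, 𝓡 3⟯ E 3))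
    (hG : ContDiff ℝ ∞ fun q : ℝ × E 3 => G q.1 q.2)
    (h0 : ∀ y, G 0 y = y) (hid : ∀ s, ∀ y ∉ Q, G s y = y) :
    ∃ Φ : AmbientIsotopy, (∀ y ∈ ψ.source, G 1 y ∈ ψ.source ∧ Φ.final (ψ y) = ψ (G 1 y)) ∧
      ∀ x ∉ ψ '' Q, Φ.final x = x := by
  have hid' : ∀ s, ∀ y ∉ Q, (G s).symm y = y := fun s y hy => by
    conv_lhs => rw [← hid s y hy]
    exact (G s).symm_apply_apply y
  have hmaps : ∀ s, MapsTo (G s) ψ.source ψ.source := fun s =>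
    mapsTo_of_eq_self (G s).injective hQs (hid s)
  have hmaps' : ∀ s, MapsTo (G s).symm ψ.source ψ.source := fun s =>
    mapsTo_of_eq_self (G s).symm.injective hQs (hid' s)
  have key : ∀ (A B : E 3 → E 3), (∀ y, B (A y) = y) → MapsTo A ψ.source ψ.source → ∀ x,
      chartMap ψ B (chartMap ψ A x) = x := by
    intro A B hBA hA x
    by_cases hx : x ∈ ψ.target
    · obtain ⟨y, hy, rfl⟩ : ∃ y ∈ ψ.source, ψ y = x := ⟨_, ψ.symm.map_source hx, ψ.right_inv hx⟩
      rw [chartMap_apply ψ A hy, chartMap_apply ψ B (hA hy), hBA]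
    · rw [chartMap, chartMap, if_neg hx, if_neg hx]
  have hcurry : ∀ {H : ℝ → S3 → S3},
      ContMDiff (𝓘(ℝ, ℝ).prod (𝓡 3)) (𝓡 3) ∞ (fun q : ℝ × S3 => H q.1 q.2) →
      ∀ s, ContMDiff (𝓡 3) (𝓡 3) ∞ (H s) := fun h s =>
    h.comp (contMDiff_const.prodMk contMDiff_id)
  have hsm := contMDiff_chartMap ψ hQ hQs hG hmaps hid
  refine ⟨{ toDiffeo := fun s =>
              { toFun := chartMap ψ (G s), invFun := chartMap ψ (G s).symm
                left_inv := key _ _ (G s).symm_apply_apply (hmaps s)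
                right_inv := key _ _ (G s).apply_symm_apply (hmaps' s)
                contMDiff_toFun := hcurry (H := fun s => chartMap ψ (G s)) hsm s
                contMDiff_invFun := ?_ }
            smooth := hsm
            map_zero := fun x => ?_ }, fun y hy => ⟨hmaps 1 hy, chartMap_apply ψ _ hy⟩,
    fun x hx => chartMap_of_notMem ψ (hid 1) hx⟩
  · refine hcurry (H := fun _ => chartMap ψ (G s).symm) (contMDiff_chartMap ψ hQ hQs
      (G := fun _ => (G s).symm) ?_ (fun _ => hmaps' s) (fun _ => hid' s)) 0
    exact (contMDiff_iff_contDiff.1 (G s).symm.contMDiff).comp contDiff_snd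
  · exact chartMap_of_notMem ψ (Q := ∅) (fun y _ => h0 y) (by simp)

/-- Small perturbations of the identity with compact support in a chart are end maps of ambient
isotopies. -/
theorem exists_ambientIsotopy_id_add (ψ : Chart) {Q : Set (E 3)} (hQ : IsCompact Q)
    (hQs : Q ⊆ ψ.source) {g : E 3 → E 3} (hg : ContDiff ℝ ∞ g) (hid : ∀ y ∉ Q, g y = 0)
    {k : NNReal} (hk : k < 1) (hlip : LipschitzWith k g) :
    ∃ Φ : AmbientIsotopy, (∀ y ∈ ψ.source, y + g y ∈ ψ.source ∧ Φ.final (ψ y) = ψ (y + g y)) ∧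
      ∀ x ∉ ψ '' Q, Φ.final x = x := by
  -- The factor `Real.smoothTransition s` runs from `0` at `s = 0` to `1` at `s = 1` and stays in
  -- `[0, 1]` for every real `s`, so the Lipschitz bound holds at all times.
  have hσ : ∀ s, ∃ G : E 3 ≃ₘ^∞⟮𝓡 3, 𝓡 3⟯ E 3,
      ∀ x, G x = x + Real.smoothTransition s • g x := by
    intro s
    have hsg : ContDiff ℝ ∞ fun x => Real.smoothTransition s • g x := hg.const_smul (Real.smoothTransition s)
    refine exists_diffeomorph_id_add hsg hk
      (LipschitzWith.of_dist_le_mul fun x y => ?_)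
    rw [dist_smul₀]
    have h1 := hlip.dist_le_mul x y
    have h2 : ‖Real.smoothTransition s‖ ≤ 1 := by
      rw [Real.norm_of_nonneg (Real.smoothTransition.nonneg s)]
      exact Real.smoothTransition.le_one s
    calc _ ≤ 1 * dist (g x) (g y) := by gcongr
      _ ≤ _ := by rw [one_mul]; exact h1
  choose G hG using hσ
  have hsm : ContDiff ℝ ∞ fun q : ℝ × E 3 => G q.1 q.2 := by
    simp_rw [hG]
    exact contDiff_snd.add ((Real.smoothTransition.contDiff.comp contDiff_fst).smul
      (hg.comp contDiff_snd))
  obtain ⟨Φ, h1, h2⟩ := exists_ambientIsotopy_of_diffeomorph ψ hQ hQs G hsm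
    (fun y => by rw [hG, Real.smoothTransition.zero, zero_smul, add_zero])
    (fun s y hy => by rw [hG, hid y hy, smul_zero, add_zero])
  refine ⟨Φ, fun y hy => ?_, h2⟩
  have := h1 y hy
  rwa [hG, Real.smoothTransition.one, one_smul] at this

/-! ### Moving disks: any two small embedded balls are ambient isotopic -/

/-- A smooth cutoff function for a compact subset of an open set. -/
theorem exists_cutoff {V : Type*} [NormedAddCommGroup V] [NormedSpace ℝ V] [FiniteDimensional ℝ V]
    {C O : Set V} (hC : IsCompact C) (hO : IsOpen O) (hCO : C ⊆ O) :
    ∃ (β : V → ℝ) (Q : Set V), ContDiff ℝ ∞ β ∧ IsCompact Q ∧ Q ⊆ O ∧ (∀ x ∉ Q, β x = 0) ∧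
      (∀ x, β x ∈ Icc (0 : ℝ) 1) ∧ ∀ x ∈ C, β x = 1 := by
  obtain ⟨Q, hQ, hCQ, hQO⟩ := exists_compact_between hC hO hCO
  obtain ⟨f, hf1, hf2, hf3⟩ := exists_contMDiffMap_one_nhds_of_subset_interior (n := ⊤) 𝓘(ℝ, V)
    hC.isClosed hCQ
  exact ⟨f, Q, f.contMDiff.contDiff, hQ, hQO, hf2, hf3, fun x hx => hf1.self_of_nhdsSet x hx⟩

theorem hasCompactSupport_of_zero {V W : Type*} [TopologicalSpace V] [T2Space V] [Zero W]
    {f : V → W} {Q : Set V} (hQ : IsCompact Q) (hf : ∀ x ∉ Q, f x = 0) : HasCompactSupport f :=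
  HasCompactSupport.intro hQ fun x hx => hf x hx

/-- A single small perturbation can only scale by a factor `1 - c` close to one. Its iterates scale
by arbitrarily small powers. -/
theorem exists_ambientIsotopy_contract (ψ : Chart) (hconv : Convex ℝ ψ.source)
    (h0 : (0 : E 3) ∈ ψ.source) {C : Set (E 3)} (hC : IsCompact C) (hCs : C ⊆ ψ.source)
    {η : ℝ} (hη : 0 < η) :
    ∃ ε, 0 < ε ∧ ε < η ∧ ∃ Φ : AmbientIsotopy, ∀ y ∈ C, Φ.final (ψ y) = ψ (ε • y) := by
  -- The cone over `C` with apex the origin is compact, lies in the convex source and is stable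
  -- under contraction. The cutoff is `1` on it, so every iterate acts there as an exact scaling.
  set C' : Set (E 3) := (fun q : ℝ × E 3 => q.1 • q.2) '' (Icc (0 : ℝ) 1 ×ˢ C) with hC'
  have hC'c : IsCompact C' := (isCompact_Icc.prod hC).image (by fun_prop)
  have hC's : C' ⊆ ψ.source := by
    rintro _ ⟨⟨t, y⟩, ⟨ht, hy⟩, rfl⟩
    exact hconv.smul_mem_of_zero_mem h0 (hCs hy) ht
  have hstar : ∀ t ∈ Icc (0 : ℝ) 1, ∀ y ∈ C', t • y ∈ C' := by
    rintro t ht _ ⟨⟨s, y⟩, ⟨hs, hy⟩, rfl⟩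
    exact ⟨(t * s, y), ⟨⟨mul_nonneg ht.1 hs.1, mul_le_one₀ ht.2 hs.1 hs.2⟩, hy⟩, mul_smul _ _ _⟩
  obtain ⟨β, Q, hβ, hQ, hQs, hβ0, -, hβ1⟩ := exists_cutoff hC'c ψ.open_source hC's
  have hg : ContDiff ℝ ∞ fun y => β y • y := hβ.smul contDiff_id
  obtain ⟨k, hk⟩ := exists_lipschitzWith_of_hasCompactSupport hg
    (hasCompactSupport_of_zero hQ fun x hx => by rw [hβ0 x hx, zero_smul])
  set c : NNReal := (2 * (k + 1))⁻¹ with hc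
  have hcpos : 0 < c := by positivity
  have hck : c * k < 1 := by
    rw [hc, inv_mul_lt_iff₀ (by positivity)]
    have : 0 ≤ k := zero_le
    rw [mul_one, mul_add, mul_one]
    calc k ≤ 2 * k := le_mul_of_one_le_left this (by norm_num)
      _ < 2 * k + 2 := lt_add_of_pos_right _ (by norm_num)
  have hc1 : (c : ℝ) < 1 := by
    rw [hc]; push_cast
    apply inv_lt_one_of_one_lt₀
    have : (0 : ℝ) ≤ k := k.2
    linarith
  obtain ⟨Φ, hΦ, -⟩ := exists_ambientIsotopy_id_add ψ hQ hQs (g := fun y => (-(c : ℝ)) • β y • y)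
    (hg.const_smul (-(c : ℝ))) (fun y hy => by rw [hβ0 y hy, zero_smul, smul_zero]) hck (by
      refine LipschitzWith.of_dist_le_mul fun x y => ?_
      rw [dist_smul₀, norm_neg, Real.norm_of_nonneg c.coe_nonneg]
      push_cast
      rw [mul_assoc]
      exact mul_le_mul_of_nonneg_left (hk.dist_le_mul x y) c.2)
  have hstep : ∀ y ∈ C', Φ.final (ψ y) = ψ ((1 - (c : ℝ)) • y) := by
    intro y hy
    rw [(hΦ y (hC's hy)).2, hβ1 y hy, one_smul]
    congr 1
    module
  have hpos : (0 : ℝ) < 1 - c := by linarith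
  have hlt : 1 - (c : ℝ) < 1 := by have : (0 : ℝ) < c := hcpos; linarith
  have hiter : ∀ n : ℕ, ∃ Φ : AmbientIsotopy, ∀ y ∈ C', Φ.final (ψ y) = ψ ((1 - (c : ℝ)) ^ n • y) := by
    intro n
    induction n with
    | zero => exact ⟨.refl, fun y _ => by rw [pow_zero, one_smul]; rfl⟩
    | succ n ih =>
      obtain ⟨Φ', h'⟩ := ih
      refine ⟨Φ'.trans Φ, fun y hy => ?_⟩
      rw [AmbientIsotopy.trans_final, h' y hy, hstep _ (hstar _ ⟨by positivity, ?_⟩ y hy), smul_smul,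
        pow_succ']
      exact pow_le_one₀ hpos.le hlt.le
  obtain ⟨n, hn⟩ := exists_pow_lt_of_lt_one hη hlt
  obtain ⟨Φ', h'⟩ := hiter n
  refine ⟨_, by positivity, hn, Φ', fun y hy => h' y ⟨(1, y), ⟨by simp, hy⟩, one_smul _ _⟩⟩

/-! ### Homogeneity of the 3-sphere -/

theorem exists_chart (p : S3) : ∃ (ψ : Chart), ∃ y ∈ ψ.source, ψ y = p := by
  let c := chartAt (E 3) p
  refine ⟨{ toPartialEquiv := c.symm.toPartialEquiv, open_source := c.open_target
            open_target := c.open_source, contMDiffOn_toFun := contMDiffOn_chart_symm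
            contMDiffOn_invFun := contMDiffOn_chart }, c p, ?_, ?_⟩
  · exact c.map_source (mem_chart_source (E 3) p)
  · exact c.left_inv (mem_chart_source (E 3) p)

theorem Chart.image_mem_nhds (ψ : Chart) {y : E 3} (hy : y ∈ ψ.source) {s : Set (E 3)}
    (hs : s ∈ 𝓝 y) : ψ '' s ∈ 𝓝 (ψ y) :=
  ψ.toOpenPartialHomeomorph.image_mem_nhds hy hs

theorem Chart.continuousAt (ψ : Chart) {y : E 3} (hy : y ∈ ψ.source) : ContinuousAt ψ y :=
  ψ.toOpenPartialHomeomorph.continuousAt hy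

/-- In a chart, the translation by `z - y` is cut off by `β`. The perturbation has Lipschitz
constant `k‖z - y‖`, which is less than one for `z` near `y`. -/
theorem exists_nhds_ambientIsotopy (p : S3) :
    ∀ᶠ q in 𝓝 p, ∃ Φ : AmbientIsotopy, Φ.final p = q := by
  obtain ⟨ψ, y, hy, rfl⟩ := exists_chart p
  obtain ⟨β, Q, hβ, hQ, hQs, hβ0, -, hβ1⟩ := exists_cutoff (isCompact_singleton (x := y))
    ψ.open_source (by simpa using hy)
  obtain ⟨k, hk⟩ := exists_lipschitzWith_of_hasCompactSupport hβ (hasCompactSupport_of_zero hQ hβ0)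
  refine mem_of_superset (ψ.image_mem_nhds hy (ball_mem_nhds y (ε := (1 / ((k : ℝ) + 1))) (by positivity))) ?_
  rintro _ ⟨z, hz, rfl⟩
  have hz' : k * ‖z - y‖₊ < 1 := by
    rw [mem_ball, dist_eq_norm, lt_div_iff₀ (by positivity)] at hz
    have h0 : 0 ≤ ‖z - y‖ := norm_nonneg _
    have : (k : ℝ) * ‖z - y‖ < 1 := by nlinarith
    exact_mod_cast this
  obtain ⟨Φ, hΦ, -⟩ := exists_ambientIsotopy_id_add ψ hQ hQs (g := fun x => β x • (z - y))
    (hβ.smul contDiff_const) (fun y hy => by rw [hβ0 y hy, zero_smul]) hz' (by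
      refine LipschitzWith.of_dist_le_mul fun x x' => ?_
      rw [dist_eq_norm, ← sub_smul, norm_smul, ← dist_eq_norm]
      push_cast
      calc _ ≤ (k * dist x x') * ‖z - y‖ := by gcongr; exact hk.dist_le_mul x x'
        _ = _ := by ring)
  refine ⟨Φ, ?_⟩
  rw [(hΦ y hy).2, hβ1 y rfl]
  simp

instance : PreconnectedSpace S3 := by
  rw [← isPreconnected_iff_preconnectedSpace]
  apply isPreconnected_sphere
  rw [← Module.finrank_eq_rank]
  simp

/-- Orbits of points under end maps of isotopies are open, and so are their complements; the sphere
is connected. -/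
theorem exists_ambientIsotopy_apply_eq (p q : S3) : ∃ Φ : AmbientIsotopy, Φ.final p = q := by
  set O : Set S3 := {q | ∃ Φ : AmbientIsotopy, Φ.final p = q} with hO
  have h1 : IsOpen O := by
    rw [isOpen_iff_mem_nhds]
    rintro q ⟨Φ, rfl⟩
    filter_upwards [exists_nhds_ambientIsotopy (Φ.final p)] with r ⟨Ψ, hΨ⟩
    exact ⟨Φ.trans Ψ, hΨ⟩
  have h2 : IsOpen Oᶜ := by
    rw [isOpen_iff_mem_nhds]
    intro q hq
    filter_upwards [exists_nhds_ambientIsotopy q] with r ⟨Ψ, hΨ⟩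
    rintro ⟨Φ, hΦ⟩
    refine hq ⟨Φ.trans Ψ.symm, ?_⟩
    rw [AmbientIsotopy.trans_final, hΦ, ← hΨ, AmbientIsotopy.symm_final_final]
  have h3 := IsClopen.eq_univ ⟨⟨h2⟩, h1⟩ (s := O) ⟨p, .refl, rfl⟩
  have : q ∈ O := by rw [h3]; trivial
  exact this

/-! ### Germs at the origin realized by ambient isotopies -/

/-- The germ of `g` at the origin is realized, in the chart `ψ`, by an ambient isotopy. -/
def RealizesGerm (ψ : Chart) (g : E 3 → E 3) : Prop :=
  ∃ Φ : AmbientIsotopy, ∀ᶠ y in 𝓝 (0 : E 3), Φ.final (ψ y) = ψ (g y)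

theorem RealizesGerm.comp {ψ : Chart} {g h : E 3 → E 3} (hg : RealizesGerm ψ g)
    (hh : RealizesGerm ψ h) (hc : Tendsto h (𝓝 0) (𝓝 0)) : RealizesGerm ψ (g ∘ h) := by
  obtain ⟨Φ, hΦ⟩ := hg
  obtain ⟨Ψ, hΨ⟩ := hh
  refine ⟨Ψ.trans Φ, ?_⟩
  filter_upwards [hΨ, hc.eventually hΦ] with y h1 h2
  rw [AmbientIsotopy.trans_final, h1, h2]; rfl

/-- Germs that are close to the identity are realized. -/
theorem exists_realizesGerm_id_add (ψ : Chart) (h0 : (0 : E 3) ∈ ψ.source) :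
    ∃ c : NNReal, 0 < c ∧ ∀ (u : E 3 → E 3) (r : ℝ), 0 < r → ContDiffOn ℝ ∞ u (ball 0 r) →
      LipschitzOnWith c u (ball 0 r) → u 0 = 0 → RealizesGerm ψ (fun y => y + u y) := by
  obtain ⟨β, Q, hβ, hQ, hQs, hβ0, hβI, hβ1⟩ := exists_cutoff (isCompact_closedBall (0 : E 3) 1)
    (isOpen_ball (x := (0 : E 3)) (ε := 2)) (closedBall_subset_ball (by norm_num))
  obtain ⟨L, hL⟩ := exists_lipschitzWith_of_hasCompactSupport hβ (hasCompactSupport_of_zero hQ hβ0)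
  -- The cutoff at scale `ρ` has Lipschitz constant `L / ρ`, while `‖u‖ ≤ 2cρ` on the ball of radius
  -- `2ρ` because `u 0 = 0`. The product thus has Lipschitz constant at most `c + 2Lc = 1/2`,
  -- whatever the scale.
  set c : NNReal := (2 * (1 + 2 * L))⁻¹ with hc
  have hcL : c * (1 + 2 * L) = 2⁻¹ := by
    rw [hc, mul_inv, mul_assoc, inv_mul_cancel₀ (by positivity), mul_one]
  refine ⟨c, by positivity, fun u r hr hu hlip hu0 => ?_⟩
  obtain ⟨δ, hδ, hδs⟩ := Metric.isOpen_iff.1 (ψ.open_source.inter isOpen_ball) (0 : E 3)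
    ⟨h0, mem_ball_self hr⟩
  set ρ := δ / 2 with hρ
  have hρpos : 0 < ρ := by positivity
  set b : E 3 → ℝ := fun y => β (ρ⁻¹ • y) with hb
  set Q' : Set (E 3) := (fun y => ρ • y) '' Q with hQ'
  have hQ'c : IsCompact Q' := hQ.image (by fun_prop)
  have hQ'b : Q' ⊆ ball 0 δ := by
    rintro _ ⟨y, hy, rfl⟩
    have := hQs hy
    rw [mem_ball_zero_iff] at this ⊢
    rw [norm_smul, Real.norm_of_nonneg hρpos.le, hρ]
    have : ‖y‖ < 2 := this
    nlinarith
  have hb0 : ∀ y ∉ Q', b y = 0 := by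
    intro y hy
    refine hβ0 _ fun h => hy ⟨_, h, smul_inv_smul₀ hρpos.ne' y⟩
  have hbs : ContDiff ℝ ∞ b := hβ.comp (contDiff_const_smul ρ⁻¹)
  have hg : ContDiff ℝ ∞ fun y => b y • u y := by
    rw [contDiff_iff_contDiffAt]
    intro y
    by_cases hy : y ∈ ball (0 : E 3) δ
    · exact hbs.contDiffAt.smul (hu.contDiffAt (isOpen_ball.mem_nhds (hδs hy).2))
    · have : (fun y => b y • u y) =ᶠ[𝓝 y] fun _ => 0 := by
        filter_upwards [hQ'c.isClosed.isOpen_compl.mem_nhds fun h => hy (hQ'b h)] with z hz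
        rw [hb0 z hz, zero_smul]
      exact contDiffAt_const.congr_of_eventuallyEq this
  have hbI : ∀ y, |b y| ≤ 1 := fun y => abs_le.2 ⟨by linarith [(hβI (ρ⁻¹ • y)).1], (hβI _).2⟩
  have hbL : ∀ x y, |b x - b y| ≤ L * ρ⁻¹ * ‖x - y‖ := by
    intro x y
    have := hL.dist_le_mul (ρ⁻¹ • x) (ρ⁻¹ • y)
    rw [dist_smul₀, Real.norm_of_nonneg (by positivity), dist_eq_norm x y, Real.dist_eq] at this
    rw [mul_assoc]; exact this
  have hunorm : ∀ x ∈ ball (0 : E 3) δ, ‖u x‖ ≤ c * (2 * ρ) := by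
    intro x hx
    have := hlip.dist_le_mul x (hδs hx).2 0 (mem_ball_self hr)
    rw [hu0, dist_zero_right, dist_zero_right] at this
    refine this.trans ?_
    have : ‖x‖ < δ := by simpa using hx
    gcongr
    linarith
  have hcL' : (c : ℝ) * (1 + 2 * L) = 2⁻¹ := by
    have := congrArg NNReal.toReal hcL; push_cast at this; exact this
  have hsm : ∀ x y, x ∈ ball (0 : E 3) δ → ‖(b x - b y) • u x‖ ≤ c * (2 * L) * ‖x - y‖ := by
    intro x y hx
    rw [norm_smul, Real.norm_eq_abs]
    calc |b x - b y| * ‖u x‖ ≤ (L * ρ⁻¹ * ‖x - y‖) * (c * (2 * ρ)) := by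
          gcongr
          · exact hbL x y
          · exact hunorm x hx
      _ = _ := by field_simp
  have hlipg : LipschitzWith 2⁻¹ fun y => b y • u y := by
    refine LipschitzWith.of_dist_le_mul fun x y => ?_
    rw [dist_eq_norm, dist_eq_norm]
    push_cast
    rw [← hcL']
    have hnn : (0 : ℝ) ≤ c * ‖x - y‖ := by positivity
    by_cases hx : x ∈ ball (0 : E 3) δ
    · by_cases hy : y ∈ ball (0 : E 3) δ
      · have h1 : b x • u x - b y • u y = b y • (u x - u y) + (b x - b y) • u x := by
          rw [smul_sub, sub_smul]; abel
        rw [h1]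
        refine (norm_add_le _ _).trans ?_
        have h2 : ‖b y • (u x - u y)‖ ≤ c * ‖x - y‖ := by
          rw [norm_smul, Real.norm_eq_abs]
          have := hlip.dist_le_mul x (hδs hx).2 y (hδs hy).2
          rw [dist_eq_norm, dist_eq_norm] at this
          calc _ ≤ 1 * ‖u x - u y‖ := by gcongr; exact hbI y
            _ ≤ _ := by rw [one_mul]; exact this
        have := hsm x y hx
        linarith
      · have h1 : b y = 0 := hb0 y fun h => hy (hQ'b h)
        have := hsm x y hx
        rw [h1, zero_smul, sub_zero] at *
        linarith
    · have h1 : b x = 0 := hb0 x fun h => hx (hQ'b h)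
      by_cases hy : y ∈ ball (0 : E 3) δ
      · have := hsm y x hy
        rw [h1, sub_zero] at this
        rw [h1, zero_smul, zero_sub, norm_neg, norm_sub_rev x y]
        rw [norm_sub_rev x y] at hnn
        linarith
      · have h2 : b y = 0 := hb0 y fun h => hy (hQ'b h)
        rw [h1, h2, zero_smul, zero_smul, sub_self, norm_zero]
        positivity
  obtain ⟨Φ, hΦ, -⟩ := exists_ambientIsotopy_id_add ψ hQ'c (fun y hy => (hδs (hQ'b hy)).1)
    hg (fun y hy => by rw [hb0 y hy, zero_smul]) (by rw [← NNReal.coe_lt_coe]; norm_num) hlipg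
  refine ⟨Φ, ?_⟩
  filter_upwards [closedBall_mem_nhds (0 : E 3) hρpos, ball_mem_nhds (0 : E 3) hδ] with y hy hy'
  rw [(hΦ y (hδs hy').1).2, show b y = 1 from ?_, one_smul]
  refine hβ1 _ ?_
  rw [mem_closedBall_zero_iff] at hy ⊢
  rw [norm_smul, Real.norm_of_nonneg (by positivity), inv_mul_le_iff₀ hρpos, mul_one]
  exact hy

theorem RealizesGerm.congr {ψ : Chart} {g h : E 3 → E 3} (hg : RealizesGerm ψ g)
    (hgh : g =ᶠ[𝓝 0] h) : RealizesGerm ψ h := by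
  obtain ⟨Φ, hΦ⟩ := hg
  exact ⟨Φ, by filter_upwards [hΦ, hgh] with y h1 h2; rw [h1, h2]⟩

/-- The linear map of `ℝ³` given by a matrix. -/
abbrev matMap : Matrix (Fin 3) (Fin 3) ℝ ≃⋆ₐ[ℝ] (E 3 →L[ℝ] E 3) := Matrix.toEuclideanCLM

theorem continuous_matMap : Continuous (matMap : Matrix (Fin 3) (Fin 3) ℝ → (E 3 →L[ℝ] E 3)) :=
  LinearMap.continuous_of_finiteDimensional (matMap.toAlgEquiv.toLinearEquiv.toLinearMap)

theorem eventually_realizesGerm_matMap (ψ : Chart) (h0 : (0 : E 3) ∈ ψ.source) :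
    ∀ᶠ M in 𝓝 (1 : Matrix (Fin 3) (Fin 3) ℝ), RealizesGerm ψ (matMap M) := by
  obtain ⟨c, hc, h⟩ := exists_realizesGerm_id_add ψ h0
  have h1 : Tendsto (fun M => ‖matMap M - 1‖₊) (𝓝 1) (𝓝 0) := by
    have : Continuous fun M => ‖matMap M - 1‖₊ := (continuous_matMap.sub continuous_const).nnnorm
    have h2 := this.tendsto 1
    rwa [map_one, sub_self, nnnorm_zero] at h2
  filter_upwards [h1.eventually (gt_mem_nhds hc)] with M hM
  have h3 := h (matMap M - 1 : E 3 →L[ℝ] E 3) 1 one_pos (ContinuousLinearMap.contDiff _).contDiffOn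
    (((matMap M - 1 : E 3 →L[ℝ] E 3).lipschitz.weaken hM.le).lipschitzOnWith) (map_zero _)
  refine h3.congr (Eventually.of_forall fun y => ?_)
  simp

theorem RealizesGerm.matMap_mul {ψ : Chart} {M N : Matrix (Fin 3) (Fin 3) ℝ}
    (hM : RealizesGerm ψ (matMap M)) (hN : RealizesGerm ψ (matMap N)) :
    RealizesGerm ψ (matMap (M * N)) := by
  have h := hM.comp hN (by simpa using (matMap N).continuous.tendsto 0)
  refine h.congr (Eventually.of_forall fun y => ?_)
  rw [map_mul]; rfl

/-- A transvection is the `n`-th power of the transvection with parameter `c / n`, which is close to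
the identity for large `n`. -/
theorem realizesGerm_transvection (ψ : Chart) (h0 : (0 : E 3) ∈ ψ.source) {i j : Fin 3}
    (hij : i ≠ j) (c : ℝ) : RealizesGerm ψ (matMap (Matrix.transvection i j c)) := by
  have h1 : Tendsto (fun n : ℕ => Matrix.transvection i j (c / n)) atTop (𝓝 1) := by
    have h2 : Continuous fun t : ℝ => Matrix.transvection i j t := by
      unfold Matrix.transvection
      refine continuous_const.add ?_
      exact LinearMap.continuous_of_finiteDimensional (Matrix.singleLinearMap ℝ i j : ℝ →ₗ[ℝ] _)
    have h3 := (h2.tendsto 0).comp (tendsto_const_div_atTop_nhds_zero_nat c)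
    rwa [Matrix.transvection_zero] at h3
  obtain ⟨n, hn, hn0⟩ := ((h1.eventually (eventually_realizesGerm_matMap ψ h0)).and
    (eventually_gt_atTop 0)).exists
  have h4 : ∀ m : ℕ, RealizesGerm ψ (matMap (Matrix.transvection i j (m * (c / n)))) := by
    intro m
    induction m with
    | zero =>
      rw [Nat.cast_zero, zero_mul, Matrix.transvection_zero]
      exact (eventually_realizesGerm_matMap ψ h0).self_of_nhds
    | succ m ih =>
      have := ih.matMap_mul hn
      rwa [Matrix.transvection_mul_transvection_same _ _ hij, ← add_one_mul, ← Nat.cast_succ] at this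
  have h5 := h4 n
  rwa [mul_div_cancel₀] at h5
  positivity

/-- Up to a diagonal matrix, every invertible linear germ is realized by an ambient isotopy. -/
theorem exists_diagonal_realizesGerm (ψ : Chart) (h0 : (0 : E 3) ∈ ψ.source)
    (M : Matrix (Fin 3) (Fin 3) ℝ) (hM : M.det ≠ 0) :
    ∃ a : Fin 3 → ℝ, (∀ i, a i ≠ 0) ∧ RealizesGerm ψ (matMap (Matrix.diagonal a * M)) := by
  -- The extra diagonal factor on the right is what makes the statement multiplicative: for a
  -- product `A * B`, the factor `a` found for `B` is cancelled by applying the statement for `A`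
  -- with `a⁻¹` on the right.
  suffices h : ∀ b : Fin 3 → ℝ, (∀ i, b i ≠ 0) → ∃ a : Fin 3 → ℝ, (∀ i, a i ≠ 0) ∧
      RealizesGerm ψ (matMap (Matrix.diagonal a * M * Matrix.diagonal b)) by
    obtain ⟨a, ha, h⟩ := h 1 (by simp)
    exact ⟨a, ha, by rwa [show Matrix.diagonal (1 : Fin 3 → ℝ) = 1 from Matrix.diagonal_one,
      mul_one] at h⟩
  refine Matrix.diagonal_transvection_induction_of_det_ne_zero (fun M => ∀ b : Fin 3 → ℝ,
    (∀ i, b i ≠ 0) → ∃ a : Fin 3 → ℝ, (∀ i, a i ≠ 0) ∧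
      RealizesGerm ψ (matMap (Matrix.diagonal a * M * Matrix.diagonal b))) M hM ?_ ?_ ?_
  · intro D hD b hb
    rw [Matrix.det_diagonal, Finset.prod_ne_zero_iff] at hD
    refine ⟨fun i => (D i * b i)⁻¹, fun i => inv_ne_zero (mul_ne_zero (hD i (Finset.mem_univ i))
      (hb i)), ?_⟩
    have : Matrix.diagonal (fun i => (D i * b i)⁻¹) * Matrix.diagonal D * Matrix.diagonal b = 1 := by
      rw [Matrix.diagonal_mul_diagonal, Matrix.diagonal_mul_diagonal, ← Matrix.diagonal_one]
      congr 1
      funext i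
      rw [mul_assoc]
      exact inv_mul_cancel₀ (mul_ne_zero (hD i (Finset.mem_univ i)) (hb i))
    rw [this]
    exact (eventually_realizesGerm_matMap ψ h0).self_of_nhds
  · rintro ⟨i, j, hij, c⟩ b hb
    refine ⟨fun i => (b i)⁻¹, fun i => inv_ne_zero (hb i), ?_⟩
    -- Conjugating a transvection by a diagonal matrix gives another transvection.
    have : Matrix.diagonal (fun i => (b i)⁻¹) * Matrix.transvection i j c * Matrix.diagonal b =
        Matrix.transvection i j ((b i)⁻¹ * c * b j) := by
      ext k l
      rw [Matrix.mul_diagonal, Matrix.diagonal_mul, Matrix.transvection, Matrix.transvection,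
        Matrix.add_apply, Matrix.add_apply, Matrix.single_apply, Matrix.single_apply,
        Matrix.one_apply]
      by_cases hkl : k = l
      · subst hkl
        have : ¬ (i = k ∧ j = k) := fun h => hij (h.1.trans h.2.symm)
        rw [if_neg this, if_neg this, if_pos rfl, add_zero, mul_one, inv_mul_cancel₀ (hb k)]
      · rw [if_neg hkl, zero_add, zero_add]
        split_ifs with h
        · rw [h.1, h.2]
        · ring
    change RealizesGerm ψ (matMap (_ * Matrix.transvection i j c * _))
    rw [this]
    exact realizesGerm_transvection ψ h0 hij _
  · intro A B _ _ hA hB b hb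
    obtain ⟨a, ha, h⟩ := hB b hb
    obtain ⟨a', ha', h'⟩ := hA (fun i => (a i)⁻¹) fun i => inv_ne_zero (ha i)
    refine ⟨a', ha', ?_⟩
    have h2 := h'.matMap_mul h
    have h3 : Matrix.diagonal (fun i => (a i)⁻¹) * Matrix.diagonal a = 1 := by
      rw [Matrix.diagonal_mul_diagonal, ← Matrix.diagonal_one]
      congr 1
      funext i
      exact inv_mul_cancel₀ (ha i)
    have h4 : Matrix.diagonal a' * A * Matrix.diagonal (fun i => (a i)⁻¹) *
        (Matrix.diagonal a * B * Matrix.diagonal b) =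
        Matrix.diagonal a' * (A * B) * Matrix.diagonal b := by
      simp only [Matrix.mul_assoc]
      rw [← Matrix.mul_assoc (Matrix.diagonal fun i => (a i)⁻¹), h3, Matrix.one_mul]
    rwa [h4] at h2

/-- A germ of a diffeomorphism whose differential is the identity is realized. -/
theorem realizesGerm_of_hasFDerivAt_id (ψ : Chart) (h0 : (0 : E 3) ∈ ψ.source) {g : E 3 → E 3}
    {U : Set (E 3)} (hU : U ∈ 𝓝 0) (hg : ContDiffOn ℝ ∞ g U) (hg0 : g 0 = 0)
    (hd : HasFDerivAt g (ContinuousLinearMap.id ℝ (E 3)) 0) : RealizesGerm ψ g := by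
  obtain ⟨c, hc, h⟩ := exists_realizesGerm_id_add ψ h0
  -- Strict differentiability makes `g - id` Lipschitz with constant `c` on a small ball, as
  -- required of a realizable perturbation.
  have hs : HasStrictFDerivAt g (ContinuousLinearMap.id ℝ (E 3)) 0 :=
    (hg.contDiffAt hU).hasStrictFDerivAt' hd (by simp)
  obtain ⟨s, hs1, hs2⟩ := hs.approximates_deriv_on_nhds (c := c) (Or.inr hc)
  obtain ⟨r, hr, hrs⟩ := Metric.mem_nhds_iff.1 (inter_mem hs1 hU)
  have h1 := h (fun y => g y - y) r hr
    ((hg.mono fun y hy => (hrs hy).2).sub contDiffOn_id) ?_ (by simp [hg0])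
  · exact h1.congr (Eventually.of_forall fun y => by simp)
  · exact (ApproximatesLinearOn.approximatesLinearOn_iff_lipschitzOnWith.1 hs2).mono fun y hy => (hrs hy).1

/-- Let `T` carry the first centre to the second, let `τ = ψ₁⁻¹ T⁻¹ ψ₂` be the transition map and
`A` its derivative. If `Φ` realizes `S τ` in `ψ₂` for a diagonal `S`, then `Φ T ψ₁ = ψ₂ (S τ) τ⁻¹ =
ψ₂ S` near the origin. The germ `S τ` is the composition of `S τ (S A)⁻¹`, whose derivative is the
identity, with the linear map `S A`, which is realized for a suitable `S`. Some diagonal factor is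
unavoidable, since end maps of isotopies preserve orientation and the charts need not. -/
theorem exists_ambientIsotopy_chart_germ (ψ₁ ψ₂ : Chart) (h₁ : (0 : E 3) ∈ ψ₁.source)
    (h₂ : (0 : E 3) ∈ ψ₂.source) :
    ∃ (a : Fin 3 → ℝ) (Φ : AmbientIsotopy), (∀ i, a i ≠ 0) ∧ ∀ᶠ y in 𝓝 (0 : E 3),
      matMap (Matrix.diagonal a) y ∈ ψ₂.source ∧
      Φ.final (ψ₁ y) = ψ₂ (matMap (Matrix.diagonal a) y) := by
  obtain ⟨T, hT⟩ := exists_ambientIsotopy_apply_eq (ψ₁ 0) (ψ₂ 0)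
  -- the transition map and its inverse
  set τ : E 3 → E 3 := fun y => ψ₁.symm (T.symm.final (ψ₂ y)) with hτ
  set τ' : E 3 → E 3 := fun y => ψ₂.symm (T.final (ψ₁ y)) with hτ'
  have hT' : T.symm.final (ψ₂ 0) = ψ₁ 0 := by rw [← hT, AmbientIsotopy.symm_final_final]
  have htrans : ∀ (A B : Chart) (S : AmbientIsotopy), 0 ∈ A.source → 0 ∈ B.source →
      S.final (A 0) = B 0 → ∃ U, IsOpen U ∧ (0 : E 3) ∈ U ∧ U ⊆ A.source ∧
      (∀ y ∈ U, S.final (A y) ∈ B.target) ∧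
      ContDiffOn ℝ ∞ (fun y => B.symm (S.final (A y))) U := by
    intro A B S hA hB hS
    have hc : ContinuousOn (fun y => S.final (A y)) A.source :=
      S.contMDiff_final.continuous.comp_continuousOn A.contMDiffOn.continuousOn
    refine ⟨A.source ∩ (fun y => S.final (A y)) ⁻¹' B.target,
      hc.isOpen_inter_preimage A.open_source B.open_target,
      ⟨hA, by simpa only [mem_preimage, hS] using B.map_source hB⟩,
      inter_subset_left, fun y hy => hy.2, ?_⟩
    rw [← contMDiffOn_iff_contDiffOn]
    exact B.symm.contMDiffOn.comp (S.contMDiff_final.comp_contMDiffOn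
      (A.contMDiffOn.mono inter_subset_left)) fun y hy => hy.2
  obtain ⟨U, hUo, hU0, hUs, hUt, hUd⟩ := htrans ψ₂ ψ₁ T.symm h₂ h₁ hT'
  obtain ⟨U', hU'o, hU'0, hU's, hU't, hU'd⟩ := htrans ψ₁ ψ₂ T h₁ h₂ hT
  have hτ0 : τ 0 = 0 := by
    change ψ₁.symm (T.symm.final (ψ₂ 0)) = 0
    rw [hT']; exact ψ₁.left_inv h₁
  have hτ'0 : τ' 0 = 0 := by
    change ψ₂.symm (T.final (ψ₁ 0)) = 0
    rw [hT]; exact ψ₂.left_inv h₂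
  have hτd : ContDiffAt ℝ ∞ τ 0 := hUd.contDiffAt (hUo.mem_nhds hU0)
  have hτ'd : ContDiffAt ℝ ∞ τ' 0 := hU'd.contDiffAt (hU'o.mem_nhds hU'0)
  have hU'n : U' ∈ 𝓝 (0 : E 3) := hU'o.mem_nhds hU'0
  have hcτ : Tendsto τ (𝓝 0) (𝓝 0) := by simpa only [hτ0] using hτd.continuousAt.tendsto
  have hcτ' : Tendsto τ' (𝓝 0) (𝓝 0) := by simpa only [hτ'0] using hτ'd.continuousAt.tendsto
  have hττ' : ∀ y ∈ U', τ (τ' y) = y := by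
    intro y hy
    simp only [hτ, hτ']
    rw [show ψ₂ (ψ₂.symm (T.final (ψ₁ y))) = T.final (ψ₁ y) from ψ₂.right_inv (hU't y hy),
      AmbientIsotopy.symm_final_final]
    exact ψ₁.left_inv (hU's hy)
  have hτ'τ : ∀ y ∈ U, τ' (τ y) = y := by
    intro y hy
    simp only [hτ, hτ']
    rw [show ψ₁ (ψ₁.symm (T.symm.final (ψ₂ y))) = T.symm.final (ψ₂ y) from ψ₁.right_inv (hUt y hy),
      AmbientIsotopy.final_symm_final]
    exact ψ₂.left_inv (hUs hy)
  have hA := (hτd.differentiableAt (by simp)).hasFDerivAt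
  have hA' := (hτ'd.differentiableAt (by simp)).hasFDerivAt
  set A := fderiv ℝ τ 0 with hAdef
  set A' := fderiv ℝ τ' 0 with hA'def
  have hcomp : A'.comp A = ContinuousLinearMap.id ℝ (E 3) := by
    have h1 : HasFDerivAt (τ' ∘ τ) (A'.comp A) 0 := by
      refine HasFDerivAt.comp 0 ?_ hA
      rw [hτ0]; exact hA'
    have h2 : HasFDerivAt (τ' ∘ τ) (ContinuousLinearMap.id ℝ (E 3)) 0 :=
      (hasFDerivAt_id (0 : E 3)).congr_of_eventuallyEq
        (by filter_upwards [hUo.mem_nhds hU0] with y hy using hτ'τ y hy)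
    exact h1.unique h2
  set M := matMap.symm A with hM
  set M' := matMap.symm A' with hM'
  have hMM : M' * M = 1 := by
    rw [hM, hM', ← map_mul, ← map_one matMap.symm]
    congr 1
  have hdet : M.det ≠ 0 := by
    intro h
    have := congrArg Matrix.det hMM
    rw [Matrix.det_mul, h, mul_zero, Matrix.det_one] at this
    exact zero_ne_one this
  obtain ⟨a, ha, hg⟩ := exists_diagonal_realizesGerm ψ₂ h₂ M hdet
  set S := Matrix.diagonal a with hS
  set S' := Matrix.diagonal fun i => (a i)⁻¹ with hS'
  have hSS : S * S' = 1 := by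
    rw [hS, hS', Matrix.diagonal_mul_diagonal, ← Matrix.diagonal_one]
    congr 1; funext i; exact mul_inv_cancel₀ (ha i)
  have hSS' : S' * S = 1 := mul_eq_one_comm.1 hSS
  have hMM' : M * M' = 1 := mul_eq_one_comm.1 hMM
  have hAM : A = matMap M := by rw [hM]; simp
  -- the germ `S τ (S A)⁻¹` has differential the identity
  set R : E 3 →L[ℝ] E 3 := matMap (M' * S') with hR
  have hRt : Tendsto R (𝓝 0) (𝓝 0) := by simpa using R.continuous.tendsto 0
  have hg2 : RealizesGerm ψ₂ (fun y => matMap S (τ (R y))) := by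
    refine realizesGerm_of_hasFDerivAt_id ψ₂ h₂ (U := R ⁻¹' U)
      (hRt (hUo.mem_nhds hU0)) ?_ (by simp [hτ0]) ?_
    · exact (ContinuousLinearMap.contDiff _).comp_contDiffOn
        (hUd.comp (ContinuousLinearMap.contDiff _).contDiffOn fun y hy => hy)
    · have h1 : HasFDerivAt (fun y => τ (R y)) (A.comp R) 0 := by
        refine HasFDerivAt.comp (g := τ) 0 ?_ R.hasFDerivAt
        rw [map_zero]; exact hA
      have h2 := (matMap S).hasFDerivAt.comp (0 : E 3) h1
      convert! h2 using 1
      have : (matMap S).comp (A.comp R) = matMap (S * (M * (M' * S'))) := by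
        rw [map_mul, map_mul, ← hAM]; rfl
      rw [this, ← Matrix.mul_assoc M, hMM', Matrix.one_mul, hSS, map_one]; rfl
  have hg3 := hg2.comp hg (by simpa using (matMap (S * M)).continuous.tendsto 0)
  have hg4 : RealizesGerm ψ₂ (fun y => matMap S (τ y)) := by
    refine hg3.congr (Eventually.of_forall fun y => ?_)
    have : R (matMap (S * M) y) = y := by
      have h1 : (M' * S') * (S * M) = 1 := by
        rw [Matrix.mul_assoc, ← Matrix.mul_assoc S', hSS', Matrix.one_mul, hMM]
      have h2 : R (matMap (S * M) y) = matMap ((M' * S') * (S * M)) y := by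
        rw [map_mul matMap (M' * S')]; rfl
      rw [h2, h1, map_one]; rfl
    simp only [Function.comp_apply, this]
  obtain ⟨Φ, hΦ⟩ := hg4
  refine ⟨a, T.trans Φ, ha, ?_⟩
  have h5 : Tendsto (matMap S) (𝓝 0) (𝓝 0) := by simpa using (matMap S).continuous.tendsto 0
  filter_upwards [hcτ'.eventually hΦ, hU'n, h5.eventually (ψ₂.open_source.mem_nhds h₂)] with y h1 h2 h3
  refine ⟨h3, ?_⟩
  rw [AmbientIsotopy.trans_final]
  have h4 : T.final (ψ₁ y) = ψ₂ (τ' y) := (ψ₂.right_inv (hU't y h2)).symm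
  rw [h4, h1, hττ' y h2]

/-- Any compact subset of a convex chart can be moved by an ambient isotopy into any other chart,
by a map that in the charts is a diagonal linear map. -/
theorem exists_ambientIsotopy_chart_to_chart (ψ₁ ψ₂ : Chart) (hconv : Convex ℝ ψ₁.source)
    (h₁ : (0 : E 3) ∈ ψ₁.source) (h₂ : (0 : E 3) ∈ ψ₂.source) {C : Set (E 3)} (hC : IsCompact C)
    (hCs : C ⊆ ψ₁.source) :
    ∃ (a : Fin 3 → ℝ) (Φ : AmbientIsotopy), (∀ i, a i ≠ 0) ∧ ∀ y ∈ C,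
      WithLp.toLp 2 (fun i => a i * y i) ∈ ψ₂.source ∧
      Φ.final (ψ₁ y) = ψ₂ (WithLp.toLp 2 fun i => a i * y i) := by
  obtain ⟨a, Φ, ha, hΦ⟩ := exists_ambientIsotopy_chart_germ ψ₁ ψ₂ h₁ h₂
  obtain ⟨r, hr, hrΦ⟩ := Metric.eventually_nhds_iff_ball.1 hΦ
  obtain ⟨B, hB⟩ := hC.isBounded.exists_norm_le
  have hB' : 0 < |B| + 1 := by positivity
  -- The bound `r / (|B| + 1)` makes the scaled copy of `C` fit into the ball of radius `r` on which
  -- the germ identity holds.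
  obtain ⟨ε, hε, hεr, Ψ, hΨ⟩ := exists_ambientIsotopy_contract ψ₁ hconv h₁ hC hCs
    (η := r / (|B| + 1)) (by positivity)
  refine ⟨fun i => a i * ε, Ψ.trans Φ, fun i => mul_ne_zero (ha i) hε.ne', fun y hy => ?_⟩
  have hmem : ε • y ∈ ball (0 : E 3) r := by
    rw [mem_ball_zero_iff, norm_smul, Real.norm_of_nonneg hε.le]
    rw [lt_div_iff₀ hB'] at hεr
    have h1 : ‖y‖ ≤ |B| + 1 := by linarith [hB y hy, le_abs_self B]
    calc ε * ‖y‖ ≤ ε * (|B| + 1) := by gcongr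
      _ < r := hεr
  have h1 := hrΦ _ hmem
  have h2 : matMap (Matrix.diagonal a) (ε • y) = WithLp.toLp 2 fun i => a i * ε * y i := by
    ext i
    simp [Matrix.ofLp_toEuclideanCLM, Matrix.mulVec_diagonal]
    ring
  rw [h2] at h1
  refine ⟨h1.1, ?_⟩
  rw [AmbientIsotopy.trans_final, hΨ y hy, h1.2]

/-! ### Comparing curves -/

/-- Since `c₁ = g ∘ c₂`, the velocities satisfy `c₁' = dg (c₂')`; nonvanishing and linear
independence are inherited by the preimages of vectors. The coincidences of the two curves are the
same, so `g` maps crossings bijectively to crossings. Only a differentiable map from the new diagram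
back to the old one is needed, not a diffeomorphism of the ambient spaces. -/
theorem IsRegularCurve.transfer {n m : ℕ} {c₁ : Circle → E n} {c₂ : Circle → E m} {g : E m → E n}
    (h : IsRegularCurve c₁) (hc : ∀ z, c₁ z = g (c₂ z))
    (hg : ∀ z, DifferentiableAt ℝ g (c₂ z))
    (hd : ∀ t, DifferentiableAt ℝ (fun s : ℝ => c₂ (Circle.exp s)) t)
    (hinj : ∀ z w, c₁ z = c₁ w → c₂ z = c₂ w) :
    IsRegularCurve c₂ ∧ (crossings c₂).encard = (crossings c₁).encard := by
  have hvel : ∀ t, velocity c₁ t = fderiv ℝ g (c₂ (Circle.exp t)) (velocity c₂ t) := by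
    intro t
    have h1 := (hg (Circle.exp t)).hasFDerivAt.comp_hasDerivAt t (hd t).hasDerivAt
    have h2 : (fun s : ℝ => c₁ (Circle.exp s)) = g ∘ fun s : ℝ => c₂ (Circle.exp s) := by
      funext s; exact hc _
    rw [velocity, h2, h1.deriv]; rfl
  have hiff : ∀ z w, c₁ z = c₁ w ↔ c₂ z = c₂ w := fun z w =>
    ⟨hinj z w, fun h' => by rw [hc, hc, h']⟩
  have himg : crossings c₁ = g '' crossings c₂ := by
    ext x
    constructor
    · rintro ⟨z, w, hzw, rfl, hw⟩
      exact ⟨c₂ z, ⟨z, w, hzw, rfl, ((hiff _ _).1 hw)⟩, (hc z).symm⟩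
    · rintro ⟨_, ⟨z, w, hzw, rfl, hw⟩, rfl⟩
      exact ⟨z, w, hzw, hc z, by rw [hc, hw]⟩
  have hinjOn : InjOn g (crossings c₂) := by
    rintro _ ⟨z, _, _, rfl, _⟩ _ ⟨z', _, _, rfl, _⟩ h'
    rw [← hc, ← hc] at h'
    exact hinj _ _ h'
  have hcard : (crossings c₂).encard = (crossings c₁).encard := by
    rw [himg, hinjOn.encard_image]
  refine ⟨⟨fun t ht => h.immersion t ?_, ?_, fun x => ?_, fun s t hst heq => ?_⟩, hcard⟩
  · rw [hvel, ht, map_zero]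
  · rw [← Set.encard_lt_top_iff, hcard]; exact Set.encard_lt_top_iff.2 h.finite
  · by_cases hx : ∃ z, c₂ z = x
    · obtain ⟨z, rfl⟩ := hx
      refine le_trans (Set.encard_le_encard ?_) (h.double (c₁ z))
      intro w hw
      exact (hiff _ _).2 hw
    · have : c₂ ⁻¹' {x} = ∅ := by
        ext z; simp only [mem_preimage, mem_singleton_iff, mem_empty_iff_false, iff_false]
        exact fun h => hx ⟨z, h⟩
      rw [this]; simp
  · have h1 := h.transverse s t hst ((hiff _ _).2 heq)
    refine LinearIndependent.of_comp (fderiv ℝ g (c₂ (Circle.exp s)) : E m →ₗ[ℝ] E n) ?_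
    convert h1 using 1
    funext i
    fin_cases i
    · simp [hvel s]
    · simp [hvel t, heq]

/-! ### Smooth maps to and from the sphere -/

/-- The radial projection to the unit sphere (with a junk value at the origin). -/
def normS (x : E 4) : S3 :=
  open Classical in if h : x ≠ 0 then ⟨‖x‖⁻¹ • x, by
    rw [mem_sphere_zero_iff_norm, norm_smul, norm_inv, norm_norm]
    exact inv_mul_cancel₀ (norm_ne_zero_iff.2 h)⟩ else ⟨EuclideanSpace.single 0 1, by simp⟩

theorem coe_normS {x : E 4} (h : x ≠ 0) : (normS x : E 4) = ‖x‖⁻¹ • x := by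
  rw [normS, dif_pos h]

theorem norm_coe (x : S3) : ‖(x : E 4)‖ = 1 := norm_eq_of_mem_sphere x

theorem coe_ne_zero (x : S3) : (x : E 4) ≠ 0 := by
  rw [← norm_ne_zero_iff, norm_coe]; exact one_ne_zero

@[simp] theorem normS_coe (x : S3) : normS x = x := by
  apply Subtype.ext
  rw [coe_normS (coe_ne_zero x), norm_coe, inv_one, one_smul]

theorem contMDiffAt_normS {x : E 4} (hx : x ≠ 0) : ContMDiffAt 𝓘(ℝ, E 4) (𝓡 3) ∞ normS x := by
  have hr : 0 < ‖x‖ / 2 := by have := norm_pos_iff.2 hx; positivity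
  obtain ⟨β, Q, hβ, -, hQs, hβ0, hβI, hβ1⟩ := exists_cutoff (isCompact_closedBall x (‖x‖ / 4))
    (isOpen_ball (x := x) (ε := ‖x‖ / 2)) (closedBall_subset_ball (by linarith))
  -- A globally defined map without zeros that is the identity near `x`. It stays within `‖x‖ / 2`
  -- of `x`, so normalizing it gives a smooth map of the whole space to the sphere.
  set h : E 4 → E 4 := fun y => x + β y • (y - x) with hh
  have hne : ∀ y, h y ≠ 0 := by
    intro y h0
    have h1 : x = -(β y • (y - x)) := eq_neg_of_add_eq_zero_left h0
    have h2 : ‖x‖ = β y * ‖y - x‖ := by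
      conv_lhs => rw [h1]
      rw [norm_neg, norm_smul, Real.norm_of_nonneg (hβI y).1]
    by_cases hy : y ∈ Q
    · have h3 := hQs hy
      rw [mem_ball, dist_eq_norm] at h3
      nlinarith [(hβI y).1, (hβI y).2, norm_nonneg (y - x)]
    · rw [hβ0 y hy, zero_mul] at h2
      exact hx (norm_eq_zero.1 h2)
  have hhs : ContDiff ℝ ∞ h := contDiff_const.add (hβ.smul (contDiff_id.sub contDiff_const))
  have hs : ContDiff ℝ ∞ fun y => ‖h y‖⁻¹ • h y :=
    ((hhs.norm ℝ hne).inv fun y => norm_ne_zero_iff.2 (hne y)).smul hhs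
  have h1 := ContMDiff.codRestrict_sphere (n := 3) hs.contMDiff fun y => by
    rw [mem_sphere_zero_iff_norm, norm_smul, norm_inv, norm_norm]
    exact inv_mul_cancel₀ (norm_ne_zero_iff.2 (hne y))
  refine (h1 x).congr_of_eventuallyEq ?_
  have hx0 : closedBall x (‖x‖ / 4) ∈ 𝓝 x := closedBall_mem_nhds _ (by linarith)
  filter_upwards [hx0, isOpen_ne.mem_nhds hx] with y hy hy0
  apply Subtype.ext
  have : h y = y := by simp only [hh]; rw [hβ1 y hy, one_smul]; abel
  rw [coe_normS hy0]
  simp only [Set.val_codRestrict_apply, this]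

theorem contMDiff_coe : ContMDiff (𝓡 3) 𝓘(ℝ, E 4) ∞ ((↑) : S3 → E 4) := contMDiff_coe_sphere

theorem contDiffAt_coe_apply {f : S3 → S3} {x : E 4} (hx : x ≠ 0)
    (hf : ContMDiffAt (𝓡 3) (𝓡 3) ∞ f (normS x)) :
    ContDiffAt ℝ ∞ (fun y => (f (normS y) : E 4)) x :=
  (contMDiff_coe.contMDiffAt.comp x (hf.comp x (contMDiffAt_normS hx))).contDiffAt

/-! ### Ambient isotopy invariance -/

/-- A loop in the 3-sphere that is smooth in the angle. -/
def SmoothLoop (c : Circle → S3) : Prop :=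
  ContMDiff 𝓘(ℝ, ℝ) (𝓡 3) ∞ (fun t : ℝ => c (Circle.exp t))

theorem Knot.smoothLoop (K : Knot) : SmoothLoop K.toFun := K.smooth.comp contMDiff_circleExp

theorem AmbientIsotopy.smoothLoop (Φ : AmbientIsotopy) {c : Circle → S3} (hc : SmoothLoop c) :
    SmoothLoop (Φ.final ∘ c) := Φ.contMDiff_final.comp hc

theorem SmoothLoop.differentiableAt_of_contMDiffAt {c : Circle → S3} (hc : SmoothLoop c) {n : ℕ} {f : S3 → E n}
    (t : ℝ) (hf : ContMDiffAt (𝓡 3) 𝓘(ℝ, E n) ∞ f (c (Circle.exp t))) :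
    DifferentiableAt ℝ (fun s : ℝ => f (c (Circle.exp s))) t :=
  ((hf.comp t (hc t)).contDiffAt).differentiableAt (by simp)

namespace RegularNeighborhood

variable {F : Set S3} (N : RegularNeighborhood F)

theorem contMDiffAt_proj {x : S3} (hx : x ∈ N.carrier) : ContMDiffAt (𝓡 3) (𝓡 3) ∞ N.proj x :=
  N.smooth_proj.contMDiffAt (N.isOpen_domain.mem_nhds (N.carrier_subset hx))

theorem contMDiffAt_height {x : S3} (hx : x ∈ N.carrier) :
    ContMDiffAt (𝓡 3) 𝓘(ℝ, ℝ) ∞ N.height x :=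
  N.smooth_height.contMDiffAt (N.isOpen_domain.mem_nhds (N.carrier_subset hx))

theorem differentiableAt_shadow {c : Circle → S3} (hc : SmoothLoop c)
    (hN : ∀ z, c z ∈ N.carrier) (t : ℝ) :
    DifferentiableAt ℝ (fun s : ℝ => N.shadow c (Circle.exp s)) t :=
  hc.differentiableAt_of_contMDiffAt (f := fun x => (N.proj x : E 4)) t
    (contMDiff_coe.contMDiffAt.comp _ (N.contMDiffAt_proj (hN _)))

theorem proj_mem {x : S3} (hx : x ∈ N.carrier) : N.proj x ∈ F := (N.bijOn.mapsTo hx).1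

theorem height_mem {x : S3} (hx : x ∈ N.carrier) : N.height x ∈ Icc (-1 : ℝ) 1 :=
  (N.bijOn.mapsTo hx).2

/-- The image of a regular neighbourhood under a diffeomorphism of the 3-sphere. -/
def map (d : S3 ≃ₘ^∞⟮𝓡 3, 𝓡 3⟯ S3) : RegularNeighborhood (d '' F) where
  carrier := d '' N.carrier
  domain := d '' N.domain
  proj := d ∘ N.proj ∘ d.symm
  height := N.height ∘ d.symm
  compact := N.compact.image d.continuous
  isOpen_domain := d.toHomeomorph.isOpenMap _ N.isOpen_domain
  carrier_subset := image_mono N.carrier_subset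
  smooth_proj := d.contMDiff.comp_contMDiffOn (N.smooth_proj.comp d.symm.contMDiff.contMDiffOn (by
    rintro _ ⟨x, hx, rfl⟩; simpa using hx))
  smooth_height := N.smooth_height.comp d.symm.contMDiff.contMDiffOn (by
    rintro _ ⟨x, hx, rfl⟩; simpa using hx)
  bijOn := by
    refine ⟨?_, ?_, ?_⟩
    · rintro _ ⟨x, hx, rfl⟩
      have := N.bijOn.mapsTo hx
      simp only [Function.comp_apply, d.symm_apply_apply]
      exact ⟨⟨_, this.1, rfl⟩, this.2⟩
    · rintro _ ⟨x, hx, rfl⟩ _ ⟨y, hy, rfl⟩ h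
      simp only [Function.comp_apply, d.symm_apply_apply, Prod.mk.injEq] at h
      rw [N.bijOn.injOn hx hy (Prod.ext (d.injective h.1) h.2)]
    · rintro ⟨_, t⟩ ⟨⟨y, hy, rfl⟩, ht⟩
      obtain ⟨x, hx, h⟩ := N.bijOn.surjOn (show (y, t) ∈ F ×ˢ Icc (-1 : ℝ) 1 from ⟨hy, ht⟩)
      refine ⟨d x, ⟨x, hx, rfl⟩, ?_⟩
      simp only [Prod.mk.injEq] at h
      simp only [Function.comp_apply, d.symm_apply_apply, h.1, h.2]
  immersion := by
    rintro _ ⟨x, hx, rfl⟩ v h1 h2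
    have hx' : d.symm (d x) ∈ N.carrier := by simpa using hx
    have hd' : MDifferentiableAt (𝓡 3) (𝓡 3) d.symm (d x) := d.symm.mdifferentiable (by simp) _
    have hp : MDifferentiableAt (𝓡 3) (𝓡 3) N.proj (d.symm (d x)) :=
      (N.contMDiffAt_proj hx').mdifferentiableAt (by simp)
    have hh : MDifferentiableAt (𝓡 3) 𝓘(ℝ, ℝ) N.height (d.symm (d x)) :=
      (N.contMDiffAt_height hx').mdifferentiableAt (by simp)
    have hd : MDifferentiableAt (𝓡 3) (𝓡 3) d (N.proj (d.symm (d x))) :=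
      d.mdifferentiable (by simp) _
    have hinj : ∀ (e : S3 ≃ₘ^∞⟮𝓡 3, 𝓡 3⟯ S3) (y : S3),
        Function.Injective (mfderiv (𝓡 3) (𝓡 3) e y) := fun e y =>
      injective_mfderiv_of_leftInverse (e.mdifferentiable (by simp) _)
        (e.symm.mdifferentiable (by simp) _) (Eventually.of_forall e.symm_apply_apply)
    rw [mfderiv_comp (d x) hd (hp.comp (d x) hd'), mfderiv_comp (d x) hp hd'] at h1
    rw [mfderiv_comp (d x) hh hd'] at h2
    have h3 := (injective_iff_map_eq_zero _).1 (hinj d _) _ h1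
    have h4 := N.immersion _ hx' _ h3 h2
    exact (injective_iff_map_eq_zero _).1 (hinj d.symm _) _ h4
  core := by
    rintro _ ⟨x, hx, rfl⟩
    obtain ⟨h1, h2, h3⟩ := N.core x hx
    refine ⟨⟨x, h1, rfl⟩, ?_, ?_⟩
    · simp [h2]
    · simp [h3]

/-- The new shadow is the image of the old one under the end map, and the inverse end map, extended
radially to `ℝ⁴`, leads back to the old shadow. -/
theorem map_inRegularPosition {Φ : AmbientIsotopy} {c : Circle → S3} (hc : SmoothLoop c)
    (h : N.InRegularPosition c) :
    (N.map Φ.diffeo).InRegularPosition (Φ.final ∘ c) ∧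
      (crossings ((N.map Φ.diffeo).shadow (Φ.final ∘ c))).encard =
        (crossings (N.shadow c)).encard := by
  have hsh : ∀ z, (N.map Φ.diffeo).shadow (Φ.final ∘ c) z = (Φ.final (N.proj (c z)) : E 4) := by
    intro z
    simp only [shadow, map, Function.comp_apply, AmbientIsotopy.final_eq,
      Diffeomorph.symm_apply_apply]
  have hint : ∀ z, (Φ.final ∘ c) z ∈ interior (N.map Φ.diffeo).carrier := by
    intro z
    have : Φ.diffeo '' interior N.carrier ⊆ interior (N.map Φ.diffeo).carrier := by
      refine interior_maximal (image_mono interior_subset) ?_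
      exact Φ.diffeo.toHomeomorph.isOpenMap _ isOpen_interior
    exact this ⟨_, h.1 z, rfl⟩
  have htr := h.2.transfer (c₂ := (N.map Φ.diffeo).shadow (Φ.final ∘ c))
    (g := fun x => (Φ.symm.final (normS x) : E 4)) (fun z => ?_) (fun z => ?_)
    (fun t => differentiableAt_shadow _ (Φ.smoothLoop hc) (fun z => interior_subset (hint z)) t) ?_
  · exact ⟨⟨hint, htr.1⟩, htr.2⟩
  · rw [hsh, normS_coe, AmbientIsotopy.symm_final_final]; rfl
  · rw [hsh]
    exact (contDiffAt_coe_apply (coe_ne_zero _) Φ.symm.contMDiff_final.contMDiffAt).differentiableAt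
      (by simp)
  · intro z w hzw
    have : N.proj (c z) = N.proj (c w) := Subtype.ext hzw
    rw [hsh, hsh, this]

end RegularNeighborhood

theorem surfaceCrossingNumber_image_le (K : Knot) (F : Set S3) (Φ : AmbientIsotopy) :
    surfaceCrossingNumber K (Φ.final '' F) ≤ surfaceCrossingNumber K F := by
  refine le_iInf fun N => le_iInf fun Ψ => le_iInf fun h => ?_
  obtain ⟨h1, h2⟩ := N.map_inRegularPosition (Φ := Φ) (Ψ.smoothLoop K.smoothLoop) h
  rw [← h2]
  exact (iInf_le_of_le (N.map Φ.diffeo) (iInf_le_of_le (Ψ.trans Φ) (iInf_le _ h1)))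

theorem surfaceCrossingNumber_le_image (K : Knot) (F : Set S3) (Φ : AmbientIsotopy) :
    surfaceCrossingNumber K F ≤ surfaceCrossingNumber K (Φ.final '' F) := by
  have h := surfaceCrossingNumber_image_le K (Φ.final '' F) Φ.symm
  simpa only [image_image, AmbientIsotopy.symm_final_final, image_id'] using h

/-! ### Charts adapted to a surface -/

/-- A point of `ℝ³` with prescribed coordinates. -/
def vec3 (a b c : ℝ) : E 3 := !₂[a, b, c]

@[simp] theorem vec3_zero (a b c : ℝ) : vec3 a b c 0 = a := rfl
@[simp] theorem vec3_one (a b c : ℝ) : vec3 a b c 1 = b := rfl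
@[simp] theorem vec3_two (a b c : ℝ) : vec3 a b c 2 = c := rfl

theorem ext3 {v w : E 3} (h0 : v 0 = w 0) (h1 : v 1 = w 1) (h2 : v 2 = w 2) : v = w := by
  ext i; fin_cases i
  · exact h0
  · exact h1
  · exact h2

theorem vec3_eta (v : E 3) : vec3 (v 0) (v 1) (v 2) = v := ext3 rfl rfl rfl

theorem contMDiffAt_vec3 {V H M : Type*} [NormedAddCommGroup V] [NormedSpace ℝ V]
    [TopologicalSpace H] {I : ModelWithCorners ℝ V H} [TopologicalSpace M] [ChartedSpace H M]
    {a b c : M → ℝ} {x : M} (ha : ContMDiffAt I 𝓘(ℝ, ℝ) ∞ a x) (hb : ContMDiffAt I 𝓘(ℝ, ℝ) ∞ b x)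
    (hc : ContMDiffAt I 𝓘(ℝ, ℝ) ∞ c x) :
    ContMDiffAt I 𝓘(ℝ, E 3) ∞ (fun y => vec3 (a y) (b y) (c y)) x := by
  have h1 : ContDiff ℝ ∞ fun q : ℝ × ℝ × ℝ => vec3 q.1 q.2.1 q.2.2 := by
    rw [contDiff_euclidean]
    intro i; fin_cases i
    · exact contDiff_fst
    · exact contDiff_fst.comp contDiff_snd
    · exact contDiff_snd.comp contDiff_snd
  exact h1.contMDiff.contMDiffAt.comp x (ha.prodMk_space (hb.prodMk_space hc))

theorem contDiff_apply3 (i : Fin 3) : ContDiff ℝ ∞ fun v : E 3 => v i :=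
  (EuclideanSpace.proj (𝕜 := ℝ) i).contDiff

/-- The projection of `ℝ³` to the horizontal coordinate plane. -/
def flat (v : E 3) : E 3 := vec3 (v 0) (v 1) 0

@[simp] theorem flat_zero' : flat 0 = 0 := ext3 rfl rfl rfl

theorem contDiff_flat : ContDiff ℝ ∞ flat := by
  rw [contDiff_iff_contDiffAt]
  intro v
  exact (contMDiffAt_vec3 (contDiff_apply3 0).contMDiff.contMDiffAt
    (contDiff_apply3 1).contMDiff.contMDiffAt contMDiffAt_const).contDiffAt

/-- `f` is the third coordinate in the chart `ψ`, which is centered at `x`. -/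
structure IsAdapted (ψ : Chart) (f : S3 → ℝ) (x : S3) : Prop where
  zero_mem : (0 : E 3) ∈ ψ.source
  map_zero : ψ 0 = x
  apply_eq : ∀ v ∈ ψ.source, f (ψ v) = v 2

theorem Chart.contMDiffAt_symm (ψ : Chart) {x : S3} (hx : x ∈ ψ.target) :
    ContMDiffAt (𝓡 3) (𝓡 3) ∞ ψ.symm x :=
  ψ.symm.contMDiffOn.contMDiffAt (ψ.open_target.mem_nhds hx)

theorem Chart.contMDiffAt (ψ : Chart) {v : E 3} (hv : v ∈ ψ.source) :
    ContMDiffAt (𝓡 3) (𝓡 3) ∞ ψ v :=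
  ψ.contMDiffOn.contMDiffAt (ψ.open_source.mem_nhds hv)

/-- Some partial derivative of the function in a chart is nonzero. Replacing that coordinate by the
function itself gives new local coordinates. -/
theorem exists_isAdapted {f : S3 → ℝ} {U : Set S3} (hU : IsOpen U)
    (hf : ContMDiffOn (𝓡 3) 𝓘(ℝ, ℝ) ∞ f U) {x : S3} (hx : x ∈ U) (hfx : f x = 0)
    (hd : mfderiv (𝓡 3) 𝓘(ℝ, ℝ) f x ≠ 0) :
    ∃ ψ : Chart, IsAdapted ψ f x ∧ ψ.target ⊆ U := by
  obtain ⟨ψ, y, hy, rfl⟩ := exists_chart x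
  set g : E 3 → ℝ := fun v => f (ψ v) with hg
  set W : Set (E 3) := ψ.source ∩ ψ ⁻¹' U with hW
  have hWo : IsOpen W := ψ.contMDiffOn.continuousOn.isOpen_inter_preimage ψ.open_source hU
  have hyW : y ∈ W := ⟨hy, hx⟩
  have hgW : ContDiffOn ℝ ∞ g W :=
    (hf.comp (ψ.contMDiffOn.mono inter_subset_left) fun v hv => hv.2).contDiffOn
  have hgd : DifferentiableAt ℝ g y := (hgW.contDiffAt (hWo.mem_nhds hyW)).differentiableAt (by simp)
  have hgy : fderiv ℝ g y ≠ 0 := by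
    intro h0
    apply hd
    have h1 : f =ᶠ[𝓝 (ψ y)] g ∘ ψ.symm := by
      filter_upwards [ψ.open_target.mem_nhds (ψ.map_source hy)] with z hz
      exact congrArg f (ψ.right_inv hz).symm
    have h2 : ψ.symm (ψ y) = y := ψ.left_inv hy
    have h3 : MDifferentiableAt 𝓘(ℝ, E 3) 𝓘(ℝ, ℝ) g (ψ.symm (ψ y)) := by
      rw [h2]; exact hgd.mdifferentiableAt
    have h4 : MDifferentiableAt (𝓡 3) 𝓘(ℝ, E 3) ψ.symm (ψ y) :=
      (ψ.contMDiffAt_symm (ψ.map_source hy)).mdifferentiableAt (by simp)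
    rw [h1.mfderiv_eq, mfderiv_comp _ h3 h4]
    have h5 : mfderiv 𝓘(ℝ, E 3) 𝓘(ℝ, ℝ) g (ψ.symm (ψ y)) = 0 := by
      rw [h2, mfderiv_eq_fderiv]; exact h0
    rw [h5]
    exact ContinuousLinearMap.zero_comp _
  obtain ⟨i, hi⟩ : ∃ i : Fin 3, fderiv ℝ g y (EuclideanSpace.single i 1) ≠ 0 := by
    by_contra! h
    apply hgy
    ext v
    have hv : v = ∑ i, v i • EuclideanSpace.single i (1 : ℝ) := by
      ext j; simp [Finset.sum_apply, Pi.single_apply]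
    rw [hv, map_sum]
    simp [h]
  -- Indices are taken modulo three: `i + 1` and `i + 2` are the two coordinates other than `i`, and
  -- the function takes the third place.
  set H : E 3 → E 3 := fun v => vec3 (v (i + 1) - y (i + 1)) (v (i + 2) - y (i + 2)) (g v) with hH
  have hHW : ContDiffOn ℝ ∞ H W := fun v hv =>
    (contMDiffAt_vec3 ((contDiff_apply3 _).sub contDiff_const).contMDiff.contMDiffAt
      ((contDiff_apply3 _).sub contDiff_const).contMDiff.contMDiffAt
      (hgW.contDiffAt (hWo.mem_nhds hv)).contMDiffAt).contDiffAt.contDiffWithinAt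
  have hHd := ((hHW.contDiffAt (hWo.mem_nhds hyW)).differentiableAt (by simp)).hasFDerivAt
  have hcoord : ∀ (j : Fin 3) (v : E 3), fderiv ℝ H y v j = fderiv ℝ (fun w => H w j) y v := by
    intro j v
    have h1 := (EuclideanSpace.proj (𝕜 := ℝ) j).hasFDerivAt.comp y hHd
    have h2 : fderiv ℝ (fun w => H w j) y = _ := h1.fderiv
    rw [h2]; rfl
  have hproj : ∀ (j : Fin 3) (v : E 3), fderiv ℝ (fun w : E 3 => w j - y j) y v = v j := by
    intro j v
    have h1 := ((EuclideanSpace.proj (𝕜 := ℝ) j).hasFDerivAt (x := y)).sub_const (y j)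
    have h2 : fderiv ℝ (fun w : E 3 => w j - y j) y = _ := h1.fderiv
    rw [h2]; rfl
  have hinj : Function.Injective (fderiv ℝ H y) := by
    rw [injective_iff_map_eq_zero]
    intro v hv
    have e0 := hcoord 0 v
    have e1 := hcoord 1 v
    have e2 := hcoord 2 v
    rw [hv] at e0 e1 e2
    simp only [hH, vec3_zero, vec3_one, vec3_two, hproj, PiLp.zero_apply] at e0 e1 e2
    have hv' : v = v i • EuclideanSpace.single i (1 : ℝ) := by
      ext j
      have h3 : ∀ i j : Fin 3, j = i ∨ j = i + 1 ∨ j = i + 2 := by decide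
      rcases h3 i j with rfl | rfl | rfl
      · simp
      · rw [← e0]; simp
      · rw [← e1]; simp
    rw [hv', map_smul, smul_eq_mul] at e2
    rcases mul_eq_zero.1 e2.symm with h | h
    · rw [hv', h, zero_smul]
    · exact absurd h hi
  obtain ⟨e, hye, heW, heH, hes, het⟩ := exists_openPartialHomeomorph_of_isInvertible hWo hHW hyW
    ⟨(LinearEquiv.ofInjectiveEndo (fderiv ℝ H y : E 3 →ₗ[ℝ] E 3) hinj).toContinuousLinearEquiv,
      by ext; rfl⟩
  have hH0 : H y = 0 := ext3 (by simp [hH]) (by simp [hH]) (by simpa [hH, hg] using hfx)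
  let e' : PartialDiffeomorph (𝓡 3) (𝓡 3) (E 3) (E 3) ∞ :=
    { toPartialEquiv := e.symm.toPartialEquiv, open_source := e.open_target
      open_target := e.open_source
      contMDiffOn_toFun := het.contMDiffOn, contMDiffOn_invFun := hes.contMDiffOn }
  have hsrc : (e'.trans ψ).source = e.target := by
    ext v
    constructor
    · intro hv; exact hv.1
    · intro hv; exact ⟨hv, (heW (e.map_target hv)).1⟩
  refine ⟨e'.trans ψ, ⟨?_, ?_, ?_⟩, ?_⟩
  · rw [hsrc, ← hH0, ← heH]; exact e.map_source hye
  · change ψ (e.symm 0) = ψ y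
    rw [← hH0, ← heH, e.left_inv hye]
  · intro v hv
    rw [hsrc] at hv
    change g (e.symm v) = v 2
    conv_rhs => rw [← e.right_inv hv, heH]
    rfl
  · intro z hz
    obtain ⟨v, hv, rfl⟩ : ∃ v ∈ (e'.trans ψ).source, (e'.trans ψ) v = z :=
      ⟨_, (e'.trans ψ).symm.map_source hz, (e'.trans ψ).right_inv hz⟩
    rw [hsrc] at hv
    exact (heW (e.map_target hv)).2

/-- A subset of the 3-sphere that is locally the zero set of a submersion. -/
def LocallyFlat (F : Set S3) : Prop :=
  ∀ x ∈ F, ∃ (ψ : Chart), (0 : E 3) ∈ ψ.source ∧ ψ 0 = x ∧ ∀ v ∈ ψ.source, ψ v ∈ F ↔ v 2 = 0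

theorem IsClosedSurface.locallyFlat {F : Set S3} (hF : IsClosedSurface F) : LocallyFlat F := by
  intro x hx
  obtain ⟨U, f, hxU, hf⟩ := hF.embedded x hx
  have hiff : ∀ z ∈ U, z ∈ F ↔ f z = 0 := by
    intro z hz
    have := congrArg (fun s => z ∈ s) hf.zeroSet
    simp only [mem_inter_iff, mem_ofPred_eq, hz, and_true, true_and, eq_iff_iff] at this
    exact this
  obtain ⟨ψ, hψ, hψU⟩ := exists_isAdapted hf.isOpen hf.smooth hxU ((hiff x hxU).1 hx)
    (hf.regular x ⟨hx, hxU⟩)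
  refine ⟨ψ, hψ.zero_mem, hψ.map_zero, fun v hv => ?_⟩
  rw [hiff _ (hψU (ψ.map_source hv)), hψ.apply_eq v hv]

/-! ### The product structure of a regular neighbourhood -/

instance : Nonempty S3 := ⟨normS 0⟩

namespace RegularNeighborhood

variable {F : Set S3} (N : RegularNeighborhood F)

/-- The product structure, as a map to a vector space. -/
def pair (x : S3) : E 4 × ℝ := (N.proj x, N.height x)

theorem contMDiffAt_pair {x : S3} (hx : x ∈ N.carrier) :
    ContMDiffAt (𝓡 3) 𝓘(ℝ, E 4 × ℝ) ∞ N.pair x :=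
  (contMDiff_coe.contMDiffAt.comp x (N.contMDiffAt_proj hx)).prodMk_space (N.contMDiffAt_height hx)

theorem injective_mfderiv_pair {x : S3} (hx : x ∈ N.carrier) :
    Function.Injective (mfderiv (𝓡 3) 𝓘(ℝ, E 4 × ℝ) N.pair x) := by
  have h0 : MDifferentiableAt (𝓡 3) 𝓘(ℝ, E 4 × ℝ) N.pair x :=
    (N.contMDiffAt_pair hx).mdifferentiableAt (by simp)
  have hp : MDifferentiableAt (𝓡 3) (𝓡 3) N.proj x :=
    (N.contMDiffAt_proj hx).mdifferentiableAt (by simp)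
  have hc : MDifferentiableAt (𝓡 3) 𝓘(ℝ, E 4) ((↑) : S3 → E 4) (N.proj x) :=
    contMDiff_coe.contMDiffAt.mdifferentiableAt (by simp)
  have hfst : MDifferentiableAt 𝓘(ℝ, E 4 × ℝ) 𝓘(ℝ, E 4) (Prod.fst : E 4 × ℝ → E 4) (N.pair x) :=
    differentiableAt_fst.mdifferentiableAt
  have hsnd : MDifferentiableAt 𝓘(ℝ, E 4 × ℝ) 𝓘(ℝ, ℝ) (Prod.snd : E 4 × ℝ → ℝ) (N.pair x) :=
    differentiableAt_snd.mdifferentiableAt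
  have e1 : mfderiv (𝓡 3) 𝓘(ℝ, E 4) (Prod.fst ∘ N.pair) x =
      mfderiv (𝓡 3) 𝓘(ℝ, E 4) (((↑) : S3 → E 4) ∘ N.proj) x := rfl
  have e2 : mfderiv (𝓡 3) 𝓘(ℝ, ℝ) (Prod.snd ∘ N.pair) x = mfderiv (𝓡 3) 𝓘(ℝ, ℝ) N.height x := rfl
  rw [mfderiv_comp x hfst h0, mfderiv_comp x hc hp] at e1
  rw [mfderiv_comp x hsnd h0] at e2
  refine (injective_iff_map_eq_zero _).2 fun v hv => ?_
  have f1 := congrArg (fun L => L v) e1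
  have f2 := congrArg (fun L => L v) e2
  simp only [ContinuousLinearMap.comp_apply] at f1 f2
  rw [hv, map_zero] at f1 f2
  refine N.immersion x hx v ?_ f2.symm
  exact (injective_iff_map_eq_zero _).1 (injective_mvfderiv_subtypeVal_sphere (n := 3) (N.proj x)) _ f1.symm

/-- The product structure has smooth local left inverses. -/
theorem exists_leftInverse {x : S3} (hx : x ∈ N.carrier) :
    ∃ (Λ : E 4 × ℝ → S3) (O : Set S3), IsOpen O ∧ x ∈ O ∧ (∀ y ∈ O, Λ (N.pair y) = y) ∧
      ∀ᶠ q in 𝓝 (N.pair x), ContMDiffAt 𝓘(ℝ, E 4 × ℝ) (𝓡 3) ∞ Λ q := by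
  -- A linear left inverse `P` of the differential makes `P ∘ pair` a local diffeomorphism between
  -- 3-manifolds, and its inverse composed with `P` is the left inverse sought. It is smooth on an
  -- open set of `ℝ⁴ × ℝ`, so no manifold structure on `F` is needed.
  obtain ⟨P, hP⟩ : ∃ P : (E 4 × ℝ) →L[ℝ] E 3,
      ∀ v : TangentSpace (𝓡 3) x, P (mfderiv (𝓡 3) 𝓘(ℝ, E 4 × ℝ) N.pair x v) = v := by
    let A : E 3 →L[ℝ] E 4 × ℝ := mfderiv (𝓡 3) 𝓘(ℝ, E 4 × ℝ) N.pair x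
    have hA : Function.Injective (A : E 3 →ₗ[ℝ] E 4 × ℝ) := N.injective_mfderiv_pair hx
    obtain ⟨P, hP⟩ := LinearMap.exists_leftInverse_of_injective (A : E 3 →ₗ[ℝ] E 4 × ℝ)
      (LinearMap.ker_eq_bot.2 hA)
    exact ⟨LinearMap.toContinuousLinearMap P, fun v => congrArg (fun L => L v) hP⟩
  have hPs : ContMDiff 𝓘(ℝ, E 4 × ℝ) 𝓘(ℝ, E 3) ∞ P := P.contDiff.contMDiff
  have hsm : ContMDiffOn (𝓡 3) 𝓘(ℝ, E 3) ∞ (P ∘ N.pair) N.domain :=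
    hPs.comp_contMDiffOn ((contMDiff_coe.comp_contMDiffOn N.smooth_proj).prodMk_space
      N.smooth_height)
  have hloc : IsLocalDiffeomorphAt (𝓡 3) (𝓡 3) ∞ (P ∘ N.pair) x := by
    refine isLocalDiffeomorphAt_of_injective_mfderiv N.isOpen_domain hsm (N.carrier_subset hx) rfl ?_
    rw [mfderiv_comp x (hPs.contMDiffAt.mdifferentiableAt (by simp))
      ((N.contMDiffAt_pair hx).mdifferentiableAt (by simp))]
    refine (injective_iff_map_eq_zero _).2 fun v hv => ?_
    have h1 : mfderiv 𝓘(ℝ, E 4 × ℝ) 𝓘(ℝ, E 3) P (N.pair x) = P := by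
      rw [mfderiv_eq_fderiv]; exact P.fderiv
    rw [ContinuousLinearMap.comp_apply, h1] at hv
    exact (hP v).symm.trans hv
  obtain ⟨Φ, hxΦ, hΦ⟩ := hloc
  refine ⟨fun q => Φ.symm (P q), Φ.source, Φ.open_source, hxΦ, fun y hy => ?_, ?_⟩
  · have : P (N.pair y) = Φ y := hΦ hy
    change Φ.symm (P (N.pair y)) = y
    rw [this]; exact Φ.left_inv hy
  · have h1 : P (N.pair x) ∈ Φ.target := by
      have : P (N.pair x) = Φ x := hΦ hxΦ
      rw [this]; exact Φ.map_source hxΦ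
    filter_upwards [P.continuous.continuousAt.preimage_mem_nhds (Φ.open_target.mem_nhds h1)]
      with q hq
    exact (Φ.symm.contMDiffOn.contMDiffAt (Φ.open_target.mem_nhds hq)).comp q hPs.contMDiffAt

/-- A continuous map to a regular neighbourhood is smooth if its two components are. -/
theorem contMDiffAt_of_pair {V H M : Type*} [NormedAddCommGroup V] [NormedSpace ℝ V]
    [TopologicalSpace H] {I : ModelWithCorners ℝ V H} [TopologicalSpace M] [ChartedSpace H M]
    {f : M → S3} {m : M} (hm : f m ∈ N.carrier) (hc : ContinuousAt f m)
    (hp : ContMDiffAt I (𝓡 3) ∞ (fun y => N.proj (f y)) m)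
    (hh : ContMDiffAt I 𝓘(ℝ, ℝ) ∞ (fun y => N.height (f y)) m) : ContMDiffAt I (𝓡 3) ∞ f m := by
  obtain ⟨Λ, O, hO, hmO, hΛ, hΛs⟩ := N.exists_leftInverse hm
  have h1 : ContMDiffAt I 𝓘(ℝ, E 4 × ℝ) ∞ (fun y => N.pair (f y)) m :=
    (contMDiff_coe.contMDiffAt.comp m hp).prodMk_space hh
  have h2 : ContMDiffAt I (𝓡 3) ∞ (fun y => Λ (N.pair (f y))) m :=
    ContMDiffAt.comp m hΛs.self_of_nhds h1
  refine h2.congr_of_eventuallyEq ?_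
  filter_upwards [hc.preimage_mem_nhds (hO.mem_nhds hmO)] with y hy
  exact (hΛ _ hy).symm

/-- The inverse of the product structure. -/
def inv (y : S3) (t : ℝ) : S3 :=
  Function.invFunOn (fun x => (N.proj x, N.height x)) N.carrier (y, t)

variable {N}

theorem inv_spec {y : S3} (hy : y ∈ F) {t : ℝ} (ht : t ∈ Icc (-1 : ℝ) 1) :
    N.inv y t ∈ N.carrier ∧ N.proj (N.inv y t) = y ∧ N.height (N.inv y t) = t := by
  obtain ⟨x, hx, h⟩ := N.bijOn.surjOn (show (y, t) ∈ F ×ˢ Icc (-1 : ℝ) 1 from ⟨hy, ht⟩)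
  have h1 : N.inv y t ∈ N.carrier := Function.invFunOn_mem ⟨x, hx, h⟩
  have h2 : (N.proj (N.inv y t), N.height (N.inv y t)) = (y, t) :=
    Function.invFunOn_eq (f := fun x => (N.proj x, N.height x)) ⟨x, hx, h⟩
  rw [Prod.mk.injEq] at h2
  exact ⟨h1, h2⟩

theorem eq_of_proj_height {x x' : S3} (hx : x ∈ N.carrier) (hx' : x' ∈ N.carrier)
    (h1 : N.proj x = N.proj x') (h2 : N.height x = N.height x') : x = x' :=
  N.bijOn.injOn hx hx' (Prod.ext h1 h2)

theorem inv_proj_height {x : S3} (hx : x ∈ N.carrier) : N.inv (N.proj x) (N.height x) = x := by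
  obtain ⟨h1, h2, h3⟩ := inv_spec (N.proj_mem hx) (N.height_mem hx)
  exact eq_of_proj_height h1 hx h2 h3

/-- The inverse of a continuous bijection from a compact space to a Hausdorff space is continuous.
-/
theorem continuousOn_inv :
    ContinuousOn (fun q : S3 × ℝ => N.inv q.1 q.2) (F ×ˢ Icc (-1 : ℝ) 1) := by
  rw [continuousOn_iff_isClosed]
  intro C hC
  have hcont : ContinuousOn (fun x => (N.proj x, N.height x)) N.carrier :=
    (N.smooth_proj.continuousOn.mono N.carrier_subset).prodMk
      (N.smooth_height.continuousOn.mono N.carrier_subset)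
  refine ⟨(fun x => (N.proj x, N.height x)) '' (N.carrier ∩ C), ?_, ?_⟩
  · exact ((N.compact.inter_right hC).image_of_continuousOn
      (hcont.mono inter_subset_left)).isClosed
  · ext ⟨y, t⟩
    constructor
    · rintro ⟨h1, h2, h3⟩
      obtain ⟨i1, i2, i3⟩ := inv_spec (N := N) h2 h3
      exact ⟨⟨_, ⟨i1, h1⟩, Prod.ext i2 i3⟩, h2, h3⟩
    · rintro ⟨⟨x, ⟨hx, hxC⟩, h⟩, h2⟩
      simp only [Prod.mk.injEq] at h
      refine ⟨?_, h2⟩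
      rw [mem_preimage, ← h.1, ← h.2, inv_proj_height hx]
      exact hxC

/-- Maps given by their two components are smooth. -/
theorem contMDiffAt_inv {V H M : Type*} [NormedAddCommGroup V] [NormedSpace ℝ V]
    [TopologicalSpace H] {I : ModelWithCorners ℝ V H} [TopologicalSpace M] [ChartedSpace H M]
    {a : M → S3} {b : M → ℝ} {m : M} (hab : ∀ᶠ y in 𝓝 m, a y ∈ F ∧ b y ∈ Icc (-1 : ℝ) 1)
    (ha : ContMDiffAt I (𝓡 3) ∞ a m) (hb : ContMDiffAt I 𝓘(ℝ, ℝ) ∞ b m) :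
    ContMDiffAt I (𝓡 3) ∞ (fun y => N.inv (a y) (b y)) m := by
  have hm := hab.self_of_nhds
  have hc : ContinuousAt (fun y => N.inv (a y) (b y)) m := by
    have h1 : Tendsto (fun y => (a y, b y)) (𝓝 m) (𝓝[F ×ˢ Icc (-1 : ℝ) 1] (a m, b m)) :=
      tendsto_nhdsWithin_iff.2 ⟨ha.continuousAt.prodMk hb.continuousAt, hab⟩
    exact (continuousOn_inv (N := N) (a m, b m) hm).tendsto.comp h1
  refine N.contMDiffAt_of_pair (inv_spec hm.1 hm.2).1 hc ?_ ?_
  · refine ha.congr_of_eventuallyEq ?_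
    filter_upwards [hab] with y hy using (inv_spec hy.1 hy.2).2.1
  · refine hb.congr_of_eventuallyEq ?_
    filter_upwards [hab] with y hy using (inv_spec hy.1 hy.2).2.2

/-- Product charts: near a point of `N(F)` of height different from `±1`, the third coordinate is
the height and the first two coordinates come from a chart of `F`. -/
theorem exists_productChart (hF : LocallyFlat F) {x : S3} (hx : x ∈ N.carrier)
    (hh : |N.height x| < 1) :
    ∃ Φ ψ : Chart, (0 : E 3) ∈ Φ.source ∧ Φ 0 = x ∧ Φ.target ⊆ N.carrier ∧
      ∀ v ∈ Φ.source, flat v ∈ ψ.source ∧ N.proj (Φ v) = ψ (flat v) ∧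
        N.height (Φ v) = N.height x + v 2 := by
  obtain ⟨ψ, hψ0, hψx, hψ⟩ := hF _ (N.proj_mem hx)
  set h := N.height x with hhdef
  set U : Set (E 3) := flat ⁻¹' ψ.source ∩ {v | |h + v 2| < 1} with hU
  have hUo : IsOpen U := (ψ.open_source.preimage contDiff_flat.continuous).inter
    (isOpen_lt (by fun_prop) continuous_const)
  have hab : ∀ v ∈ U, ψ (flat v) ∈ F ∧ h + v 2 ∈ Icc (-1 : ℝ) 1 := fun v hv =>
    ⟨(hψ _ hv.1).2 rfl, (abs_le.1 (le_of_lt hv.2))⟩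
  set f : E 3 → S3 := fun v => N.inv (ψ (flat v)) (h + v 2) with hf
  have hspec : ∀ v ∈ U, f v ∈ N.carrier ∧ N.proj (f v) = ψ (flat v) ∧ N.height (f v) = h + v 2 :=
    fun v hv => inv_spec (hab v hv).1 (hab v hv).2
  have hfs : ContMDiffOn (𝓡 3) (𝓡 3) ∞ f U := by
    intro v hv
    refine (contMDiffAt_inv ?_ ?_ ?_).contMDiffWithinAt
    · filter_upwards [hUo.mem_nhds hv] with w hw using hab w hw
    · exact (ψ.contMDiffAt hv.1).comp v contDiff_flat.contMDiff.contMDiffAt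
    · exact (contDiff_const.add (contDiff_apply3 2)).contMDiff.contMDiffAt
  set W : Set S3 := N.domain ∩ N.proj ⁻¹' ψ.target with hW
  have hWo : IsOpen W := N.smooth_proj.continuousOn.isOpen_inter_preimage N.isOpen_domain
    ψ.open_target
  set g : S3 → E 3 := fun z => vec3 (ψ.symm (N.proj z) 0) (ψ.symm (N.proj z) 1) (N.height z - h)
    with hg
  have hgs : ContMDiffOn (𝓡 3) (𝓡 3) ∞ g W := by
    intro z hz
    have h1 : ContMDiffAt (𝓡 3) (𝓡 3) ∞ (fun z => ψ.symm (N.proj z)) z :=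
      (ψ.contMDiffAt_symm hz.2).comp z (N.smooth_proj.contMDiffAt (N.isOpen_domain.mem_nhds hz.1))
    have h2 : ContMDiffAt (𝓡 3) 𝓘(ℝ, ℝ) ∞ N.height z :=
      N.smooth_height.contMDiffAt (N.isOpen_domain.mem_nhds hz.1)
    refine (contMDiffAt_vec3 ?_ ?_ ?_).contMDiffWithinAt
    · exact (contDiff_apply3 0).contMDiff.contMDiffAt.comp z h1
    · exact (contDiff_apply3 1).contMDiff.contMDiffAt.comp z h1
    · exact (contDiff_id.sub contDiff_const).contMDiff.contMDiffAt.comp z h2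
  have hUW : MapsTo f U W := fun v hv => ⟨N.carrier_subset (hspec v hv).1, by
    rw [mem_preimage, (hspec v hv).2.1]; exact ψ.map_source hv.1⟩
  have hgf : ∀ v ∈ U, g (f v) = v := by
    intro v hv
    have h1 : ψ.symm (N.proj (f v)) = flat v := by
      rw [(hspec v hv).2.1]; exact ψ.left_inv hv.1
    simp only [hg, h1, (hspec v hv).2.2]
    exact ext3 rfl rfl (by simp)
  obtain ⟨Φ, hΦs, hΦf, hΦt⟩ := exists_partialDiffeomorph_of_leftInverse hUo hWo hfs hgs hUW hgf rfl
  have h0U : (0 : E 3) ∈ U := ⟨by simpa using hψ0, by simpa using hh⟩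
  refine ⟨Φ, ψ, by rwa [hΦs], ?_, ?_, ?_⟩
  · rw [hΦf]
    simp only [hf, flat_zero', hψx, PiLp.zero_apply, add_zero]
    exact inv_proj_height hx
  · rw [hΦt]
    rintro _ ⟨v, hv, rfl⟩
    exact (hspec v hv).1
  · intro v hv
    rw [hΦs] at hv
    rw [hΦf]
    exact ⟨hv.1, (hspec v hv).2⟩

theorem mem_interior_of_height (hF : LocallyFlat F) {x : S3} (hx : x ∈ N.carrier)
    (hh : |N.height x| < 1) : x ∈ interior N.carrier := by
  obtain ⟨Φ, -, h0, hΦ0, hΦ, -⟩ := exists_productChart hF hx hh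
  refine interior_maximal hΦ Φ.open_target ?_
  rw [← hΦ0]; exact Φ.map_source h0

/-- At an interior point the surface coordinates of the projection together with the height form a
local diffeomorphism to `ℝ³`. The height therefore takes all values near `N.height x`, and all of
them lie in `[-1, 1]`. -/
theorem height_lt_of_mem_interior (hF : LocallyFlat F) {x : S3} (hx : x ∈ interior N.carrier) :
    |N.height x| < 1 := by
  have hxc := interior_subset hx
  obtain ⟨ψ, hψ0, hψx, hψ⟩ := hF _ (N.proj_mem hxc)
  obtain ⟨Λ, O, hO, hxO, hΛ, hΛs⟩ := N.exists_leftInverse hxc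
  set h := N.height x with hhdef
  set W : Set S3 := interior N.carrier ∩ N.proj ⁻¹' ψ.target with hW
  have hWo : IsOpen W := (N.smooth_proj.continuousOn.mono
    (interior_subset.trans N.carrier_subset)).isOpen_inter_preimage isOpen_interior ψ.open_target
  have hxW : x ∈ W := ⟨hx, by rw [mem_preimage, ← hψx]; exact ψ.map_source hψ0⟩
  set g : S3 → E 3 := fun z => vec3 (ψ.symm (N.proj z) 0) (ψ.symm (N.proj z) 1) (N.height z - h)
    with hg
  have hgs : ContMDiffOn (𝓡 3) (𝓡 3) ∞ g W := by
    intro z hz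
    have hzc := interior_subset hz.1
    have h1 : ContMDiffAt (𝓡 3) (𝓡 3) ∞ (fun z => ψ.symm (N.proj z)) z :=
      (ψ.contMDiffAt_symm hz.2).comp z (N.contMDiffAt_proj hzc)
    refine (contMDiffAt_vec3 ?_ ?_ ?_).contMDiffWithinAt
    · exact (contDiff_apply3 0).contMDiff.contMDiffAt.comp z h1
    · exact (contDiff_apply3 1).contMDiff.contMDiffAt.comp z h1
    · exact (contDiff_id.sub contDiff_const).contMDiff.contMDiffAt.comp z (N.contMDiffAt_height hzc)
  have hx0 : ψ.symm (N.proj x) = 0 := by rw [← hψx]; exact ψ.left_inv hψ0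
  have hgx : g x = 0 := ext3 (by change ψ.symm (N.proj x) 0 = 0; rw [hx0]; rfl)
    (by change ψ.symm (N.proj x) 1 = 0; rw [hx0]; rfl) (by simp [hg, hhdef])
  -- A smooth left inverse of `g` near `x`, which forces the differential of `g` to be injective.
  set L : E 3 → S3 := fun v => Λ (ψ (flat v), h + v 2) with hL
  have hpx : N.pair x = ((ψ (flat (g x)) : E 4), h + g x 2) := by
    rw [hgx, flat_zero', hψx]; simp [pair, hhdef]
  have hLs : ContMDiffAt (𝓡 3) (𝓡 3) ∞ L (g x) := by
    refine ContMDiffAt.comp (g x) (g := Λ) (by rw [← hpx]; exact hΛs.self_of_nhds) ?_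
    refine ContMDiffAt.prodMk_space (contMDiff_coe.contMDiffAt.comp _ ?_) ?_
    · exact (ψ.contMDiffAt (by rwa [hgx, flat_zero'])).comp _ contDiff_flat.contMDiff.contMDiffAt
    · exact (contDiff_const.add (contDiff_apply3 2)).contMDiff.contMDiffAt
  have hloc : IsLocalDiffeomorphAt (𝓡 3) (𝓡 3) ∞ g x := by
    refine isLocalDiffeomorphAt_of_injective_mfderiv hWo hgs hxW rfl ?_
    refine injective_mfderiv_of_leftInverse (g := L)
      ((hgs.contMDiffAt (hWo.mem_nhds hxW)).mdifferentiableAt (by simp))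
      (hLs.mdifferentiableAt (by simp)) ?_
    filter_upwards [hWo.mem_nhds hxW, hO.mem_nhds hxO] with z hz hzO
    have h1 : ψ (ψ.symm (N.proj z)) = N.proj z := ψ.right_inv hz.2
    have h2 : ψ.symm (N.proj z) 2 = 0 := by
      rw [← hψ _ (ψ.symm.map_source hz.2), h1]
      exact N.proj_mem (interior_subset hz.1)
    have h3 : flat (g z) = ψ.symm (N.proj z) := ext3 rfl rfl h2.symm
    have h4 : h + g z 2 = N.height z := by simp [hg]
    simp only [hL]
    rw [h3, h1, h4]
    exact hΛ z hzO
  obtain ⟨Φ, hxΦ, hΦ⟩ := hloc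
  have hΦx : Φ x = 0 := by rw [← hΦ hxΦ, hgx]
  have h0t : (0 : E 3) ∈ Φ.target := by rw [← hΦx]; exact Φ.map_source hxΦ
  have hsx : Φ.symm 0 = x := by rw [← hΦx]; exact Φ.left_inv hxΦ
  have hv : Continuous fun δ : ℝ => vec3 0 0 δ :=
    (contMDiff_iff_contDiff.1 (fun δ => contMDiffAt_vec3 contMDiffAt_const contMDiffAt_const
      contMDiffAt_id : ContMDiff 𝓘(ℝ, ℝ) 𝓘(ℝ, E 3) ∞ fun δ : ℝ => vec3 0 0 δ)).continuous
  have hv0 : vec3 0 0 0 = 0 := ext3 rfl rfl rfl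
  have hvt : Tendsto (fun δ : ℝ => vec3 0 0 δ) (𝓝 0) (𝓝 0) := by
    simpa only [hv0] using hv.tendsto 0
  have hsc : Tendsto Φ.symm (𝓝 0) (𝓝 x) := by
    have := (Φ.symm.contMDiffOn.contMDiffAt (Φ.open_target.mem_nhds h0t)).continuousAt.tendsto
    rwa [hsx] at this
  have hev := (hvt.eventually (Φ.open_target.mem_nhds h0t)).and
    ((hsc.comp hvt).eventually (isOpen_interior.mem_nhds hx))
  obtain ⟨ε, hε, hball⟩ := Metric.eventually_nhds_iff_ball.1 hev
  have hkey : ∀ δ : ℝ, |δ| < ε → h + δ ∈ Icc (-1 : ℝ) 1 := by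
    intro δ hδ
    obtain ⟨h1, h2⟩ := hball δ (by simpa using hδ)
    have h3 : g (Φ.symm (vec3 0 0 δ)) = vec3 0 0 δ := by
      rw [hΦ (Φ.symm.map_source h1)]; exact Φ.right_inv h1
    have h4 := congrArg (fun v => v 2) h3
    simp only [hg, vec3_two] at h4
    have h5 := N.height_mem (interior_subset h2)
    rwa [show h + δ = N.height (Φ.symm (vec3 0 0 δ)) by linarith]
  have h1 := hkey (ε / 2) (by rw [abs_of_pos (by linarith)]; linarith)
  have h2 := hkey (-(ε / 2)) (by rw [abs_neg, abs_of_pos (by linarith)]; linarith)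
  rw [abs_lt]
  constructor
  · linarith [h2.1]
  · linarith [h1.2]

/-! ### Isotopies along the fibres of a regular neighbourhood -/

/-- The fibrewise rescaling of a regular neighbourhood by a self-map of the interval. -/
def fiberMap (N : RegularNeighborhood F) (lam : ℝ → ℝ) (x : S3) : S3 :=
  open Classical in
    if x ∈ N.carrier ∧ |N.height x| < 1 then N.inv (N.proj x) (lam (N.height x)) else x

theorem fiberMap_spec {lam : ℝ → ℝ} (hlam : ∀ h, |h| < 1 → |lam h| < 1) {x : S3}
    (hx : x ∈ N.carrier) (hh : |N.height x| < 1) :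
    N.fiberMap lam x ∈ N.carrier ∧ N.proj (N.fiberMap lam x) = N.proj x ∧
      N.height (N.fiberMap lam x) = lam (N.height x) := by
  rw [fiberMap, if_pos ⟨hx, hh⟩]
  exact inv_spec (N.proj_mem hx) (abs_le.1 (hlam _ hh).le)

theorem fiberMap_eq_self {lam : ℝ → ℝ} {ρ : ℝ} (hρ : ∀ h, ρ < |h| → lam h = h) {x : S3}
    (hx : ¬ (x ∈ N.carrier ∧ |N.height x| ≤ ρ)) : N.fiberMap lam x = x := by
  rw [fiberMap]
  split_ifs with h
  · rw [hρ, inv_proj_height h.1]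
    by_contra! h'
    exact hx ⟨h.1, h'⟩
  · rfl

theorem fiberMap_comp {lam mu : ℝ → ℝ} (hlam : ∀ h, |h| < 1 → |lam h| < 1)
    (hmu : ∀ h, mu (lam h) = h) (x : S3) : N.fiberMap mu (N.fiberMap lam x) = x := by
  by_cases h : x ∈ N.carrier ∧ |N.height x| < 1
  · obtain ⟨h1, h2, h3⟩ := fiberMap_spec hlam h.1 h.2
    conv_lhs => rw [fiberMap]
    rw [if_pos ⟨h1, by rw [h3]; exact hlam _ h.2⟩, h2, h3, hmu, inv_proj_height h.1]
  · rw [fiberMap, fiberMap, if_neg h, if_neg h]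

/-- Near a point of the compact set where the height is at most `ρ`, the map is given by smooth
components; on the complement of that set it is the identity. -/
theorem contMDiff_fiberMap (hF : LocallyFlat F) {lam : ℝ → ℝ → ℝ} {ρ : ℝ} (hρ1 : ρ < 1)
    (hs : ContDiff ℝ ∞ fun q : ℝ × ℝ => lam q.1 q.2)
    (hlam : ∀ s h, |h| < 1 → |lam s h| < 1) (hρ : ∀ s h, ρ < |h| → lam s h = h) :
    ContMDiff (𝓘(ℝ, ℝ).prod (𝓡 3)) (𝓡 3) ∞
      (fun q : ℝ × S3 => N.fiberMap (lam q.1) q.2) := by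
  rintro ⟨s, x⟩
  by_cases hx : x ∈ N.carrier ∧ |N.height x| ≤ ρ
  · have hxi : x ∈ interior N.carrier := mem_interior_of_height hF hx.1 (hx.2.trans_lt hρ1)
    have hU : ∀ᶠ q : ℝ × S3 in 𝓝 (s, x), q.2 ∈ interior N.carrier :=
      continuousAt_snd.eventually (isOpen_interior.mem_nhds hxi)
    have hp : ContMDiffAt (𝓘(ℝ, ℝ).prod (𝓡 3)) (𝓡 3) ∞ (fun q : ℝ × S3 => N.proj q.2) (s, x) :=
      ContMDiffAt.comp (s, x) (N.contMDiffAt_proj hx.1) contMDiffAt_snd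
    have hh : ContMDiffAt (𝓘(ℝ, ℝ).prod (𝓡 3)) 𝓘(ℝ, ℝ) ∞ (fun q : ℝ × S3 => N.height q.2) (s, x) :=
      ContMDiffAt.comp (s, x) (N.contMDiffAt_height hx.1) contMDiffAt_snd
    have hlh : ContMDiffAt (𝓘(ℝ, ℝ).prod (𝓡 3)) 𝓘(ℝ, ℝ) ∞
        (fun q : ℝ × S3 => lam q.1 (N.height q.2)) (s, x) :=
      hs.contMDiff.contMDiffAt.comp (s, x) (contMDiffAt_fst.prodMk_space hh)
    refine (contMDiffAt_inv (N := N) ?_ hp hlh).congr_of_eventuallyEq ?_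
    · filter_upwards [hU] with q hq
      exact ⟨N.proj_mem (interior_subset hq),
        abs_le.1 (hlam _ _ (height_lt_of_mem_interior hF hq)).le⟩
    · filter_upwards [hU] with q hq
      rw [fiberMap, if_pos ⟨interior_subset hq, height_lt_of_mem_interior hF hq⟩]
  · have hcl : IsClosed {x | x ∈ N.carrier ∧ |N.height x| ≤ ρ} := by
      have h1 : ContinuousOn (fun x => |N.height x|) N.carrier :=
        (N.smooth_height.continuousOn.mono N.carrier_subset).abs
      exact h1.preimage_isClosed_of_isClosed N.compact.isClosed isClosed_Iic
    refine (contMDiff_snd (s, x)).congr_of_eventuallyEq ?_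
    have hev : ∀ᶠ q : ℝ × S3 in 𝓝 (s, x), q.2 ∈ {x | x ∈ N.carrier ∧ |N.height x| ≤ ρ}ᶜ :=
      continuousAt_snd.eventually (hcl.isOpen_compl.mem_nhds (by exact hx))
    filter_upwards [hev] with q hq
    exact fiberMap_eq_self (hρ q.1) hq

/-- A compact part of the interior of a regular neighbourhood can be moved along the fibres into an
arbitrarily small neighbourhood of the surface. -/
theorem exists_ambientIsotopy_shrink (N : RegularNeighborhood F) (hF : LocallyFlat F) {h₀ η : ℝ}
    (h₀1 : h₀ < 1) (hη : 0 < η) :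
    ∃ Φ : AmbientIsotopy, ∀ x ∈ N.carrier, |N.height x| ≤ h₀ →
      Φ.final x ∈ N.carrier ∧ N.proj (Φ.final x) = N.proj x ∧ |N.height (Φ.final x)| < η := by
  obtain ⟨β, Q, hβ, hQ, hQs, hβ0, -, hβ1⟩ := exists_cutoff
    (isCompact_closedBall (0 : ℝ) h₀) (isOpen_ball (x := (0 : ℝ)) (ε := 1))
    (closedBall_subset_ball h₀1)
  -- The support of the cutoff is compact in `(-1, 1)`, so the rescaling is the identity for heights
  -- beyond some `ρ < 1`, that is, near the boundary of the neighbourhood.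
  obtain ⟨ρ, hρ1, hρ⟩ : ∃ ρ < 1, ∀ h ∈ Q, |h| ≤ ρ := by
    rcases Q.eq_empty_or_nonempty with h | h
    · exact ⟨0, one_pos, by simp [h]⟩
    · obtain ⟨q, hq, hmax⟩ := hQ.exists_isMaxOn h (continuous_abs.continuousOn)
      exact ⟨|q|, by simpa using hQs hq, fun h hh => hmax hh⟩
  have hg : ContDiff ℝ ∞ fun y => β y * y := hβ.mul contDiff_id
  obtain ⟨k, hk⟩ := exists_lipschitzWith_of_hasCompactSupport hg
    (hasCompactSupport_of_zero hQ fun x hx => by rw [hβ0 x hx, zero_mul])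
  set c : ℝ := (2 * ((k : ℝ) + 1))⁻¹ with hc
  have hk0 : (0 : ℝ) ≤ k := k.2
  have hcpos : 0 < c := by positivity
  have hc1 : c < 1 := by
    rw [hc]; apply inv_lt_one_of_one_lt₀; linarith
  have hck : c * k ≤ 2⁻¹ := by
    rw [hc, inv_mul_le_iff₀ (by positivity)]; linarith
  have hσ : ∀ s, ∃ G : ℝ ≃ₘ^∞⟮𝓘(ℝ, ℝ), 𝓘(ℝ, ℝ)⟯ ℝ,
      ∀ x, G x = x + -(Real.smoothTransition s * c) * (β x * x) := by
    intro s
    have hs : ContDiff ℝ ∞ fun x => -(Real.smoothTransition s * c) * (β x * x) :=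
      contDiff_const.mul hg
    refine exists_diffeomorph_id_add hs (k := 2⁻¹) (by rw [← NNReal.coe_lt_coe]; norm_num)
      (LipschitzWith.of_dist_le_mul fun x y => ?_)
    have h1 := hk.dist_le_mul x y
    rw [Real.dist_eq] at h1 ⊢
    rw [← mul_sub, abs_mul, abs_neg, abs_mul, abs_of_pos hcpos,
      abs_of_nonneg (Real.smoothTransition.nonneg s)]
    calc _ ≤ 1 * c * (k * dist x y) := by
          gcongr; exact Real.smoothTransition.le_one s
      _ = (c * k) * dist x y := by ring
      _ ≤ 2⁻¹ * dist x y := by gcongr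
      _ = _ := by push_cast; rfl
  choose G hG using hσ
  have hid : ∀ s h, ρ < |h| → G s h = h := by
    intro s h hh
    rw [hG, hβ0 h fun h' => absurd (hρ h h') (not_le.2 hh)]; ring
  have hid' : ∀ s h, ρ < |h| → (G s).symm h = h := by
    intro s h hh
    conv_lhs => rw [← hid s h hh]
    exact (G s).symm_apply_apply h
  have hmapsAux : ∀ A : ℝ → ℝ, Function.Injective A → (∀ h, ρ < |h| → A h = h) →
      ∀ h, |h| < 1 → |A h| < 1 := by
    intro A hA hA' h hh
    exact mapsTo_of_eq_self hA (Q := {h | |h| ≤ ρ}) (U := {h | |h| < 1})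
      (fun h hh => lt_of_le_of_lt hh hρ1) (fun h hh => hA' h (not_le.1 hh)) hh
  have hmaps := fun s => hmapsAux (G s) (G s).injective (hid s)
  have hmaps' := fun s => hmapsAux (G s).symm (G s).symm.injective (hid' s)
  have hGs : ContDiff ℝ ∞ fun q : ℝ × ℝ => G q.1 q.2 := by
    simp_rw [hG]
    exact contDiff_snd.add ((((Real.smoothTransition.contDiff.comp contDiff_fst).mul
      contDiff_const).neg).mul (hg.comp contDiff_snd))
  have hsm := contMDiff_fiberMap (N := N) hF (lam := fun s => G s) hρ1 hGs hmaps hid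
  have hcurry : ∀ {A : ℝ → S3 → S3},
      ContMDiff (𝓘(ℝ, ℝ).prod (𝓡 3)) (𝓡 3) ∞ (fun q : ℝ × S3 => A q.1 q.2) →
      ∀ s, ContMDiff (𝓡 3) (𝓡 3) ∞ (A s) := fun h s =>
    h.comp (contMDiff_const.prodMk contMDiff_id)
  let Φ : AmbientIsotopy :=
    { toDiffeo := fun s =>
        { toFun := N.fiberMap (G s), invFun := N.fiberMap (G s).symm
          left_inv := fiberMap_comp (hmaps s) (G s).symm_apply_apply
          right_inv := fiberMap_comp (hmaps' s) (G s).apply_symm_apply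
          contMDiff_toFun := hcurry (A := fun s => N.fiberMap (G s)) hsm s
          contMDiff_invFun := hcurry (A := fun _ => N.fiberMap (G s).symm)
            (contMDiff_fiberMap (N := N) hF (lam := fun _ => (G s).symm) hρ1
              ((contMDiff_iff_contDiff.1 (G s).symm.contMDiff).comp contDiff_snd)
              (fun _ => hmaps' s) (fun _ => hid' s)) 0 }
      smooth := hsm
      -- At time zero the rescaling is the identity at every height, and `ρ = -1` makes the
      -- exceptional set empty.
      map_zero := fun x => fiberMap_eq_self (ρ := -1) (fun h _ => by
        rw [hG, Real.smoothTransition.zero]; ring) fun h => by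
          have := abs_nonneg (N.height x); linarith [h.2] }
  have hstep : ∀ x ∈ N.carrier, |N.height x| ≤ h₀ → Φ.final x ∈ N.carrier ∧
      N.proj (Φ.final x) = N.proj x ∧ N.height (Φ.final x) = (1 - c) * N.height x := by
    intro x hx hh
    obtain ⟨h1, h2, h3⟩ := fiberMap_spec (hmaps 1) hx (hh.trans_lt h₀1)
    refine ⟨h1, h2, h3.trans ?_⟩
    rw [hG, Real.smoothTransition.one, hβ1 _ (by simpa using hh)]; ring
  have hpos : 0 < 1 - c := by linarith
  have hiter : ∀ n : ℕ, ∃ Φ : AmbientIsotopy, ∀ x ∈ N.carrier, |N.height x| ≤ h₀ →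
      Φ.final x ∈ N.carrier ∧ N.proj (Φ.final x) = N.proj x ∧
      N.height (Φ.final x) = (1 - c) ^ n * N.height x := by
    intro n
    induction n with
    | zero => exact ⟨.refl, fun x hx _ => ⟨hx, rfl, by rw [pow_zero, one_mul]; rfl⟩⟩
    | succ n ih =>
      obtain ⟨Ψ, hΨ⟩ := ih
      refine ⟨Ψ.trans Φ, fun x hx hh => ?_⟩
      obtain ⟨h1, h2, h3⟩ := hΨ x hx hh
      have h4 : |N.height (Ψ.final x)| ≤ h₀ := by
        rw [h3, abs_mul, abs_of_pos (by positivity)]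
        calc _ ≤ 1 * |N.height x| := by
              gcongr; exact pow_le_one₀ hpos.le (by linarith)
          _ ≤ h₀ := by rw [one_mul]; exact hh
      obtain ⟨i1, i2, i3⟩ := hstep _ h1 h4
      rw [AmbientIsotopy.trans_final]
      exact ⟨i1, i2.trans h2, by rw [i3, h3, pow_succ']; ring⟩
  obtain ⟨n, hn⟩ := exists_pow_lt_of_lt_one (show 0 < η by positivity) (show 1 - c < 1 by linarith)
  obtain ⟨Ψ, hΨ⟩ := hiter n
  refine ⟨Ψ, fun x hx hh => ?_⟩
  obtain ⟨h1, h2, h3⟩ := hΨ x hx hh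
  refine ⟨h1, h2, ?_⟩
  rw [h3, abs_mul, abs_of_pos (by positivity)]
  calc (1 - c) ^ n * |N.height x| ≤ (1 - c) ^ n * 1 := by gcongr; linarith
    _ < η := by rw [mul_one]; exact hn

end RegularNeighborhood

/-! ### Regular neighbourhoods from a retraction and a defining function -/

/-- `f` is a defining function and `r` is a smooth retraction for `F`, both on the open set `U`. -/
structure IsTube (F U : Set S3) (f : S3 → ℝ) (r : S3 → S3) : Prop where
  isOpen : IsOpen U
  subset : F ⊆ U
  smooth_f : ContMDiffOn (𝓡 3) 𝓘(ℝ, ℝ) ∞ f U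
  smooth_r : ContMDiffOn (𝓡 3) (𝓡 3) ∞ r U
  mapsTo : ∀ x ∈ U, r x ∈ F
  eq_self : ∀ x ∈ F, r x = x
  zero_iff : ∀ x ∈ U, f x = 0 ↔ x ∈ F
  adapted : ∀ p ∈ F, ∃ ψ : Chart, IsAdapted ψ f p

theorem hasFDerivAt_apply3 {k : E 3 → E 3} {k' : E 3 →L[ℝ] E 3} {x : E 3} (h : HasFDerivAt k k' x)
    (i : Fin 3) : HasFDerivAt (fun v => k v i) ((EuclideanSpace.proj (𝕜 := ℝ) i).comp k') x :=
  (EuclideanSpace.proj (𝕜 := ℝ) i).hasFDerivAt.comp x h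

theorem fderiv_eq_self_of_eq_on_line {k : E 3 → E 3} {k' : E 3 →L[ℝ] E 3} (h : HasFDerivAt k k' 0)
    {v : E 3} (hv : ∀ᶠ t in 𝓝 (0 : ℝ), k (t • v) = t • v) : k' v = v := by
  have h1 : HasDerivAt (fun t : ℝ => t • v) v 0 := by
    simpa using (hasDerivAt_id (0 : ℝ)).smul_const v
  have h2 : HasDerivAt (fun t : ℝ => k (t • v)) (k' v) 0 := by
    refine HasFDerivAt.comp_hasDerivAt (0 : ℝ) (l := k) ?_ h1
    rw [zero_smul]; exact h
  exact h2.unique (h1.congr_of_eventuallyEq hv)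

instance : Nonempty Chart := ⟨(exists_chart (normS 0)).choose⟩

/-- In an adapted chart, let `k` consist of the first two coordinates of the retraction and the
value of `f`. It preserves the third coordinate and is the identity on the plane of the surface. A
vector in the kernel of its derivative is thus horizontal, hence fixed by the derivative, hence
zero; so `k` can be used as a change of coordinates. -/
theorem IsTube.exists_productChart {F U : Set S3} {f : S3 → ℝ} {r : S3 → S3} (h : IsTube F U f r)
    {p : S3} (hp : p ∈ F) :
    ∃ θ ψ : Chart, (0 : E 3) ∈ θ.source ∧ θ 0 = p ∧ θ.target ⊆ U ∧ (0 : E 3) ∈ ψ.source ∧ ψ 0 = p ∧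
      (∀ v ∈ ψ.source, f (ψ v) = v 2) ∧
      ∀ v ∈ θ.source, flat v ∈ ψ.source ∧ r (θ v) = ψ (flat v) ∧ f (θ v) = v 2 := by
  obtain ⟨ψ, hψ0, hψp, hψ⟩ := h.adapted p hp
  set W : Set S3 := U ∩ r ⁻¹' ψ.target with hW
  have hWo : IsOpen W := h.smooth_r.continuousOn.isOpen_inter_preimage h.isOpen ψ.open_target
  have hpt : p ∈ ψ.target := by rw [← hψp]; exact ψ.map_source hψ0
  have hpW : p ∈ W := ⟨h.subset hp, by rw [mem_preimage, h.eq_self p hp]; exact hpt⟩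
  set O : Set (E 3) := ψ.source ∩ ψ ⁻¹' W with hO
  have hOo : IsOpen O := ψ.contMDiffOn.continuousOn.isOpen_inter_preimage ψ.open_source hWo
  have h0O : (0 : E 3) ∈ O := ⟨hψ0, by rw [mem_preimage, hψp]; exact hpW⟩
  set k : E 3 → E 3 := fun v => vec3 (ψ.symm (r (ψ v)) 0) (ψ.symm (r (ψ v)) 1) (f (ψ v)) with hk
  have hks : ContDiffOn ℝ ∞ k O := by
    intro v hv
    have h1 : ContMDiffAt (𝓡 3) (𝓡 3) ∞ (fun v => ψ.symm (r (ψ v))) v :=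
      (ψ.contMDiffAt_symm hv.2.2).comp v ((h.smooth_r.contMDiffAt
        (h.isOpen.mem_nhds hv.2.1)).comp v (ψ.contMDiffAt hv.1))
    have h2 : ContMDiffAt (𝓡 3) 𝓘(ℝ, ℝ) ∞ (fun v => f (ψ v)) v :=
      (h.smooth_f.contMDiffAt (h.isOpen.mem_nhds hv.2.1)).comp v (ψ.contMDiffAt hv.1)
    exact (contMDiffAt_vec3 ((contDiff_apply3 0).contMDiff.contMDiffAt.comp v h1)
      ((contDiff_apply3 1).contMDiff.contMDiffAt.comp v h1) h2).contDiffAt.contDiffWithinAt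
  have hk2 : ∀ v ∈ O, k v 2 = v 2 := fun v hv => hψ v hv.1
  have hkid : ∀ v ∈ O, v 2 = 0 → k v = v := by
    intro v hv hv2
    have h1 : ψ v ∈ F := (h.zero_iff _ hv.2.1).1 (by rw [hψ v hv.1, hv2])
    have h2 : ψ.symm (r (ψ v)) = v := by rw [h.eq_self _ h1]; exact ψ.left_inv hv.1
    exact ext3 (by simp only [hk, h2, vec3_zero]) (by simp only [hk, h2, vec3_one])
      (by rw [hk2 v hv])
  have hkd := ((hks.contDiffAt (hOo.mem_nhds h0O)).differentiableAt (by simp)).hasFDerivAt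
  have hinj : Function.Injective (fderiv ℝ k 0) := by
    rw [injective_iff_map_eq_zero]
    intro v hv
    have h1 := hasFDerivAt_apply3 hkd 2
    have h2 : HasFDerivAt (fun v => k v 2) (EuclideanSpace.proj (𝕜 := ℝ) (2 : Fin 3)) 0 :=
      (EuclideanSpace.proj (𝕜 := ℝ) (2 : Fin 3)).hasFDerivAt.congr_of_eventuallyEq (by
        filter_upwards [hOo.mem_nhds h0O] with w hw using hk2 w hw)
    have h3 := congrArg (fun L => L v) (h1.unique h2)
    simp only [ContinuousLinearMap.comp_apply, hv, map_zero] at h3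
    have hv2 : v 2 = 0 := h3.symm
    have h4 : fderiv ℝ k 0 v = v := by
      refine fderiv_eq_self_of_eq_on_line hkd ?_
      have hc : Tendsto (fun t : ℝ => t • v) (𝓝 0) (𝓝 0) := by
        have : Continuous fun t : ℝ => t • v := by fun_prop
        simpa using this.tendsto 0
      filter_upwards [hc.eventually (hOo.mem_nhds h0O)] with t ht
      exact hkid _ ht (by simp [hv2])
    rw [← h4, hv]
  obtain ⟨e, h0e, heO, hek, hes, het⟩ := exists_openPartialHomeomorph_of_isInvertible hOo hks h0O
    ⟨(LinearEquiv.ofInjectiveEndo (fderiv ℝ k 0 : E 3 →ₗ[ℝ] E 3) hinj).toContinuousLinearEquiv,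
      by ext; rfl⟩
  have hk0 : k 0 = 0 := hkid 0 h0O rfl
  let e' : PartialDiffeomorph (𝓡 3) (𝓡 3) (E 3) (E 3) ∞ :=
    { toPartialEquiv := e.symm.toPartialEquiv, open_source := e.open_target
      open_target := e.open_source
      contMDiffOn_toFun := het.contMDiffOn, contMDiffOn_invFun := hes.contMDiffOn }
  have hsrc : ∀ v ∈ (e'.trans ψ).source, v ∈ e.target := fun v hv => hv.1
  have happ : ∀ v, (e'.trans ψ) v = ψ (e.symm v) := fun v => rfl
  refine ⟨e'.trans ψ, ψ, ?_, ?_, ?_, hψ0, hψp, hψ, ?_⟩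
  · have h1 : (0 : E 3) ∈ e.target := by rw [← hk0, ← hek]; exact e.map_source h0e
    exact ⟨h1, (heO (e.map_target h1)).1⟩
  · rw [happ]
    have : e.symm 0 = 0 := by
      conv_lhs => rw [← hk0, ← hek]
      exact e.left_inv h0e
    rw [this, hψp]
  · intro z hz
    obtain ⟨v, hv, rfl⟩ : ∃ v ∈ (e'.trans ψ).source, (e'.trans ψ) v = z :=
      ⟨_, (e'.trans ψ).symm.map_source hz, (e'.trans ψ).right_inv hz⟩
    exact (heO (e.map_target (hsrc v hv))).2.1
  · intro v hv
    have h1 := heO (e.map_target (hsrc v hv))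
    have h2 : k (e.symm v) = v := by rw [← hek]; exact e.right_inv (hsrc v hv)
    rw [happ]
    set w := e.symm v
    have h3 : ψ.symm (r (ψ w)) = flat v := by
      have h4 : ψ.symm (r (ψ w)) 2 = 0 := by
        rw [← hψ _ (ψ.symm.map_source h1.2.2),
          show ψ (ψ.symm (r (ψ w))) = r (ψ w) from ψ.right_inv h1.2.2]
        exact (h.zero_iff _ (h.subset (h.mapsTo _ h1.2.1))).2 (h.mapsTo _ h1.2.1)
      exact ext3 (by rw [← h2]; rfl) (by rw [← h2]; rfl) h4
    refine ⟨by rw [← h3]; exact ψ.symm.map_source h1.2.2, ?_, ?_⟩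
    · rw [← h3]; exact (ψ.right_inv h1.2.2).symm
    · conv_rhs => rw [← h2]
      rfl

/-- The map `(r, f)` is injective on the compact set `F` and, by product charts, locally injective
around it, hence injective on a neighbourhood. It is also locally onto `F × ℝ` near `F × {0}`.
Compactness provides a uniform width `ε`, and `f / ε` serves as height. -/
theorem IsTube.exists_regularNeighborhood {F U : Set S3} {f : S3 → ℝ} {r : S3 → S3}
    (hF : IsCompact F) (h : IsTube F U f r) :
    ∃ N : RegularNeighborhood F, N.proj = r ∧ F ⊆ interior N.carrier := by
  choose! θ ψ h0θ hθp hθU h0ψ hψp hψ hθ using fun p hp => h.exists_productChart (p := p) hp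
  have hpθ : ∀ p ∈ F, p ∈ (θ p).target := fun p hp => by
    have := (θ p).map_source (h0θ p hp)
    have h2 : (θ p).toPartialEquiv 0 = p := hθp p hp
    rwa [h2] at this
  have hpψ : ∀ p ∈ F, p ∈ (ψ p).target := fun p hp => by
    have := (ψ p).map_source (h0ψ p hp)
    have h2 : (ψ p).toPartialEquiv 0 = p := hψp p hp
    rwa [h2] at this
  -- the chart recovers a point from its retraction and its value
  set B : S3 → S3 × ℝ → E 3 := fun p q => vec3 ((ψ p).symm q.1 0) ((ψ p).symm q.1 1) q.2 with hB
  have hBs : ∀ p, ∀ q : S3 × ℝ, q.1 ∈ (ψ p).target →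
      ContMDiffAt ((𝓡 3).prod 𝓘(ℝ, ℝ)) (𝓡 3) ∞ (B p) q := by
    intro p q hq
    have h1 : ContMDiffAt ((𝓡 3).prod 𝓘(ℝ, ℝ)) (𝓡 3) ∞ (fun q : S3 × ℝ => (ψ p).symm q.1) q :=
      ((ψ p).contMDiffAt_symm hq).comp q contMDiffAt_fst
    exact contMDiffAt_vec3 ((contDiff_apply3 0).contMDiff.contMDiffAt.comp q h1)
      ((contDiff_apply3 1).contMDiff.contMDiffAt.comp q h1) contMDiffAt_snd
  have hrec : ∀ p ∈ F, ∀ x ∈ (θ p).target, r x ∈ (ψ p).target ∧ θ p (B p (r x, f x)) = x ∧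
      B p (r x, f x) ∈ (θ p).source := by
    intro p hp x hx
    obtain ⟨v, hv, rfl⟩ : ∃ v ∈ (θ p).source, θ p v = x :=
      ⟨_, (θ p).symm.map_source hx, (θ p).right_inv hx⟩
    obtain ⟨h1, h2, h3⟩ := hθ p hp v hv
    have h4 : (ψ p).symm (ψ p (flat v)) = flat v := (ψ p).left_inv h1
    have h5 : B p (r (θ p v), f (θ p v)) = v := by
      rw [h2, h3]
      simp only [hB, h4]
      exact vec3_eta v
    rw [h5]
    exact ⟨by rw [h2]; exact (ψ p).map_source h1, rfl, hv⟩
  set H : S3 → S3 × ℝ := fun x => (r x, f x) with hH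
  have hHc : ContinuousOn H U := h.smooth_r.continuousOn.prodMk h.smooth_f.continuousOn
  obtain ⟨O₁, hO₁, hFO₁, hinj⟩ := InjOn.exists_isOpen_superset (f := H) (s := F)
    (fun x hx y hy hxy => by
      have := congrArg Prod.fst hxy
      simpa only [hH, h.eq_self x hx, h.eq_self y hy] using this) hF
    (fun x hx => hHc.continuousAt (h.isOpen.mem_nhds (h.subset hx)))
    (fun p hp => ⟨(θ p).target, (θ p).open_target.mem_nhds (hpθ p hp), fun x hx y hy hxy => by
      rw [← (hrec p hp x hx).2.1, ← (hrec p hp y hy).2.1]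
      simp only [hH] at hxy
      rw [hxy]⟩)
  set O : Set S3 := O₁ ∩ ⋃ p ∈ F, (θ p).target with hO
  have hOo : IsOpen O := hO₁.inter (isOpen_biUnion fun p _ => (θ p).open_target)
  have hFO : F ⊆ O := fun p hp => ⟨hFO₁ hp, mem_biUnion hp (hpθ p hp)⟩
  have hOU : O ⊆ U := by
    rintro x ⟨-, hx⟩
    obtain ⟨p, hp, hx⟩ := mem_iUnion₂.1 hx
    exact hθU p hp hx
  obtain ⟨Q, hQ, hFQ, hQO⟩ := exists_compact_between hF hOo hFO
  -- Near each point of `F` a preimage of `(y, t)` is written down in a product chart; compactness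
  -- makes the range of `t` independent of `y`.
  have hsurj : ∀ᶠ t in 𝓝 (0 : ℝ), ∀ y ∈ F, ∃ x ∈ Q, r x = y ∧ f x = t := by
    refine hF.eventually_forall_of_forall_eventually
      (P := fun t y => y ∈ F → ∃ x ∈ Q, r x = y ∧ f x = t) (x₀ := (0 : ℝ)) ?_ |>.mono
      fun t ht y hy => ht y hy hy
    intro p hp
    have hq : (p, (0 : ℝ)).1 ∈ (ψ p).target := hpψ p hp
    have hsw : Tendsto (fun z : ℝ × S3 => (z.2, z.1)) (𝓝 (0, p)) (𝓝 (p, 0)) :=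
      (continuous_swap.tendsto (0, p))
    have hB0 : B p (p, 0) = 0 := by
      have h1 : (ψ p).symm p = 0 := by
        have h2 : (ψ p).symm (ψ p 0) = 0 := (ψ p).left_inv (h0ψ p hp)
        rwa [hψp p hp] at h2
      simp only [hB, h1]
      exact ext3 rfl rfl rfl
    have hBt : Tendsto (B p) (𝓝 (p, 0)) (𝓝 0) := by
      have := (hBs p _ hq).continuousAt.tendsto
      rwa [hB0] at this
    have hθt : Tendsto (θ p) (𝓝 0) (𝓝 p) := by
      have := ((θ p).continuousAt (h0θ p hp)).tendsto
      rwa [hθp p hp] at this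
    filter_upwards [(hBt.comp hsw).eventually ((θ p).open_source.mem_nhds (h0θ p hp)),
      ((hθt.comp hBt).comp hsw).eventually (mem_interior_iff_mem_nhds.1 (hFQ hp)),
      (continuous_snd.tendsto ((0 : ℝ), p)).eventually ((ψ p).open_target.mem_nhds (hpψ p hp))]
      with ⟨t, y⟩ h1 h2 h3 hy
    refine ⟨θ p (B p (y, t)), h2, ?_, ?_⟩
    · refine (hθ p hp _ h1).2.1.trans ?_
      have h4 : (ψ p).symm y 2 = 0 := by
        rw [← hψ p hp _ ((ψ p).symm.map_source h3),
          show (ψ p) ((ψ p).symm y) = y from (ψ p).right_inv h3]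
        exact (h.zero_iff _ (h.subset hy)).2 hy
      have h5 : flat (B p (y, t)) = (ψ p).symm y := ext3 rfl rfl h4.symm
      change ψ p (flat (B p (y, t))) = y
      rw [h5]; exact (ψ p).right_inv h3
    · exact (hθ p hp _ h1).2.2
  obtain ⟨ε₀, hε₀, hball⟩ := Metric.eventually_nhds_iff_ball.1 hsurj
  set ε := ε₀ / 2 with hε
  have hεpos : 0 < ε := by positivity
  have hfQ : ContinuousOn (fun x => |f x|) Q := (h.smooth_f.continuousOn.mono (hQO.trans hOU)).abs
  have hf0 : ∀ x ∈ F, f x = 0 := fun x hx => (h.zero_iff x (h.subset hx)).2 hx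
  let N : RegularNeighborhood F :=
    { carrier := Q ∩ {x | |f x| ≤ ε}
      domain := O
      proj := r
      height := fun x => ε⁻¹ * f x
      compact := by
        have h1 := hfQ.preimage_isClosed_of_isClosed hQ.isClosed (isClosed_Iic (a := ε))
        exact hQ.of_isClosed_subset h1 inter_subset_left
      isOpen_domain := hOo
      carrier_subset := inter_subset_left.trans hQO
      smooth_proj := h.smooth_r.mono hOU
      smooth_height := fun x hx => by
        have h1 : ContDiff ℝ ∞ fun t : ℝ => ε⁻¹ * t := contDiff_const.mul contDiff_id
        exact h1.contMDiff.contMDiffAt.comp_contMDiffWithinAt x ((h.smooth_f.mono hOU) x hx)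
      bijOn := by
        refine ⟨fun x hx => ⟨h.mapsTo x (hOU (hQO hx.1)), ?_⟩, fun x hx y hy hxy => ?_, ?_⟩
        · have h1 : |f x| ≤ ε := hx.2
          change ε⁻¹ * f x ∈ Icc (-1 : ℝ) 1
          rw [mem_Icc, ← abs_le, abs_mul, abs_of_pos (inv_pos.2 hεpos), inv_mul_le_iff₀ hεpos, mul_one]
          exact h1
        · simp only [Prod.mk.injEq, mul_eq_mul_left_iff] at hxy
          refine hinj (hQO hx.1).1 (hQO hy.1).1 (Prod.ext hxy.1 ?_)
          rcases hxy.2 with h1 | h1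
          · exact h1
          · exact absurd h1 (inv_ne_zero hεpos.ne')
        · rintro ⟨y, t⟩ ⟨hy, ht⟩
          have ht' : |ε * t| ≤ ε := by
            rw [abs_mul, abs_of_pos hεpos]
            have := abs_le.2 ht
            nlinarith
          obtain ⟨x, hx, h1, h2⟩ := hball (ε * t) (by
            rw [mem_ball_zero_iff, Real.norm_eq_abs]; linarith) y hy
          refine ⟨x, ⟨hx, by rw [mem_ofPred_eq, h2]; exact ht'⟩, ?_⟩
          simp only [h1, h2, ← mul_assoc, inv_mul_cancel₀ hεpos.ne', one_mul]
      immersion := by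
        intro x hx v h1 h2
        obtain ⟨p, hp, hxp⟩ := mem_iUnion₂.1 (hQO hx.1).2
        have hxU := h.isOpen.mem_nhds (hOU (hQO hx.1))
        have hrs : ContMDiffAt (𝓡 3) (𝓡 3) ∞ r x := h.smooth_r.contMDiffAt hxU
        have hfs : ContMDiffAt (𝓡 3) 𝓘(ℝ, ℝ) ∞ (fun x => ε⁻¹ * f x) x :=
          (contDiff_const.mul contDiff_id : ContDiff ℝ ∞ fun t : ℝ => ε⁻¹ * t).contMDiff.contMDiffAt.comp
            x (h.smooth_f.contMDiffAt hxU)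
        -- The map `m` undoes the rescaling of the height, so that the chart inverse `θ p ∘ B p`
        -- becomes a left inverse of the rescaled pair.
        obtain ⟨m, hm, hval⟩ : ∃ m : S3 × ℝ → S3 × ℝ,
            ContMDiff ((𝓡 3).prod 𝓘(ℝ, ℝ)) ((𝓡 3).prod 𝓘(ℝ, ℝ)) ∞ m ∧
            ∀ y, m (r y, ε⁻¹ * f y) = (r y, f y) :=
          ⟨fun q => (q.1, ε * q.2), contMDiff_fst.prodMk ((contDiff_const.mul contDiff_id :
            ContDiff ℝ ∞ fun t : ℝ => ε * t).contMDiff.comp contMDiff_snd), fun y => by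
            simp only [← mul_assoc, mul_inv_cancel₀ hεpos.ne', one_mul]⟩
        have hBx : ContMDiffAt ((𝓡 3).prod 𝓘(ℝ, ℝ)) (𝓡 3) ∞
            (B p ∘ m) (r x, ε⁻¹ * f x) := by
          refine ContMDiffAt.comp _ ?_ hm.contMDiffAt
          rw [hval]
          exact hBs p _ (hrec p hp x hxp).1
        have hθx : ContMDiffAt ((𝓡 3).prod 𝓘(ℝ, ℝ)) (𝓡 3) ∞
            (θ p ∘ (B p ∘ m)) (r x, ε⁻¹ * f x) := by
          refine ContMDiffAt.comp _ ?_ hBx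
          rw [Function.comp_apply, hval]
          exact (θ p).contMDiffAt (hrec p hp x hxp).2.2
        have hinj' := injective_mfderiv_of_leftInverse (f := fun x => (r x, ε⁻¹ * f x))
          ((hrs.prodMk hfs).mdifferentiableAt (by simp)) (hθx.mdifferentiableAt (by simp)) (by
            filter_upwards [(θ p).open_target.mem_nhds hxp] with y hy
            rw [Function.comp_apply, Function.comp_apply, hval]
            exact (hrec p hp y hy).2.1)
        refine (injective_iff_map_eq_zero _).1 hinj' v ?_
        have h3 := mfderiv_prodMk (hrs.mdifferentiableAt (by simp)) (hfs.mdifferentiableAt (by simp))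
        refine (congrArg (fun L => L v) h3).trans ?_
        exact congrArg₂ Prod.mk h1 h2
      core := fun x hx => ⟨⟨interior_subset (hFQ hx), by
        rw [mem_ofPred_eq, hf0 x hx, abs_zero]; exact hεpos.le⟩, h.eq_self x hx, by
        rw [hf0 x hx, mul_zero]⟩ }
  refine ⟨N, rfl, fun x hx => ?_⟩
  have hopen : IsOpen (interior Q ∩ (fun x => |f x|) ⁻¹' Iio ε) :=
    (hfQ.mono interior_subset).isOpen_inter_preimage isOpen_interior isOpen_Iio
  have hsub : interior Q ∩ (fun x => |f x|) ⁻¹' Iio ε ⊆ N.carrier :=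
    fun y hy => ⟨interior_subset hy.1, le_of_lt (show |f y| < ε from hy.2)⟩
  refine interior_maximal hsub hopen ⟨hFQ hx, ?_⟩
  change |f x| < ε
  rw [hf0 x hx, abs_zero]; exact hεpos

/-! ### Existence of tubes around closed surfaces -/

/-- The derivative of a function on the 3-sphere in the direction of a tangent vector. -/
def dirDeriv (f : S3 → ℝ) (x : S3) (v : TangentSpace (𝓡 3) x) : ℝ :=
  mfderiv (𝓡 3) 𝓘(ℝ, ℝ) f x v

theorem dirDeriv_const (c : ℝ) (x : S3) (v : TangentSpace (𝓡 3) x) :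
    dirDeriv (fun _ => c) x v = 0 :=
  congrArg (fun L => L v) (mfderiv_const (I := 𝓡 3) (I' := 𝓘(ℝ, ℝ)) (x := x) (c := c))

theorem continuousOn_dirDeriv {f : S3 → ℝ} {F U : Set S3} (hU : IsOpen U)
    (hf : ContMDiffOn (𝓡 3) 𝓘(ℝ, ℝ) ∞ f U) {X : (x : S3) → TangentSpace (𝓡 3) x}
    (hX : ContinuousOn (fun x => (⟨x, X x⟩ : TangentBundle (𝓡 3) S3)) F) :
    ContinuousOn (fun x => dirDeriv f x (X x)) (F ∩ U) := by
  have h1 := hf.continuousOn_tangentMapWithin (by simp) hU.uniqueMDiffOn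
  have h2 : ContinuousOn (fun x => tangentMapWithin (𝓡 3) 𝓘(ℝ, ℝ) f U ⟨x, X x⟩) (F ∩ U) :=
    h1.comp (hX.mono inter_subset_left) fun x hx => hx.2
  have h3 : ContinuousOn (fun x => (tangentBundleModelSpaceHomeomorph 𝓘(ℝ, ℝ)
      (tangentMapWithin (𝓡 3) 𝓘(ℝ, ℝ) f U ⟨x, X x⟩)).2) (F ∩ U) :=
    continuous_snd.comp_continuousOn
      ((tangentBundleModelSpaceHomeomorph 𝓘(ℝ, ℝ)).continuous.comp_continuousOn h2)
  refine h3.congr fun x hx => ?_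
  rw [tangentBundleModelSpaceHomeomorph_coe]
  change _ = (mfderivWithin (𝓡 3) 𝓘(ℝ, ℝ) f U x (X x) : ℝ)
  rw [mfderivWithin_of_isOpen hU hx.2]
  rfl

theorem exists_smooth_bump {C V : Set S3} (hC : IsCompact C) (hV : IsOpen V) (hCV : C ⊆ V) :
    ∃ χ : S3 → ℝ, ContMDiff (𝓡 3) 𝓘(ℝ, ℝ) ∞ χ ∧ (∀ᶠ x in 𝓝ˢ C, χ x = 1) ∧ tsupport χ ⊆ V ∧
      ∀ x, χ x ∈ Icc (0 : ℝ) 1 := by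
  obtain ⟨Q, hQ, hCQ, hQV⟩ := exists_compact_between hC hV hCV
  obtain ⟨χ, h1, h2, h3⟩ := exists_contMDiffMap_one_nhds_of_subset_interior (n := ⊤) (𝓡 3)
    hC.isClosed hCQ
  refine ⟨χ, χ.contMDiff, h1, (closure_minimal (fun x hx => ?_) hQ.isClosed).trans hQV, h3⟩
  by_contra hxt
  exact hx (h2 x hxt)

theorem contMDiff_mul_of_tsupport_subset {χ g : S3 → ℝ} {U : Set S3} (hU : IsOpen U)
    (hχ : ContMDiff (𝓡 3) 𝓘(ℝ, ℝ) ∞ χ) (hs : tsupport χ ⊆ U)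
    (hg : ContMDiffOn (𝓡 3) 𝓘(ℝ, ℝ) ∞ g U) :
    ContMDiff (𝓡 3) 𝓘(ℝ, ℝ) ∞ (fun x => χ x * g x) := by
  intro x
  by_cases hx : x ∈ tsupport χ
  · have h1 : ContDiff ℝ ∞ fun q : ℝ × ℝ => q.1 * q.2 := contDiff_fst.mul contDiff_snd
    have h2 := (hχ x).prodMk_space (hg.contMDiffAt (hU.mem_nhds (hs hx)))
    exact h1.contMDiff.contMDiffAt.comp x h2
  · have h1 : (fun x => χ x * g x) =ᶠ[𝓝 x] fun _ => 0 := by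
      filter_upwards [(isClosed_tsupport χ).isOpen_compl.mem_nhds hx] with y hy
      rw [image_eq_zero_of_notMem_tsupport hy, zero_mul]
    exact contMDiffAt_const.congr_of_eventuallyEq h1

theorem dirDeriv_mul_of_eq_zero {χ g : S3 → ℝ} {x : S3}
    (hχ : ContMDiffAt (𝓡 3) 𝓘(ℝ, ℝ) ∞ χ x) (hg : ContMDiffAt (𝓡 3) 𝓘(ℝ, ℝ) ∞ g x) (hgx : g x = 0)
    (v : TangentSpace (𝓡 3) x) :
    dirDeriv (fun y => χ y * g y) x v =
      χ x * dirDeriv g x v := by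
  have h := (HasMFDerivAt.mul (hχ.mdifferentiableAt (by simp)).hasMFDerivAt
    (hg.mdifferentiableAt (by simp)).hasMFDerivAt).mfderiv
  refine (congrArg (fun L => L v) h).trans ?_
  rw [hgx]
  change χ x • dirDeriv g x v + (0 : ℝ) • dirDeriv χ x v = _
  rw [zero_smul, add_zero, smul_eq_mul]

theorem dirDeriv_add {f g : S3 → ℝ} {x : S3}
    (hf : ContMDiffAt (𝓡 3) 𝓘(ℝ, ℝ) ∞ f x) (hg : ContMDiffAt (𝓡 3) 𝓘(ℝ, ℝ) ∞ g x)
    (v : TangentSpace (𝓡 3) x) :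
    dirDeriv (fun y => f y + g y) x v =
      dirDeriv f x v + dirDeriv g x v := by
  have h := (HasMFDerivAt.add (hf.mdifferentiableAt (by simp)).hasMFDerivAt
    (hg.mdifferentiableAt (by simp)).hasMFDerivAt).mfderiv
  exact congrArg (fun L => L v) h

theorem IsLocalDefiningFunction.eq_zero_iff {F U : Set S3} {f : S3 → ℝ}
    (h : IsLocalDefiningFunction F U f) {x : S3} (hx : x ∈ U) : f x = 0 ↔ x ∈ F := by
  have := congrArg (fun s => x ∈ s) h.zeroSet
  simp only [mem_inter_iff, mem_ofPred_eq, hx, and_true, true_and, eq_iff_iff] at this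
  exact this.symm

/-- Around each of its points, a closed surface has a local defining function which increases in
the direction of the transverse field. -/
theorem exists_local_increasing {F : Set S3} {X : (x : S3) → TangentSpace (𝓡 3) x}
    (hX : ContinuousOn (fun x => (⟨x, X x⟩ : TangentBundle (𝓡 3) S3)) F)
    (hXF : ∀ x ∈ F, ∀ (U : Set S3) (f : S3 → ℝ), x ∈ U → IsLocalDefiningFunction F U f →
      mfderiv (𝓡 3) 𝓘(ℝ, ℝ) f x (X x) ≠ 0)
    {p : S3} (hp : p ∈ F) {U : Set S3} {f : S3 → ℝ} (hpU : p ∈ U)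
    (hf : IsLocalDefiningFunction F U f) :
    ∃ (V : Set S3) (g : S3 → ℝ), IsOpen V ∧ p ∈ V ∧ ContMDiffOn (𝓡 3) 𝓘(ℝ, ℝ) ∞ g V ∧
      ∀ x ∈ F ∩ V, g x = 0 ∧ 0 < dirDeriv g x (X x) := by
  -- Multiplication by the derivative at `p` corrects the sign; by continuity the derivative along
  -- the field remains positive near `p`.
  obtain ⟨c, hc⟩ : ∃ c : ℝ, 0 < c * dirDeriv f p (X p) :=
    ⟨dirDeriv f p (X p), mul_self_pos.2 (hXF p hp U f hpU hf)⟩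
  have h1 := continuousOn_dirDeriv hf.isOpen hf.smooth hX
  have h2 : ∀ᶠ x in 𝓝[F ∩ U] p, 0 < c * dirDeriv f x (X x) :=
    ((h1 p ⟨hp, hpU⟩).const_mul c).eventually (lt_mem_nhds hc)
  obtain ⟨O, hO, hpO, hOs⟩ := mem_nhdsWithin.1 h2
  refine ⟨O ∩ U, fun x => c * f x, hO.inter hf.isOpen, ⟨hpO, hpU⟩, ?_, ?_⟩
  · have h3 : ContDiff ℝ ∞ fun t : ℝ => c * t := contDiff_const.mul contDiff_id
    exact fun x hx => h3.contMDiff.contMDiffAt.comp_contMDiffWithinAt x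
      ((hf.smooth x hx.2).mono inter_subset_right)
  · rintro x ⟨hxF, hxO, hxU⟩
    have hfx : f x = 0 := (hf.eq_zero_iff hxU).2 hxF
    refine ⟨by simp only [hfx, mul_zero], ?_⟩
    rw [dirDeriv_mul_of_eq_zero (χ := fun _ => c) contMDiffAt_const
      (hf.smooth.contMDiffAt (hf.isOpen.mem_nhds hxU)) hfx]
    exact hOs ⟨hxO, hxF, hxU⟩

/-- Local defining functions are chosen increasing along the transverse field, cut off and added. As
they vanish on `F`, the derivatives of the cutoffs do not contribute there. All summands have
derivative at least zero along the field, so nothing cancels. Compactness of `F` reduces this to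
finite sums. -/
theorem IsClosedSurface.exists_increasing {F : Set S3} (hF : IsClosedSurface F) :
    ∃ f : S3 → ℝ, ContMDiff (𝓡 3) 𝓘(ℝ, ℝ) ∞ f ∧ (∀ x ∈ F, f x = 0) ∧
      ∀ x ∈ F, mfderiv (𝓡 3) 𝓘(ℝ, ℝ) f x ≠ 0 := by
  obtain ⟨X, hX, hXF⟩ := hF.orientable
  have key : ∃ f : S3 → ℝ, ContMDiff (𝓡 3) 𝓘(ℝ, ℝ) ∞ f ∧ (∀ x ∈ F, f x = 0) ∧
      (∀ x ∈ F, 0 ≤ dirDeriv f x (X x)) ∧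
      ∀ x ∈ F, x ∈ F → 0 < dirDeriv f x (X x) := by
    refine hF.compact.induction_on (p := fun s => ∃ f : S3 → ℝ, ContMDiff (𝓡 3) 𝓘(ℝ, ℝ) ∞ f ∧
      (∀ x ∈ F, f x = 0) ∧ (∀ x ∈ F, 0 ≤ dirDeriv f x (X x)) ∧
      ∀ x ∈ s, x ∈ F → 0 < dirDeriv f x (X x)) ?_ ?_ ?_ ?_
    · refine ⟨fun _ => 0, contMDiff_const, fun _ _ => rfl, fun x _ => ?_, fun x hx => hx.elim⟩
      exact (dirDeriv_const 0 x (X x)).ge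
    · rintro s t hst ⟨f, h1, h2, h3, h4⟩
      exact ⟨f, h1, h2, h3, fun x hx => h4 x (hst hx)⟩
    · rintro s t ⟨f, h1, h2, h3, h4⟩ ⟨g, h1', h2', h3', h4'⟩
      refine ⟨fun x => f x + g x, fun x => ?_, fun x hx => ?_, fun x hx => ?_, fun x hx hxF => ?_⟩
      · exact (h1 x).add (h1' x)
      · simp only [h2 x hx, h2' x hx, add_zero]
      · rw [dirDeriv_add (h1 x) (h1' x)]
        exact add_nonneg (h3 x hx) (h3' x hx)
      · rw [dirDeriv_add (h1 x) (h1' x)]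
        rcases hx with hx | hx
        · exact add_pos_of_pos_of_nonneg (h4 x hx hxF) (h3' x hxF)
        · exact add_pos_of_nonneg_of_pos (h3 x hxF) (h4' x hx hxF)
    · intro p hp
      obtain ⟨U, f, hpU, hf⟩ := hF.embedded p hp
      obtain ⟨V, g, hV, hpV, hg, hgF⟩ := exists_local_increasing hX hXF hp hpU hf
      obtain ⟨χ, hχ, hχ1, hχV, hχI⟩ := exists_smooth_bump isCompact_singleton hV
        (singleton_subset_iff.2 hpV)
      rw [nhdsSet_singleton] at hχ1
      have hder : ∀ x ∈ F ∩ V, dirDeriv (fun y => χ y * g y) x (X x) =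
          χ x * dirDeriv g x (X x) := fun x hx =>
        dirDeriv_mul_of_eq_zero (hχ x) (hg.contMDiffAt (hV.mem_nhds hx.2)) (hgF x hx).1 _
      refine ⟨V ∩ {x | χ x = 1}, mem_nhdsWithin_of_mem_nhds (inter_mem (hV.mem_nhds hpV) hχ1),
        fun x => χ x * g x, contMDiff_mul_of_tsupport_subset hV hχ hχV hg, fun x hx => ?_,
        fun x hx => ?_, fun x hx hxF => ?_⟩
      · by_cases hxV : x ∈ V
        · simp only [(hgF x ⟨hx, hxV⟩).1, mul_zero]
        · simp only [image_eq_zero_of_notMem_tsupport fun h => hxV (hχV h), zero_mul]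
      · by_cases hxV : x ∈ V
        · rw [hder x ⟨hx, hxV⟩]
          exact mul_nonneg (hχI x).1 (hgF x ⟨hx, hxV⟩).2.le
        · have h1 : (fun y => χ y * g y) =ᶠ[𝓝 x] fun _ => 0 := by
            filter_upwards [(isClosed_tsupport χ).isOpen_compl.mem_nhds fun h => hxV (hχV h)]
              with y hy
            rw [image_eq_zero_of_notMem_tsupport hy, zero_mul]
          have h2 := h1.mfderiv_eq (I := 𝓡 3) (I' := 𝓘(ℝ, ℝ))
          have h3 : dirDeriv (fun y => χ y * g y) x (X x) = dirDeriv (fun _ => 0) x (X x) :=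
            congrArg (fun L => L (X x)) h2
          rw [h3, dirDeriv_const]
      · rw [hder x ⟨hxF, hx.1⟩, show χ x = 1 from hx.2, one_mul]
        exact (hgF x ⟨hxF, hx.1⟩).2
  obtain ⟨f, h1, h2, -, h4⟩ := key
  refine ⟨f, h1, h2, fun x hx h0 => ?_⟩
  have := h4 x hx hx
  have h5 : dirDeriv f x (X x) = 0 := congrArg (fun L => L (X x)) h0
  exact this.ne' h5

/-- In a flattening chart the derivative of `f` vanishes on the horizontal plane, so by regularity
it is nonzero on the vertical unit vector `e`. Strict differentiability compares `f` at a point and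
at its horizontal projection, where `f` is zero: the difference is the height times the derivative
on `e`, up to an error of half that size. So `f` has no zeros off the plane near `p`. -/
theorem IsAdapted.eventually_eq_zero_iff {F : Set S3} {f : S3 → ℝ} {p : S3} {θ ψ : Chart}
    (hψ : IsAdapted ψ f p) (h0 : (0 : E 3) ∈ θ.source) (hθp : θ 0 = p)
    (hθ : ∀ v ∈ θ.source, θ v ∈ F ↔ v 2 = 0) (hf : ContMDiff (𝓡 3) 𝓘(ℝ, ℝ) ∞ f)
    (hfF : ∀ x ∈ F, f x = 0) : ∀ᶠ x in 𝓝 p, f x = 0 ↔ x ∈ F := by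
  set h : E 3 → ℝ := fun v => f (θ v) with hh
  have hc : ContDiffAt ℝ ∞ h 0 :=
    ((hf (θ 0)).comp (0 : E 3) (θ.contMDiffAt h0)).contDiffAt
  have hs := hc.hasStrictFDerivAt (by simp)
  set h' := fderiv ℝ h 0
  set e : E 3 := EuclideanSpace.single 2 1 with he
  have he1 : ‖e‖ = 1 := by simp [he]
  have hsplit : ∀ v : E 3, v = flat v + v 2 • e := fun v =>
    ext3 (by simp [he, flat]) (by simp [he, flat]) (by simp [he, flat])
  have hzero : ∀ v ∈ θ.source, v 2 = 0 → h v = 0 := fun v hv h2 => hfF _ ((hθ v hv).2 h2)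
  have hflat : ∀ v : E 3, v 2 = 0 → h' v = 0 := by
    intro v hv
    have h1 : HasDerivAt (fun t : ℝ => t • v) v 0 := by
      simpa using (hasDerivAt_id (0 : ℝ)).smul_const v
    have h2 : HasDerivAt (fun t : ℝ => h (t • v)) (h' v) 0 := by
      refine HasFDerivAt.comp_hasDerivAt (0 : ℝ) (l := h) ?_ h1
      rw [zero_smul]; exact hs.hasFDerivAt
    have hct : Tendsto (fun t : ℝ => t • v) (𝓝 0) (𝓝 0) := by
      have : Continuous fun t : ℝ => t • v := by fun_prop
      simpa using this.tendsto 0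
    refine h2.unique ((hasDerivAt_const (0 : ℝ) (0 : ℝ)).congr_of_eventuallyEq ?_)
    filter_upwards [hct.eventually (θ.open_source.mem_nhds h0)] with t ht
    exact hzero _ ht (by simp [hv])
  have hpt : p ∈ θ.target := by rw [← hθp]; exact θ.map_source h0
  -- Otherwise `h'` would vanish altogether, whereas composing `h` with the transition map to the
  -- adapted chart gives the third coordinate, whose derivative is nonzero.
  have hne : h' e ≠ 0 := by
    intro hcon
    have hall : h' = 0 := by
      ext v
      rw [hsplit v, map_add, map_smul, hcon, hflat (flat v) rfl]
      simp
    have hτ : ContMDiffAt (𝓡 3) (𝓡 3) ∞ (fun v => θ.symm (ψ v)) (0 : E 3) := by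
      refine ContMDiffAt.comp (0 : E 3) (θ.contMDiffAt_symm ?_) (ψ.contMDiffAt hψ.zero_mem)
      rw [hψ.map_zero]; exact hpt
    have hτ0 : θ.symm (ψ 0) = 0 := by
      rw [hψ.map_zero, ← hθp]; exact θ.left_inv h0
    have h1 := (hτ.contDiffAt.differentiableAt (by simp)).hasFDerivAt
    have h2 : HasFDerivAt (fun v => h (θ.symm (ψ v)))
        (h'.comp (fderiv ℝ (fun v => θ.symm (ψ v)) 0)) 0 := by
      refine HasFDerivAt.comp (0 : E 3) (g := h) ?_ h1
      rw [hτ0]; exact hs.hasFDerivAt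
    have hcψ : ContinuousAt ψ 0 := ψ.continuousAt hψ.zero_mem
    have h3 : HasFDerivAt (fun v : E 3 => v 2) (h'.comp (fderiv ℝ (fun v => θ.symm (ψ v)) 0)) 0 := by
      refine h2.congr_of_eventuallyEq ?_
      filter_upwards [ψ.open_source.mem_nhds hψ.zero_mem,
        hcψ.eventually (by rw [hψ.map_zero]; exact θ.open_target.mem_nhds hpt)] with v hv hv'
      change v 2 = f (θ (θ.symm (ψ v)))
      rw [show θ (θ.symm (ψ v)) = ψ v from θ.right_inv hv', hψ.apply_eq v hv]
    have h4 := congrArg (fun L => L e)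
      (h3.unique (EuclideanSpace.proj (𝕜 := ℝ) (2 : Fin 3)).hasFDerivAt)
    rw [hall] at h4
    simp [he] at h4
  have hbound := hs.isLittleO.def (show 0 < |h' e| / 2 by positivity)
  have htend : Tendsto (fun w : E 3 => (w, flat w)) (𝓝 0) (𝓝 ((0 : E 3), (0 : E 3))) := by
    have : Continuous fun w : E 3 => (w, flat w) := continuous_id.prodMk contDiff_flat.continuous
    simpa using this.tendsto 0
  have hflatt : Tendsto flat (𝓝 0) (𝓝 (0 : E 3)) := by
    simpa using contDiff_flat.continuous.tendsto 0
  have hev : ∀ᶠ w in 𝓝 (0 : E 3), h w = 0 → w 2 = 0 := by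
    filter_upwards [htend.eventually hbound, hflatt.eventually (θ.open_source.mem_nhds h0)]
      with w hw hfw hw0
    have h1 : w - flat w = w 2 • e := by
      conv_lhs => rw [hsplit w]
      have : flat (flat w + w 2 • e) = flat w := by rw [← hsplit w]
      rw [this, add_sub_cancel_left]
    simp only [hw0, hzero (flat w) hfw rfl, h1, map_smul, norm_smul, he1, Real.norm_eq_abs,
      sub_zero, zero_sub, abs_neg, smul_eq_mul, abs_mul, mul_one] at hw
    by_contra hne2
    have h2 := abs_pos.2 hne2
    have h3 := abs_pos.2 hne
    nlinarith [mul_pos h2 h3]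
  have hsym : Tendsto θ.symm (𝓝 p) (𝓝 0) := by
    have h1 : ContinuousAt θ.symm p := (θ.contMDiffAt_symm hpt).continuousAt
    have h2 : θ.symm p = 0 := by rw [← hθp]; exact θ.left_inv h0
    have h3 := h1.tendsto
    rwa [h2] at h3
  filter_upwards [hsym.eventually hev, θ.open_target.mem_nhds hpt] with x hx hxt
  have h1 : θ (θ.symm x) = x := θ.right_inv hxt
  refine ⟨fun hfx => ?_, hfF x⟩
  have h2 : (θ.symm x) 2 = 0 := hx (by rw [hh]; simp only; rw [h1, hfx])
  rw [← h1]
  exact (hθ _ (θ.symm.map_source hxt)).2 h2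

/-! ### Retraction along the gradient of a defining function -/

/-- The gradient of a function on `ℝ⁴`. -/
def grad (g : E 4 → ℝ) (x : E 4) : E 4 :=
  ∑ i : Fin 4, fderiv ℝ g x (EuclideanSpace.single i 1) • EuclideanSpace.single i (1 : ℝ)

theorem fderiv_grad_pos {g : E 4 → ℝ} {x : E 4} (h : fderiv ℝ g x ≠ 0) :
    0 < fderiv ℝ g x (grad g x) := by
  have h1 : fderiv ℝ g x (grad g x) =
      ∑ i : Fin 4, fderiv ℝ g x (EuclideanSpace.single i 1) ^ 2 := by
    rw [grad, map_sum]
    exact Finset.sum_congr rfl fun i _ => by rw [map_smul, smul_eq_mul, sq]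
  rw [h1]
  refine lt_of_le_of_ne (Finset.sum_nonneg fun i _ => sq_nonneg _) fun h0 => h ?_
  have h2 := (Finset.sum_eq_zero_iff_of_nonneg fun i _ => sq_nonneg _).1 h0.symm
  ext v
  have hv : v = ∑ i : Fin 4, v i • EuclideanSpace.single i (1 : ℝ) := by
    ext j
    fin_cases j <;> simp [Fin.sum_univ_four]
  rw [hv, map_sum]
  simp only [map_smul, zero_apply]
  exact Finset.sum_eq_zero fun i hi => by
    rw [pow_eq_zero_iff two_ne_zero |>.1 (h2 i hi), smul_zero]

theorem contDiffAt_grad {g : E 4 → ℝ} {x : E 4} (h : ContDiffAt ℝ ∞ g x) :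
    ContDiffAt ℝ ∞ (grad g) x := by
  have h1 : ContDiffAt ℝ ∞ (fderiv ℝ g) x := h.fderiv_right (by simp)
  exact ContDiffAt.sum fun i _ => (h1.clm_apply contDiffAt_const).smul contDiffAt_const

/-- A compact locally flat set which is given by a global regular function has a tube. -/
theorem exists_isTube {F : Set S3} (hF : IsCompact F) (hflat : LocallyFlat F) {f : S3 → ℝ}
    (hf : ContMDiff (𝓡 3) 𝓘(ℝ, ℝ) ∞ f) (hfF : ∀ x ∈ F, f x = 0)
    (hd : ∀ x ∈ F, mfderiv (𝓡 3) 𝓘(ℝ, ℝ) f x ≠ 0) : ∃ (U : Set S3) (r : S3 → S3), IsTube F U f r := by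
  have hadapt : ∀ p ∈ F, ∃ ψ : Chart, IsAdapted ψ f p := fun p hp => by
    obtain ⟨ψ, hψ, -⟩ := exists_isAdapted isOpen_univ hf.contMDiffOn (mem_univ p) (hfF p hp) (hd p hp)
    exact ⟨ψ, hψ⟩
  obtain ⟨U₁, hU₁F, hU₁, hU₁z⟩ : ∃ U₁, F ⊆ U₁ ∧ IsOpen U₁ ∧ ∀ x ∈ U₁, f x = 0 ↔ x ∈ F := by
    refine ⟨interior {x | f x = 0 ↔ x ∈ F}, fun p hp => ?_, isOpen_interior,
      fun x hx => (interior_subset hx : x ∈ {x | f x = 0 ↔ x ∈ F})⟩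
    obtain ⟨ψ, hψ⟩ := hadapt p hp
    obtain ⟨θ, h0, hθp, hθ⟩ := hflat p hp
    exact mem_interior_iff_mem_nhds.2 (hψ.eventually_eq_zero_iff h0 hθp hθ hf hfF)
  -- The extension is constant along rays, so a zero of `g` projects radially to a zero of `f`.
  set g : E 4 → ℝ := fun x => f (normS x) with hg
  have hgs : ∀ x : E 4, x ≠ 0 → ContDiffAt ℝ ∞ g x := fun x hx =>
    ((hf (normS x)).comp x (contMDiffAt_normS hx)).contDiffAt
  have hgd : ∀ x ∈ F, fderiv ℝ g (x : E 4) ≠ 0 := by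
    intro x hx h0
    refine hd x hx ?_
    have h1 : mfderiv (𝓡 3) 𝓘(ℝ, ℝ) (g ∘ fun y : S3 => (y : E 4)) x = mfderiv (𝓡 3) 𝓘(ℝ, ℝ) f x := by
      congr 1
      funext y
      simp [hg]
    rw [← h1]
    have h2 := mfderiv_comp x ((hgs x (coe_ne_zero x)).contMDiffAt.mdifferentiableAt (by simp))
      (contMDiff_coe.contMDiffAt.mdifferentiableAt (x := x) (by simp))
    refine h2.trans ?_
    have h3 : mfderiv 𝓘(ℝ, E 4) 𝓘(ℝ, ℝ) g (x : E 4) = 0 := by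
      rw [mfderiv_eq_fderiv]; exact h0
    rw [h3]
    exact ContinuousLinearMap.zero_comp _
  set V := grad g with hV
  have hVs : ∀ x : E 4, x ≠ 0 → ContDiffAt ℝ ∞ V x := fun x hx => contDiffAt_grad (hgs x hx)
  set m : E 4 × ℝ → E 4 := fun q => q.1 + q.2 • V q.1 with hm
  have hms : ∀ q : E 4 × ℝ, q.1 ≠ 0 → ContDiffAt ℝ ∞ m q := fun q hq =>
    contDiffAt_fst.add (contDiffAt_snd.smul ((hVs q.1 hq).comp q contDiffAt_fst))
  set D : Set (E 4 × ℝ) := {q | q.1 ≠ 0} ∩ m ⁻¹' {0}ᶜ with hD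
  have hDo : IsOpen D := by
    have h1 : IsOpen {q : E 4 × ℝ | q.1 ≠ 0} := isOpen_ne_fun continuous_fst continuous_const
    have h2 : ContinuousOn m {q : E 4 × ℝ | q.1 ≠ 0} := fun q hq =>
      (hms q hq).continuousAt.continuousWithinAt
    exact h2.isOpen_inter_preimage h1 isOpen_compl_singleton
  -- Inverting `T` near `F × {0}` solves `g (x + σ V x) = 0` for `σ`. At such a point the derivative
  -- in the last variable is that of `g` along its gradient, which is positive.
  set T : E 4 × ℝ → E 4 × ℝ := fun q => (q.1, g (m q)) with hT
  have hTs : ∀ q ∈ D, ContDiffAt ℝ ∞ T q := fun q hq =>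
    contDiffAt_fst.prodMk ((hgs _ hq.2).comp q (hms q hq.1))
  have hTD : ContMDiffOn 𝓘(ℝ, E 4 × ℝ) 𝓘(ℝ, E 4 × ℝ) ∞ T D :=
    contMDiffOn_iff_contDiffOn.2 fun q hq => (hTs q hq).contDiffWithinAt
  have hm0 : ∀ x : E 4, m (x, 0) = x := fun x => by simp [hm]
  have hFD : ∀ x : S3, ((x : E 4), (0 : ℝ)) ∈ D := fun x =>
    ⟨coe_ne_zero x, by rw [mem_preimage, hm0]; exact coe_ne_zero x⟩
  have hT0 : ∀ x ∈ F, T ((x : E 4), 0) = ((x : E 4), 0) := fun x hx => by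
    simp only [hT, hm0, hg, normS_coe, hfF x hx]
  have hloc : ∀ x ∈ F, IsLocalDiffeomorphAt 𝓘(ℝ, E 4 × ℝ) 𝓘(ℝ, E 4 × ℝ) ∞ T ((x : E 4), 0) := by
    intro x hx
    refine isLocalDiffeomorphAt_of_injective_mfderiv hDo hTD (hFD x) rfl ?_
    rw [mfderiv_eq_fderiv]
    refine (injective_iff_map_eq_zero (fderiv ℝ T ((x : E 4), 0))).2 ?_
    rintro ⟨a, b⟩ hab
    have h1 := ((hTs _ (hFD x)).differentiableAt (by simp)).hasFDerivAt
    have h2 := (ContinuousLinearMap.fst ℝ (E 4) ℝ).hasFDerivAt.comp ((x : E 4), (0 : ℝ)) h1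
    have h3 : HasFDerivAt (fun q : E 4 × ℝ => q.1) (ContinuousLinearMap.fst ℝ (E 4) ℝ)
        ((x : E 4), (0 : ℝ)) := hasFDerivAt_fst
    have ha : a = 0 := by
      have := congrArg (fun L => L (a, b)) (h3.unique h2)
      simpa [hab] using this
    subst ha
    have h4 : HasDerivAt (fun t : ℝ => ((x : E 4), t * b)) ((0 : E 4), b) 0 := by
      refine (hasDerivAt_const (0 : ℝ) (x : E 4)).prodMk ?_
      simpa using (hasDerivAt_id (0 : ℝ)).mul_const b
    have h5 : HasDerivAt (fun t : ℝ => T ((x : E 4), t * b)) (0 : E 4 × ℝ) 0 := by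
      rw [← hab]
      refine HasFDerivAt.comp_hasDerivAt (0 : ℝ) (l := T) ?_ h4
      simpa using h1
    have h6 : HasDerivAt (fun t : ℝ => g (m ((x : E 4), t * b))) 0 0 :=
      (ContinuousLinearMap.snd ℝ (E 4) ℝ).hasFDerivAt.comp_hasDerivAt (0 : ℝ) h5
    have h7 : HasDerivAt (fun t : ℝ => (x : E 4) + (t * b) • V x) (b • V x) 0 := by
      have : HasDerivAt (fun t : ℝ => t * b) b 0 := by
        simpa using (hasDerivAt_id (0 : ℝ)).mul_const b
      exact (this.smul_const (V x)).const_add _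
    have h8 : HasDerivAt (fun t : ℝ => g (m ((x : E 4), t * b))) (fderiv ℝ g x (b • V x)) 0 := by
      refine HasFDerivAt.comp_hasDerivAt (0 : ℝ) (l := g) ?_ h7
      simpa [hm0] using ((hgs x (coe_ne_zero x)).differentiableAt (by simp)).hasFDerivAt
    have h9 := h8.unique h6
    rw [map_smul, smul_eq_mul] at h9
    have hb : b = 0 := (mul_eq_zero.1 h9).resolve_right (fderiv_grad_pos (hgd x hx)).ne'
    rw [hb]; rfl
  set FE : Set (E 4 × ℝ) := (fun x : S3 => ((x : E 4), (0 : ℝ))) '' F with hFE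
  have hFEc : IsCompact FE := hF.image (continuous_subtype_val.prodMk continuous_const)
  obtain ⟨O₁, hO₁, hFO₁, hinj⟩ := InjOn.exists_isOpen_superset (f := T) (s := FE)
    (by
      rintro _ ⟨x, hx, rfl⟩ _ ⟨y, hy, rfl⟩ hxy
      simp only at hxy ⊢
      rwa [hT0 x hx, hT0 y hy] at hxy) hFEc
    (by rintro _ ⟨x, hx, rfl⟩; exact (hTs _ (hFD x)).continuousAt)
    (by
      rintro _ ⟨x, hx, rfl⟩
      obtain ⟨Φ, h1, h2⟩ := hloc x hx
      refine ⟨Φ.source, Φ.open_source.mem_nhds h1, fun a ha b hb hab => ?_⟩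
      rw [h2 ha, h2 hb] at hab
      exact Φ.injOn ha hb hab)
  set L : Set (E 4 × ℝ) := {q | IsLocalDiffeomorphAt 𝓘(ℝ, E 4 × ℝ) 𝓘(ℝ, E 4 × ℝ) ∞ T q} with hL
  have hLo : IsOpen L := by
    refine isOpen_iff_mem_nhds.2 fun q hq => ?_
    obtain ⟨Φ, h1, h2⟩ := hq
    exact mem_of_superset (Φ.open_source.mem_nhds h1) fun y hy => ⟨Φ, hy, h2⟩
  obtain ⟨Φ, hΦs, hΦT, hΦt⟩ := exists_partialDiffeomorph (f := T) (U := (O₁ ∩ L) ∩ D)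
    ((hO₁.inter hLo).inter hDo) (hinj.mono fun q hq => hq.1.1) fun q hq => hq.1.2
  set σ : S3 → ℝ := fun x => (Φ.symm ((x : E 4), (0 : ℝ))).2 with hσ
  set r : S3 → S3 := fun x => normS (m ((x : E 4), σ x)) with hr
  set U₂ : Set S3 := U₁ ∩ (fun x : S3 => ((x : E 4), (0 : ℝ))) ⁻¹' Φ.target with hU₂
  have hU₂o : IsOpen U₂ := hU₁.inter
    (Φ.open_target.preimage (continuous_subtype_val.prodMk continuous_const))
  have hspec : ∀ x ∈ U₂, m ((x : E 4), σ x) ≠ 0 ∧ g (m ((x : E 4), σ x)) = 0 := by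
    rintro x ⟨-, hx⟩
    have h1 := Φ.symm.map_source hx
    have h2 : Φ (Φ.symm ((x : E 4), (0 : ℝ))) = ((x : E 4), (0 : ℝ)) := Φ.right_inv hx
    have h3 : Φ.symm ((x : E 4), (0 : ℝ)) ∈ D := by
      have h4 : Φ.symm ((x : E 4), (0 : ℝ)) ∈ Φ.source := h1
      rw [hΦs] at h4
      exact h4.2
    rw [hΦT] at h2
    have h5 : Φ.symm ((x : E 4), (0 : ℝ)) = ((x : E 4), σ x) := 
      Prod.ext (show (T (Φ.symm ((x : E 4), (0 : ℝ)))).1 = _ by rw [h2]) rfl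
    rw [h5] at h2 h3
    exact ⟨h3.2, congrArg Prod.snd h2⟩
  have hσs : ∀ x ∈ U₂, ContMDiffAt (𝓡 3) 𝓘(ℝ, ℝ) ∞ σ x := by
    intro x hx
    have h1 : ContMDiffAt 𝓘(ℝ, E 4 × ℝ) 𝓘(ℝ, E 4 × ℝ) ∞ Φ.symm ((x : E 4), (0 : ℝ)) :=
      Φ.symm.contMDiffOn.contMDiffAt (Φ.open_target.mem_nhds hx.2)
    exact contDiff_snd.contMDiff.contMDiffAt.comp x
      (h1.comp x ((contMDiff_coe x).prodMk_space contMDiffAt_const))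
  have hrs : ∀ x ∈ U₂, ContMDiffAt (𝓡 3) (𝓡 3) ∞ r x := by
    intro x hx
    exact (contMDiffAt_normS (hspec x hx).1).comp x
      ((hms ((x : E 4), σ x) (coe_ne_zero x)).contMDiffAt.comp x
        ((contMDiff_coe x).prodMk_space (hσs x hx)))
  have hFU₂ : F ⊆ U₂ := fun x hx => ⟨hU₁F hx, by
    have h1 : ((x : E 4), (0 : ℝ)) ∈ Φ.source := by
      rw [hΦs]
      exact ⟨⟨hFO₁ (mem_image_of_mem _ hx), hloc x hx⟩, hFD x⟩
    have h2 := Φ.map_source h1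
    have h3 : Φ ((x : E 4), (0 : ℝ)) = ((x : E 4), (0 : ℝ)) := by rw [hΦT, hT0 x hx]
    have h4 : Φ ((x : E 4), (0 : ℝ)) ∈ Φ.target := h2
    rwa [h3] at h4⟩
  have hrF : ∀ x ∈ F, r x = x := by
    intro x hx
    have h1 : ((x : E 4), (0 : ℝ)) ∈ Φ.source := by
      rw [hΦs]
      exact ⟨⟨hFO₁ (mem_image_of_mem _ hx), hloc x hx⟩, hFD x⟩
    have h3 : Φ ((x : E 4), (0 : ℝ)) = ((x : E 4), (0 : ℝ)) := by rw [hΦT, hT0 x hx]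
    have h2 : Φ.symm (Φ ((x : E 4), (0 : ℝ))) = ((x : E 4), (0 : ℝ)) := Φ.left_inv h1
    rw [h3] at h2
    have h4 : σ x = 0 := by rw [hσ]; simp only; rw [h2]
    rw [hr]; simp only
    rw [h4, hm0, normS_coe]
  have hrc : ContinuousOn r U₂ := fun x hx => (hrs x hx).continuousAt.continuousWithinAt
  -- The domain is restricted so that `r x` lies in `U₁`, where the zeros of `f` are exactly the
  -- points of `F`; this is what places `r x` on the surface.
  refine ⟨U₂ ∩ r ⁻¹' U₁, r, ⟨hrc.isOpen_inter_preimage hU₂o hU₁,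
    fun x hx => ⟨hFU₂ hx, by rw [mem_preimage, hrF x hx]; exact hU₁F hx⟩, hf.contMDiffOn,
    fun x hx => (hrs x hx.1).contMDiffWithinAt, fun x hx => ?_, hrF,
    fun x hx => hU₁z x hx.1.1, hadapt⟩⟩
  exact (hU₁z _ hx.2).1 (hspec x hx.1).2

theorem IsClosedSurface.exists_isTube {F : Set S3} (hF : IsClosedSurface F) :
    ∃ (U : Set S3) (f : S3 → ℝ) (r : S3 → S3), IsTube F U f r := by
  obtain ⟨f, h1, h2, h3⟩ := hF.exists_increasing
  obtain ⟨U, r, h⟩ := SurfaceCrossing.exists_isTube hF.compact hF.locallyFlat h1 h2 h3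
  exact ⟨U, f, r, h⟩

/-! ### Stereographic coordinates -/

/-- The inverse of stereographic projection. -/
def istereo (u : E 3) : S3 :=
  normS !₂[2 * u 0, 2 * u 1, 2 * u 2, u 0 ^ 2 + u 1 ^ 2 + u 2 ^ 2 - 1]

theorem normSq_four (a b c d : ℝ) :
    ‖(!₂[a, b, c, d] : E 4)‖ ^ 2 = a ^ 2 + b ^ 2 + c ^ 2 + d ^ 2 := by
  rw [EuclideanSpace.norm_sq_eq]
  simp [Fin.sum_univ_four]

theorem contDiff_vec4 {V : Type*} [NormedAddCommGroup V] [NormedSpace ℝ V] {a b c d : V → ℝ}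
    (ha : ContDiff ℝ ∞ a) (hb : ContDiff ℝ ∞ b) (hc : ContDiff ℝ ∞ c) (hd : ContDiff ℝ ∞ d) :
    ContDiff ℝ ∞ fun v => (!₂[a v, b v, c v, d v] : E 4) := by
  rw [contDiff_euclidean]
  intro i
  fin_cases i
  exacts [ha, hb, hc, hd]

theorem norm_istereo_aux (u : E 3) :
    ‖(!₂[2 * u 0, 2 * u 1, 2 * u 2, u 0 ^ 2 + u 1 ^ 2 + u 2 ^ 2 - 1] : E 4)‖ =
      u 0 ^ 2 + u 1 ^ 2 + u 2 ^ 2 + 1 := by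
  have h := normSq_four (2 * u 0) (2 * u 1) (2 * u 2) (u 0 ^ 2 + u 1 ^ 2 + u 2 ^ 2 - 1)
  refine (pow_left_inj₀ (norm_nonneg _) (by positivity) two_ne_zero).1 ?_
  rw [h]; ring

theorem coe_istereo (u : E 3) : (istereo u : E 4) = (u 0 ^ 2 + u 1 ^ 2 + u 2 ^ 2 + 1)⁻¹ •
    !₂[2 * u 0, 2 * u 1, 2 * u 2, u 0 ^ 2 + u 1 ^ 2 + u 2 ^ 2 - 1] := by
  rw [istereo, coe_normS, norm_istereo_aux]
  rw [← norm_ne_zero_iff, norm_istereo_aux]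
  positivity

theorem contMDiff_istereo : ContMDiff (𝓡 3) (𝓡 3) ∞ istereo := by
  intro u
  refine ContMDiffAt.comp u (contMDiffAt_normS ?_) (ContDiff.contMDiff ?_).contMDiffAt
  · rw [← norm_ne_zero_iff, norm_istereo_aux]
    positivity
  · have h := contDiff_apply3
    exact contDiff_vec4 (contDiff_const.mul (h 0)) (contDiff_const.mul (h 1))
      (contDiff_const.mul (h 2)) (((((h 0).pow 2).add ((h 1).pow 2)).add ((h 2).pow 2)).sub
        contDiff_const)

theorem istereo_three (u : E 3) : (istereo u : E 4) 3 ≠ 1 := by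
  rw [coe_istereo]
  have h : 0 < u 0 ^ 2 + u 1 ^ 2 + u 2 ^ 2 + 1 := by positivity
  simp only [PiLp.smul_apply, smul_eq_mul, Matrix.cons_val]
  intro hcon
  rw [inv_mul_eq_iff_eq_mul₀ h.ne'] at hcon
  linarith

theorem stereo_istereo (u : E 3) : stereo (istereo u) = u := by
  have h : u 0 ^ 2 + u 1 ^ 2 + u 2 ^ 2 + 1 ≠ 0 := by positivity
  have h2 : 1 - (u 0 ^ 2 + u 1 ^ 2 + u 2 ^ 2 + 1)⁻¹ * (u 0 ^ 2 + u 1 ^ 2 + u 2 ^ 2 - 1) =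
      2 * (u 0 ^ 2 + u 1 ^ 2 + u 2 ^ 2 + 1)⁻¹ := by
    field_simp; ring
  have key : ∀ t : ℝ, (u 0 ^ 2 + u 1 ^ 2 + u 2 ^ 2 + 1)⁻¹ * (2 * t) /
      (2 * (u 0 ^ 2 + u 1 ^ 2 + u 2 ^ 2 + 1)⁻¹) = t := fun t => by
    field_simp
  refine ext3 ?_ ?_ ?_ <;>
  · simp only [stereo, coe_istereo, PiLp.smul_apply, smul_eq_mul, Matrix.cons_val, h2]
    exact key _

theorem sum_sq_coe (x : S3) :
    (x : E 4) 0 ^ 2 + (x : E 4) 1 ^ 2 + (x : E 4) 2 ^ 2 + (x : E 4) 3 ^ 2 = 1 := by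
  have h := norm_coe x
  have h2 := EuclideanSpace.norm_sq_eq (x : E 4)
  rw [h] at h2
  simp [Fin.sum_univ_four] at h2
  linarith

theorem istereo_stereo {x : S3} (hx : (x : E 4) 3 ≠ 1) : istereo (stereo x) = x := by
  have h1 : 1 - (x : E 4) 3 ≠ 0 := sub_ne_zero.2 hx.symm
  have h2 := sum_sq_coe x
  apply Subtype.ext
  rw [coe_istereo]
  have h3 : stereo x 0 ^ 2 + stereo x 1 ^ 2 + stereo x 2 ^ 2 + 1 = 2 / (1 - (x : E 4) 3) := by
    simp only [stereo, Matrix.cons_val]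
    field_simp
    linear_combination h2
  have h4 : stereo x 0 ^ 2 + stereo x 1 ^ 2 + stereo x 2 ^ 2 - 1 =
      2 * (x : E 4) 3 / (1 - (x : E 4) 3) := by
    have : 2 * (x : E 4) 3 / (1 - (x : E 4) 3) = 2 / (1 - (x : E 4) 3) - 2 := by
      field_simp; ring
    rw [this, ← h3]; ring
  rw [h4, h3]
  have key : ∀ t : ℝ, (2 / (1 - (x : E 4) 3))⁻¹ * (2 * (t / (1 - (x : E 4) 3))) = t := fun t => by
    field_simp
  ext i
  fin_cases i
  · exact key _
  · exact key _
  · exact key _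
  · simp only [PiLp.smul_apply, smul_eq_mul]
    rw [mul_div_assoc]
    exact key _

theorem isOpen_ne_pole : IsOpen {x : S3 | (x : E 4) 3 ≠ 1} :=
  isOpen_ne_fun ((EuclideanSpace.proj (𝕜 := ℝ) (3 : Fin 4)).continuous.comp
    continuous_subtype_val) continuous_const

theorem contMDiff_coe_apply (i : Fin 4) :
    ContMDiff (𝓡 3) 𝓘(ℝ, ℝ) ∞ fun x : S3 => (x : E 4) i :=
  (EuclideanSpace.proj (𝕜 := ℝ) i).contMDiff.comp contMDiff_coe

theorem ContMDiffAt.div_real {f g : S3 → ℝ} {x : S3} (hf : ContMDiffAt (𝓡 3) 𝓘(ℝ, ℝ) ∞ f x)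
    (hg : ContMDiffAt (𝓡 3) 𝓘(ℝ, ℝ) ∞ g x) (h : g x ≠ 0) :
    ContMDiffAt (𝓡 3) 𝓘(ℝ, ℝ) ∞ (fun y => f y / g y) x := by
  have h1 : ContDiffAt ℝ ∞ (fun q : ℝ × ℝ => q.1 / q.2) (f x, g x) :=
    contDiffAt_fst.div contDiffAt_snd h
  exact h1.contMDiffAt.comp x (hf.prodMk_space hg)

theorem contMDiffAt_stereo {x : S3} (hx : (x : E 4) 3 ≠ 1) :
    ContMDiffAt (𝓡 3) (𝓡 3) ∞ stereo x := by
  have h1 : ContMDiffAt (𝓡 3) 𝓘(ℝ, ℝ) ∞ (fun y : S3 => 1 - (y : E 4) 3) x :=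
    contMDiffAt_const.sub (contMDiff_coe_apply 3 x)
  have h2 : (1 : ℝ) - (x : E 4) 3 ≠ 0 := sub_ne_zero.2 hx.symm
  exact contMDiffAt_vec3 (ContMDiffAt.div_real (contMDiff_coe_apply 0 x) h1 h2)
    (ContMDiffAt.div_real (contMDiff_coe_apply 1 x) h1 h2)
    (ContMDiffAt.div_real (contMDiff_coe_apply 2 x) h1 h2)

theorem exists_stereoChart : ∃ ψ : Chart, ψ.source = univ ∧ ∀ u, ψ u = istereo u := by
  obtain ⟨ψ, h1, h2, -⟩ := exists_partialDiffeomorph_of_leftInverse (f := istereo) (g := stereo)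
    isOpen_univ isOpen_ne_pole contMDiff_istereo.contMDiffOn
    (fun x hx => (contMDiffAt_stereo hx).contMDiffWithinAt) (fun u _ => istereo_three u)
    (fun u _ => stereo_istereo u) rfl
  exact ⟨ψ, h1, h2⟩

theorem contDiff_planeProj : ContDiff ℝ ∞ planeProj := by
  rw [contDiff_euclidean]
  intro i
  fin_cases i
  exacts [contDiff_apply3 0, contDiff_apply3 1]

theorem planeProj_eq_iff {v w : E 3} : planeProj v = planeProj w ↔ v 0 = w 0 ∧ v 1 = w 1 := by
  refine ⟨fun h => ⟨congrArg (fun u : E 2 => u 0) h, congrArg (fun u : E 2 => u 1) h⟩, fun h => ?_⟩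
  rw [planeProj, planeProj, h.1, h.2]

/-! ### Planar diagrams are diagrams on every surface -/

/-- Stereographic coordinates are defined on all of `ℝ³`, a convex chart, so the knot can be moved
into a product chart by a diagonal linear map. There the surface projection forgets the third
coordinate, just as the planar one does. -/
theorem surfaceCrossingNumber_le_crossingNumber (K : Knot) {F U : Set S3} {f : S3 → ℝ}
    {r : S3 → S3} (hne : F.Nonempty) (hF : IsCompact F) (hflat : LocallyFlat F)
    (h : IsTube F U f r) : surfaceCrossingNumber K F ≤ crossingNumber K := by
  refine le_iInf fun Φ => le_iInf fun hΦ => ?_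
  obtain ⟨hpole, hreg⟩ := hΦ
  obtain ⟨N, -, -⟩ := h.exists_regularNeighborhood hF
  obtain ⟨p, hp⟩ := hne
  obtain ⟨hpN, -, hph⟩ := N.core p hp
  obtain ⟨θ, ψ, h0, -, hθN, hθ⟩ := RegularNeighborhood.exists_productChart hflat hpN
    (by rw [hph, abs_zero]; exact one_pos)
  obtain ⟨σ, hσu, hσ⟩ := exists_stereoChart
  set c : Circle → S3 := Φ.final ∘ K.toFun with hc
  have hpole' : ∀ z, (c z : E 4) 3 ≠ 1 := hpole
  have hcs : SmoothLoop c := Φ.smoothLoop K.smoothLoop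
  have hcc : Continuous c := Φ.contMDiff_final.continuous.comp K.smooth.continuous
  have hsc : Continuous fun z => stereo (c z) := by
    refine continuous_iff_continuousAt.2 fun z => ?_
    exact ContinuousAt.comp (f := c) (contMDiffAt_stereo (hpole' z)).continuousAt hcc.continuousAt
  obtain ⟨a, Θ, ha, hΘ⟩ := exists_ambientIsotopy_chart_to_chart σ θ
    (by rw [hσu]; exact convex_univ) (by rw [hσu]; trivial) h0 (isCompact_range hsc)
    (by rw [hσu]; exact subset_univ _)
  set y : Circle → E 3 := fun z => WithLp.toLp 2 fun i => a i * stereo (c z) i with hy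
  have hy' : ∀ z, y z ∈ θ.source ∧ Θ.final (c z) = θ (y z) := by
    intro z
    have h1 := hΘ (stereo (c z)) (mem_range_self z)
    rw [hσ, istereo_stereo (hpole' z)] at h1
    exact h1
  have hfin : (Φ.trans Θ).final ∘ K.toFun = Θ.final ∘ c := by
    funext z
    simp only [Function.comp_apply, AmbientIsotopy.trans_final, hc]
  have hint : ∀ z, Θ.final (c z) ∈ interior N.carrier := fun z => by
    refine interior_maximal hθN θ.open_target ?_
    rw [(hy' z).2]; exact θ.map_source (hy' z).1
  have hsh : ∀ z, N.shadow (Θ.final ∘ c) z = (ψ (flat (y z)) : E 4) := fun z => by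
    rw [RegularNeighborhood.shadow, Function.comp_apply, (hy' z).2, (hθ _ (hy' z).1).2.1]
  have hfs : ∀ z, flat (y z) ∈ ψ.source := fun z => (hθ _ (hy' z).1).1
  have hback : ∀ z, ψ.symm (normS (N.shadow (Θ.final ∘ c) z)) = flat (y z) := fun z => by
    rw [hsh, normS_coe]
    exact ψ.left_inv (hfs z)
  -- The planar diagram is recovered from the one on the surface by reading surface coordinates and
  -- dividing by the diagonal entries.
  have htr := IsRegularCurve.transfer (c₂ := N.shadow (Θ.final ∘ c))
    (g := fun x : E 4 => planeProj (vec3 ((a 0)⁻¹ * ψ.symm (normS x) 0)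
      ((a 1)⁻¹ * ψ.symm (normS x) 1) 0)) hreg ?_ ?_ ?_ ?_
  · refine (iInf_le_of_le N (iInf_le_of_le (Φ.trans Θ) (iInf_le_of_le ?_ ?_)))
    · rw [hfin]; exact ⟨hint, htr.1⟩
    · rw [hfin]; exact htr.2.le
  · intro z
    rw [hback]
    refine planeProj_eq_iff.2 ⟨?_, ?_⟩
    · change stereo (c z) 0 = (a 0)⁻¹ * (a 0 * stereo (c z) 0)
      rw [inv_mul_cancel_left₀ (ha 0)]
    · change stereo (c z) 1 = (a 1)⁻¹ * (a 1 * stereo (c z) 1)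
      rw [inv_mul_cancel_left₀ (ha 1)]
  · intro z
    have h1 : (N.shadow (Θ.final ∘ c) z) ≠ 0 := coe_ne_zero _
    have h2 : ContMDiffAt 𝓘(ℝ, E 4) (𝓡 3) ∞ (fun x => ψ.symm (normS x))
        (N.shadow (Θ.final ∘ c) z) := by
      refine ContMDiffAt.comp _ (ψ.contMDiffAt_symm ?_) (contMDiffAt_normS h1)
      rw [hsh, normS_coe]
      exact ψ.map_source (hfs z)
    have h3 : ContMDiffAt 𝓘(ℝ, E 4) 𝓘(ℝ, E 3) ∞ (fun x : E 4 =>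
        vec3 ((a 0)⁻¹ * ψ.symm (normS x) 0) ((a 1)⁻¹ * ψ.symm (normS x) 1) 0)
        (N.shadow (Θ.final ∘ c) z) :=
      contMDiffAt_vec3
        ((contDiff_const.mul (contDiff_apply3 0)).contMDiff.contMDiffAt.comp _ h2)
        ((contDiff_const.mul (contDiff_apply3 1)).contMDiff.contMDiffAt.comp _ h2)
        contMDiffAt_const
    exact ((contDiff_planeProj.contMDiff.contMDiffAt.comp _ h3).contDiffAt).differentiableAt
      (by simp)
  · exact fun t => N.differentiableAt_shadow (Θ.smoothLoop hcs)
      (fun z => interior_subset (hint z)) t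
  · intro z w hzw
    obtain ⟨h1, h2⟩ := planeProj_eq_iff.1 hzw
    rw [hsh, hsh]
    have : flat (y z) = flat (y w) := by
      refine ext3 ?_ ?_ rfl
      · change a 0 * stereo (c z) 0 = a 0 * stereo (c w) 0
        rw [h1]
      · change a 1 * stereo (c z) 1 = a 1 * stereo (c w) 1
        rw [h2]
    rw [this]

/-! ### Diagrams on the standard sphere are planar diagrams -/

/-- The first two chart coordinates of the curve trace a set of Hausdorff dimension at most one,
whose complement in the plane is dense. A point of the horizontal plane over a missed value is not
on the curve. -/
theorem exists_notMem_curve (θ : Chart) {γ : ℝ → S3} (hγ : ContMDiff 𝓘(ℝ, ℝ) (𝓡 3) ∞ γ)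
    {O : Set (E 3)} (hO : O ∈ 𝓝 (0 : E 3)) : ∃ v ∈ O, v 2 = 0 ∧ (v ∈ θ.source → ∀ t, γ t ≠ θ v) := by
  set S : Set ℝ := γ ⁻¹' θ.target with hS
  set f : ℝ → E 2 := fun t => planeProj (θ.symm (γ t)) with hf
  have hfs : ∀ t ∈ S, ContDiffAt ℝ 1 f t := fun t ht => by
    have h1 : ContMDiffAt 𝓘(ℝ, ℝ) (𝓡 3) ∞ (fun t => θ.symm (γ t)) t :=
      (θ.contMDiffAt_symm ht).comp t (hγ t)
    exact ((contDiff_planeProj.contMDiff.contMDiffAt.comp t h1).contDiffAt).of_le (by simp)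
  have hdim : dimH (f '' S) < finrank ℝ (E 2) := by
    have h1 : dimH (f '' S) ≤ dimH S := dimH_image_le_of_locally_lipschitzOn fun t ht => by
      obtain ⟨C, u, hu, h⟩ := (hfs t ht).exists_lipschitzOnWith
      exact ⟨C, u, mem_nhdsWithin_of_mem_nhds hu, h⟩
    have h2 : dimH S ≤ 1 := (dimH_mono (subset_univ S)).trans Real.dimH_univ.le
    refine (h1.trans h2).trans_lt ?_
    simp
  have hdense := dense_compl_of_dimH_lt_finrank hdim
  set j : E 2 → E 3 := fun w => vec3 (w 0) (w 1) 0 with hj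
  have hjc : Continuous j := by
    have h1 : ∀ i, Continuous fun w : E 2 => w i := fun i =>
      (EuclideanSpace.proj (𝕜 := ℝ) i).continuous
    refine (PiLp.continuous_toLp 2 _).comp (continuous_pi fun i => ?_)
    fin_cases i
    exacts [h1 0, h1 1, continuous_const]
  have hj0 : j 0 = 0 := ext3 rfl rfl rfl
  have hpre : j ⁻¹' O ∈ 𝓝 (0 : E 2) := hjc.continuousAt.preimage_mem_nhds (by rwa [hj0])
  obtain ⟨w, hw, hwS⟩ := mem_closure_iff_nhds.1 (hdense 0) _ hpre
  refine ⟨j w, hw, rfl, fun hs t ht => hwS ⟨t, ?_, ?_⟩⟩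
  · rw [hS, mem_preimage, ht]; exact θ.map_source hs
  · rw [hf]
    simp only
    rw [ht, show θ.symm (θ (j w)) = j w from θ.left_inv hs]
    ext i
    fin_cases i <;> rfl

/-- Along the normalized line `x + t e`, with `e` the last unit vector, the last coordinate is `t /
‖x + t e‖`, which has nonzero derivative at `t = 0`. -/
theorem mfderiv_coe_three_ne_zero {x : S3} (hx : x ∈ standardSphere) :
    mfderiv (𝓡 3) 𝓘(ℝ, ℝ) (fun y : S3 => (y : E 4) 3) x ≠ 0 := by
  intro h0
  have hx3 : (x : E 4) 3 = 0 := hx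
  set e : E 4 := EuclideanSpace.single 3 1 with he
  set g : E 4 → ℝ := fun y => (normS y : E 4) 3 with hg
  have h1 : mfderiv 𝓘(ℝ, E 4) 𝓘(ℝ, ℝ) g (x : E 4) = 0 := by
    have h2 : mfderiv (𝓡 3) 𝓘(ℝ, ℝ) (fun y : S3 => (y : E 4) 3) (normS (x : E 4)) = 0 := by
      rw [normS_coe]; exact h0
    have h3 := mfderiv_comp (x : E 4)
      ((contMDiff_coe_apply 3 (normS (x : E 4))).mdifferentiableAt (by simp))
      ((contMDiffAt_normS (coe_ne_zero x)).mdifferentiableAt (by simp))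
    refine h3.trans ?_
    rw [h2]
    exact ContinuousLinearMap.zero_comp _
  rw [mfderiv_eq_fderiv] at h1
  have hgd : HasFDerivAt g (0 : E 4 →L[ℝ] ℝ) ((x : E 4) + (0 : ℝ) • e) := by
    have h2 : ContMDiffAt 𝓘(ℝ, E 4) 𝓘(ℝ, ℝ) ∞ g (x : E 4) :=
      (contMDiff_coe_apply 3 _).comp _ (contMDiffAt_normS (coe_ne_zero x))
    have h3 := (h2.contDiffAt.differentiableAt (by simp)).hasFDerivAt
    rw [zero_smul, add_zero]
    rwa [show fderiv ℝ g (x : E 4) = 0 from h1] at h3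
  have hline : HasDerivAt (fun t : ℝ => (x : E 4) + t • e) e 0 := by
    simpa using ((hasDerivAt_id (0 : ℝ)).smul_const e).const_add (x : E 4)
  have hcomp : HasDerivAt (fun t : ℝ => g ((x : E 4) + t • e)) 0 0 := by
    exact hgd.comp_hasDerivAt (0 : ℝ) hline
  have hne : (x : E 4) + (0 : ℝ) • e ≠ 0 := by rw [zero_smul, add_zero]; exact coe_ne_zero x
  have hk : DifferentiableAt ℝ (fun t : ℝ => ‖(x : E 4) + t • e‖⁻¹) 0 :=
    (hline.differentiableAt.norm ℝ hne).inv (norm_ne_zero_iff.2 hne)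
  have hprod := hk.hasDerivAt.mul (hasDerivAt_id (0 : ℝ))
  have hev : (fun t : ℝ => g ((x : E 4) + t • e)) =ᶠ[𝓝 0]
      ((fun t : ℝ => ‖(x : E 4) + t • e‖⁻¹) * id) := by
    filter_upwards [hline.continuousAt.eventually_ne hne] with t ht
    change (normS ((x : E 4) + t • e) : E 4) 3 = ‖(x : E 4) + t • e‖⁻¹ * t
    rw [coe_normS ht]
    simp [he, hx3]
  have h5 := hcomp.unique (hprod.congr_of_eventuallyEq hev)
  simp at h5

theorem isCompact_standardSphere : IsCompact standardSphere :=
  (isClosed_eq (contMDiff_coe_apply 3).continuous continuous_const).isCompact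

theorem standardSphere_nonempty : standardSphere.Nonempty := by
  refine ⟨normS (EuclideanSpace.single 0 1), ?_⟩
  have h : (EuclideanSpace.single 0 1 : E 4) ≠ 0 := by simp
  change (normS (EuclideanSpace.single 0 1) : E 4) 3 = 0
  rw [coe_normS h]
  simp

theorem locallyFlat_standardSphere : LocallyFlat standardSphere := by
  intro x hx
  obtain ⟨ψ, hψ, -⟩ := exists_isAdapted isOpen_univ (contMDiff_coe_apply 3).contMDiffOn
    (mem_univ x) hx (mfderiv_coe_three_ne_zero hx)
  refine ⟨ψ, hψ.zero_mem, hψ.map_zero, fun v hv => ?_⟩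
  rw [← hψ.apply_eq v hv]
  rfl

theorem exists_isTube_standardSphere :
    ∃ (U : Set S3) (r : S3 → S3), IsTube standardSphere U (fun x => (x : E 4) 3) r :=
  exists_isTube isCompact_standardSphere locallyFlat_standardSphere (contMDiff_coe_apply 3)
    (fun _ hx => hx) fun _ hx => mfderiv_coe_three_ne_zero hx

/-- A linear isometry that moves a given point of the standard sphere to the third unit vector and
preserves the last coordinate. -/
theorem exists_linearIsometryEquiv {q : S3} (hq : q ∈ standardSphere) :
    ∃ L : E 4 ≃ₗᵢ[ℝ] E 4, L q = EuclideanSpace.single 2 1 ∧ ∀ x, L x 3 = x 3 := by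
  have hq3 : (q : E 4) 3 = 0 := hq
  have hv : Orthonormal ℝ (({2, 3} : Set (Fin 4)).domRestrict
      ![0, 0, (q : E 4), EuclideanSpace.single 3 1]) := by
    rw [orthonormal_iff_ite]
    rintro ⟨i, hi⟩ ⟨j, hj⟩
    rcases hi with rfl | rfl <;> rcases hj with rfl | rfl <;>
      simp [Set.domRestrict, Subtype.ext_iff, hq3, EuclideanSpace.inner_single_left,
        EuclideanSpace.inner_single_right]
  obtain ⟨b, hb⟩ := hv.exists_orthonormalBasis_extension_of_card_eq (by simp)
  have hb2 : b 2 = (q : E 4) := hb 2 (by simp)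
  have hb3 : b 3 = EuclideanSpace.single 3 1 := hb 3 (by simp)
  refine ⟨b.repr, ?_, fun x => ?_⟩
  · rw [← hb2, b.repr_self]
  · rw [b.repr_apply_apply, hb3]
    simp [EuclideanSpace.inner_single_left]

theorem exists_notMem_range {γ : ℝ → S3} (hγ : ContMDiff 𝓘(ℝ, ℝ) (𝓡 3) ∞ γ) {F : Set S3}
    (hF : LocallyFlat F) (hne : F.Nonempty) : ∃ q ∈ F, ∀ t, γ t ≠ q := by
  obtain ⟨p, hp⟩ := hne
  obtain ⟨θ, h0, -, hθ⟩ := hF p hp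
  obtain ⟨v, hv, hv2, hvγ⟩ := exists_notMem_curve θ hγ (θ.open_source.mem_nhds h0)
  exact ⟨θ v, (hθ v hv).2 hv2, hvγ hv⟩

/-! ### Stereographic coordinates on the standard sphere -/

/-- Stereographic parametrization of the standard sphere. -/
def planeParam (L : E 4 ≃ₗᵢ[ℝ] E 4) (a b : ℝ) : S3 :=
  normS (L.symm !₂[2 * a, 2 * b, a ^ 2 + b ^ 2 - 1, 0])

theorem norm_planeParam_aux (L : E 4 ≃ₗᵢ[ℝ] E 4) (a b : ℝ) :
    ‖L.symm !₂[2 * a, 2 * b, a ^ 2 + b ^ 2 - 1, 0]‖ = a ^ 2 + b ^ 2 + 1 := by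
  rw [LinearIsometryEquiv.norm_map]
  have h := normSq_four (2 * a) (2 * b) (a ^ 2 + b ^ 2 - 1) 0
  refine (pow_left_inj₀ (norm_nonneg _) (by positivity) two_ne_zero).1 ?_
  rw [h]; ring

theorem planeParam_aux_ne_zero (L : E 4 ≃ₗᵢ[ℝ] E 4) (a b : ℝ) :
    L.symm !₂[2 * a, 2 * b, a ^ 2 + b ^ 2 - 1, 0] ≠ 0 := by
  rw [← norm_ne_zero_iff, norm_planeParam_aux]
  positivity

theorem apply_planeParam (L : E 4 ≃ₗᵢ[ℝ] E 4) (a b : ℝ) :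
    L (planeParam L a b) = (a ^ 2 + b ^ 2 + 1)⁻¹ • !₂[2 * a, 2 * b, a ^ 2 + b ^ 2 - 1, 0] := by
  rw [planeParam, coe_normS (planeParam_aux_ne_zero L a b), norm_planeParam_aux, map_smul,
    LinearIsometryEquiv.apply_symm_apply]

theorem contMDiffAt_planeParam (L : E 4 ≃ₗᵢ[ℝ] E 4) {V : Type*} [NormedAddCommGroup V]
    [NormedSpace ℝ V] {a b : V → ℝ} (ha : ContDiff ℝ ∞ a) (hb : ContDiff ℝ ∞ b) (v : V) :
    ContMDiffAt 𝓘(ℝ, V) (𝓡 3) ∞ (fun v => planeParam L (a v) (b v)) v := by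
  refine ContMDiffAt.comp v (contMDiffAt_normS (planeParam_aux_ne_zero L (a v) (b v)))
    (ContDiff.contMDiff ?_).contMDiffAt
  exact L.symm.contDiff.comp (contDiff_vec4 (contDiff_const.mul ha) (contDiff_const.mul hb)
    (((ha.pow 2).add (hb.pow 2)).sub contDiff_const) contDiff_const)

/-- The coordinates inverse to `planeParam`. -/
def planeCoord (L : E 4 ≃ₗᵢ[ℝ] E 4) (x : S3) (i : Fin 4) : ℝ := L x i / (1 - L x 2)

theorem planeCoord_planeParam (L : E 4 ≃ₗᵢ[ℝ] E 4) (a b : ℝ) :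
    L (planeParam L a b) 2 ≠ 1 ∧ planeCoord L (planeParam L a b) 0 = a ∧
      planeCoord L (planeParam L a b) 1 = b := by
  have h : a ^ 2 + b ^ 2 + 1 ≠ 0 := by positivity
  have h2 : 1 - (a ^ 2 + b ^ 2 + 1)⁻¹ * (a ^ 2 + b ^ 2 - 1) = 2 * (a ^ 2 + b ^ 2 + 1)⁻¹ := by
    field_simp; ring
  have h3 : L (planeParam L a b) 2 = (a ^ 2 + b ^ 2 + 1)⁻¹ * (a ^ 2 + b ^ 2 - 1) := by
    rw [apply_planeParam]; rfl
  have h4 : L (planeParam L a b) 0 = (a ^ 2 + b ^ 2 + 1)⁻¹ * (2 * a) := by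
    rw [apply_planeParam]; rfl
  have h5 : L (planeParam L a b) 1 = (a ^ 2 + b ^ 2 + 1)⁻¹ * (2 * b) := by
    rw [apply_planeParam]; rfl
  refine ⟨fun hcon => ?_, ?_, ?_⟩
  · rw [← h3, hcon, sub_self] at h2
    have : 2 * (a ^ 2 + b ^ 2 + 1)⁻¹ ≠ 0 := by positivity
    exact this h2.symm
  · rw [planeCoord, h3, h2, h4]
    field_simp
  · rw [planeCoord, h3, h2, h5]
    field_simp

theorem planeParam_planeCoord (L : E 4 ≃ₗᵢ[ℝ] E 4) (hL : ∀ x, L x 3 = x 3) {x : S3}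
    (hx : x ∈ standardSphere) (hx2 : L x 2 ≠ 1) :
    planeParam L (planeCoord L x 0) (planeCoord L x 1) = x := by
  apply Subtype.ext
  apply L.injective
  rw [apply_planeParam]
  have h1 : 1 - L x 2 ≠ 0 := sub_ne_zero.2 hx2.symm
  have hx3 : L x 3 = 0 := (hL x).trans hx
  have h2 : L x 0 ^ 2 + L x 1 ^ 2 + L x 2 ^ 2 = 1 := by
    have h := EuclideanSpace.norm_sq_eq (L x)
    rw [LinearIsometryEquiv.norm_map, norm_coe] at h
    simp [Fin.sum_univ_four, hx3] at h
    linarith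
  have h3 : planeCoord L x 0 ^ 2 + planeCoord L x 1 ^ 2 + 1 = 2 / (1 - L x 2) := by
    simp only [planeCoord]
    field_simp
    linear_combination h2
  have h4 : planeCoord L x 0 ^ 2 + planeCoord L x 1 ^ 2 - 1 = 2 * (L x 2 / (1 - L x 2)) := by
    have : 2 * (L x 2 / (1 - L x 2)) = 2 / (1 - L x 2) - 2 := by
      field_simp; ring
    rw [this, ← h3]; ring
  have key : ∀ t : ℝ, (2 / (1 - L x 2))⁻¹ * (2 * (t / (1 - L x 2))) = t := fun t => by
    field_simp
  rw [h4, h3]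
  ext i
  fin_cases i
  · exact key _
  · exact key _
  · exact key _
  · change (2 / (1 - L x 2))⁻¹ * 0 = L x 3
    rw [hx3, mul_zero]

theorem contMDiff_isometry_apply (L : E 4 ≃ₗᵢ[ℝ] E 4) (i : Fin 4) :
    ContMDiff (𝓡 3) 𝓘(ℝ, ℝ) ∞ fun x : S3 => L x i :=
  ((EuclideanSpace.proj (𝕜 := ℝ) i).contDiff.comp L.contDiff).contMDiff.comp contMDiff_coe

theorem contMDiffAt_planeCoord (L : E 4 ≃ₗᵢ[ℝ] E 4) {x : S3} (hx : L x 2 ≠ 1) (i : Fin 4) :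
    ContMDiffAt (𝓡 3) 𝓘(ℝ, ℝ) ∞ (fun y => planeCoord L y i) x :=
  ContMDiffAt.div_real (contMDiff_isometry_apply L i x)
    (contMDiffAt_const.sub (contMDiff_isometry_apply L 2 x)) (sub_ne_zero.2 hx.symm)

theorem eq_of_apply_two_eq_one (L : E 4 ≃ₗᵢ[ℝ] E 4) {q x : S3}
    (hq : L q = EuclideanSpace.single 2 1) (hx : L x 2 = 1) : x = q := by
  have h1 : inner ℝ (x : E 4) (q : E 4) = (1 : ℝ) := by
    rw [← L.inner_map_map, hq]
    simp [EuclideanSpace.inner_single_right, hx]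
  exact Subtype.ext ((inner_eq_one_iff_of_norm_eq_one (norm_coe x) (norm_coe q)).1 h1)

/-- The shadow misses a point `q` of the sphere. Stereographic projection from `q` together with the
height identifies the part of the neighbourhood containing the knot with a slab in `ℝ³`. The slab is
convex, so the knot can be moved to standard `ℝ³` by a diagonal map, under which the projection
becomes the planar one. -/
theorem crossingNumber_le_surfaceCrossingNumber (K : Knot) :
    crossingNumber K ≤ surfaceCrossingNumber K standardSphere := by
  refine le_iInf fun N => le_iInf fun Φ => le_iInf fun hΦ => ?_
  set c : Circle → S3 := Φ.final ∘ K.toFun with hc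
  have hcs : SmoothLoop c := Φ.smoothLoop K.smoothLoop
  have hcc : Continuous c := Φ.contMDiff_final.continuous.comp K.smooth.continuous
  obtain ⟨hint, hreg⟩ := hΦ
  have hcar : ∀ z, c z ∈ N.carrier := fun z => interior_subset (hint z)
  have hflat := locallyFlat_standardSphere
  obtain ⟨q, hq, hqγ⟩ := exists_notMem_range (γ := fun t : ℝ => N.proj (c (Circle.exp t)))
    (fun t => (N.contMDiffAt_proj (hcar _)).comp t (hcs t)) hflat standardSphere_nonempty
  have hqc : ∀ z, N.proj (c z) ≠ q := fun z => by
    obtain ⟨t, rfl⟩ := Circle.exp_surjective z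
    exact hqγ t
  obtain ⟨L, hLq, hL3⟩ := exists_linearIsometryEquiv hq
  have hL2 : ∀ z, L (N.proj (c z)) 2 ≠ 1 := fun z h => hqc z (eq_of_apply_two_eq_one L hLq h)
  set S : Set (E 3) := {v | |v 2| < 1} with hS
  have hSo : IsOpen S := isOpen_lt (contDiff_apply3 2).continuous.abs continuous_const
  -- The slab chart: the first two coordinates parametrize the sphere without `q`, the third is the
  -- height.
  set f : E 3 → S3 := fun v => N.inv (planeParam L (v 0) (v 1)) (v 2) with hf
  have hpm : ∀ a b, planeParam L a b ∈ standardSphere := fun a b => by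
    change (planeParam L a b : E 4) 3 = 0
    rw [← hL3, apply_planeParam]
    simp
  have hSI : ∀ v ∈ S, v 2 ∈ Icc (-1 : ℝ) 1 := fun v hv => abs_le.1 (le_of_lt hv)
  have hfs : ContMDiffOn (𝓡 3) (𝓡 3) ∞ f S := fun v hv => by
    refine (N.contMDiffAt_inv ?_ (contMDiffAt_planeParam L (contDiff_apply3 0) (contDiff_apply3 1) v)
      (contDiff_apply3 2).contMDiff.contMDiffAt).contMDiffWithinAt
    filter_upwards [hSo.mem_nhds hv] with w hw using ⟨hpm _ _, hSI w hw⟩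
  set W : Set S3 := N.domain ∩ (fun x => L (N.proj x) 2) ⁻¹' {1}ᶜ with hW
  have hWo : IsOpen W := by
    have h1 : ContinuousOn (fun x => L (N.proj x) 2) N.domain :=
      (contMDiff_isometry_apply L 2).continuous.comp_continuousOn N.smooth_proj.continuousOn
    exact h1.isOpen_inter_preimage N.isOpen_domain isOpen_compl_singleton
  set g : S3 → E 3 := fun x =>
    vec3 (planeCoord L (N.proj x) 0) (planeCoord L (N.proj x) 1) (N.height x) with hg
  have hgs : ContMDiffOn (𝓡 3) (𝓡 3) ∞ g W := fun x hx => by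
    have h1 := N.smooth_proj.contMDiffAt (N.isOpen_domain.mem_nhds hx.1)
    have h2 : ∀ i, ContMDiffAt (𝓡 3) 𝓘(ℝ, ℝ) ∞ (fun y => planeCoord L (N.proj y) i) x := fun i =>
      ContMDiffAt.comp x (contMDiffAt_planeCoord L hx.2 i) h1
    exact (contMDiffAt_vec3 (h2 0) (h2 1) (N.smooth_height.contMDiffAt
      (N.isOpen_domain.mem_nhds hx.1))).contMDiffWithinAt
  have hgf : ∀ v ∈ S, f v ∈ W ∧ g (f v) = v := fun v hv => by
    obtain ⟨h1, h2, h3⟩ := N.inv_spec (hpm (v 0) (v 1)) (hSI v hv)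
    obtain ⟨h4, h5, h6⟩ := planeCoord_planeParam L (v 0) (v 1)
    refine ⟨⟨N.carrier_subset h1, ?_⟩, ext3 ?_ ?_ ?_⟩
    · simp only [mem_preimage, hf, h2, mem_compl_iff, mem_singleton_iff]
      exact h4
    · simp only [hg, hf, h2, vec3_zero, h5]
    · simp only [hg, hf, h2, vec3_one, h6]
    · simp only [hg, hf, h3, vec3_two]
  obtain ⟨ψ, hψS, hψf, -⟩ := exists_partialDiffeomorph_of_leftInverse hSo hWo hfs hgs
    (fun v hv => (hgf v hv).1) (fun v hv => (hgf v hv).2) rfl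
  have hψf' : ∀ v, ψ v = f v := hψf
  obtain ⟨σ, hσu, hσ⟩ := exists_stereoChart
  have hcW : ∀ z, c z ∈ W := fun z => ⟨N.carrier_subset (hcar z), hL2 z⟩
  have hgc : Continuous fun z => g (c z) := by
    refine continuous_iff_continuousAt.2 fun z => ?_
    exact ContinuousAt.comp (f := c) (hgs.contMDiffAt (hWo.mem_nhds (hcW z))).continuousAt
      hcc.continuousAt
  have hgS : ∀ z, g (c z) ∈ S := fun z =>
    RegularNeighborhood.height_lt_of_mem_interior hflat (hint z)
  have hproj : ∀ z, planeParam L (g (c z) 0) (g (c z) 1) = N.proj (c z) := fun z =>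
    planeParam_planeCoord L hL3 (N.proj_mem (hcar z)) (hL2 z)
  have hfg : ∀ z, f (g (c z)) = c z := fun z => by
    change N.inv (planeParam L (g (c z) 0) (g (c z) 1)) (N.height (c z)) = c z
    rw [hproj, N.inv_proj_height (hcar z)]
  obtain ⟨a, Θ, ha, hΘ⟩ := exists_ambientIsotopy_chart_to_chart ψ σ
    (by
      rw [hψS]
      have : S = (EuclideanSpace.proj (𝕜 := ℝ) (2 : Fin 3)).toLinearMap ⁻¹' Ioo (-1) 1 := by
        ext v
        change |v 2| < 1 ↔ -1 < v 2 ∧ v 2 < 1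
        exact abs_lt
      rw [this]
      exact (convex_Ioo (-1) 1).linear_preimage _)
    (by rw [hψS]; simp [hS]) (by rw [hσu]; trivial) (isCompact_range hgc)
    (by rw [hψS]; rintro _ ⟨z, rfl⟩; exact hgS z)
  set y : Circle → E 3 := fun z => WithLp.toLp 2 fun i => a i * g (c z) i with hy
  have hy' : ∀ z, Θ.final (c z) = istereo (y z) := by
    intro z
    have h1 := (hΘ (g (c z)) (mem_range_self z)).2
    rw [hψf', hfg, hσ] at h1
    exact h1
  have hfin : (Φ.trans Θ).final ∘ K.toFun = Θ.final ∘ c := by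
    funext z
    simp only [Function.comp_apply, AmbientIsotopy.trans_final, hc]
  have hsh : ∀ z, planarShadow (Θ.final ∘ c) z = planeProj (y z) := fun z => by
    rw [planarShadow, Function.comp_apply, hy', stereo_istereo]
  have htr := IsRegularCurve.transfer (c₂ := planarShadow (Θ.final ∘ c))
    (g := fun w : E 2 => (planeParam L ((a 0)⁻¹ * w 0) ((a 1)⁻¹ * w 1) : E 4)) hreg ?_ ?_ ?_ ?_
  · refine iInf_le_of_le (Φ.trans Θ) (iInf_le_of_le ⟨fun z => ?_, ?_⟩ ?_)
    · have h1 : (Φ.trans Θ).final (K.toFun z) = istereo (y z) := by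
        rw [← hy']; exact congrFun hfin z
      rw [h1]
      exact istereo_three _
    · rw [hfin]; exact htr.1
    · rw [hfin]; exact htr.2.le
  · intro z
    rw [hsh]
    change (N.proj (c z) : E 4) =
      planeParam L ((a 0)⁻¹ * (a 0 * g (c z) 0)) ((a 1)⁻¹ * (a 1 * g (c z) 1))
    rw [inv_mul_cancel_left₀ (ha 0), inv_mul_cancel_left₀ (ha 1), hproj]
  · intro z
    have h1 : ∀ i : Fin 2, ContDiff ℝ ∞ fun w : E 2 => w i := fun i =>
      (EuclideanSpace.proj (𝕜 := ℝ) i).contDiff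
    exact ((contMDiff_coe.contMDiffAt.comp _ (contMDiffAt_planeParam L
      (contDiff_const.mul (h1 0)) (contDiff_const.mul (h1 1)) _)).contDiffAt).differentiableAt
      (by simp)
  · intro t
    refine (Θ.smoothLoop hcs).differentiableAt_of_contMDiffAt
      (f := fun x => planeProj (stereo x)) t ?_
    refine contDiff_planeProj.contMDiff.contMDiffAt.comp _ (contMDiffAt_stereo ?_)
    rw [Function.comp_apply, hy']
    exact istereo_three _
  · intro z w hzw
    have h1 : N.proj (c z) = N.proj (c w) := Subtype.ext hzw
    rw [hsh, hsh]
    refine planeProj_eq_iff.2 ⟨?_, ?_⟩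
    · change a 0 * planeCoord L (N.proj (c z)) 0 = a 0 * planeCoord L (N.proj (c w)) 0
      rw [h1]
    · change a 1 * planeCoord L (N.proj (c z)) 1 = a 1 * planeCoord L (N.proj (c w)) 1
      rw [h1]

/-! ### Transport of tubes -/

/-- The composition of a chart with a diffeomorphism of the 3-sphere. -/
def Chart.transDiffeo (ψ : Chart) (d : S3 ≃ₘ^∞⟮𝓡 3, 𝓡 3⟯ S3) : Chart where
  toPartialEquiv := ψ.toPartialEquiv.transEquiv d.toEquiv
  open_source := ψ.open_source
  open_target := ψ.open_target.preimage d.symm.continuous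
  contMDiffOn_toFun := d.contMDiff.comp_contMDiffOn ψ.contMDiffOn
  contMDiffOn_invFun := ψ.symm.contMDiffOn.comp d.symm.contMDiff.contMDiffOn fun _ hx => hx

theorem LocallyFlat.image {F : Set S3} (hF : LocallyFlat F) (d : S3 ≃ₘ^∞⟮𝓡 3, 𝓡 3⟯ S3) :
    LocallyFlat (d '' F) := by
  rintro _ ⟨x, hx, rfl⟩
  obtain ⟨ψ, h0, hψx, hψ⟩ := hF x hx
  refine ⟨ψ.transDiffeo d, h0, congrArg d hψx, fun v hv => ?_⟩
  rw [← hψ v hv]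
  exact d.injective.mem_set_image

theorem IsTube.image {F U : Set S3} {f : S3 → ℝ} {r : S3 → S3} (h : IsTube F U f r)
    (d : S3 ≃ₘ^∞⟮𝓡 3, 𝓡 3⟯ S3) :
    IsTube (d '' F) (d.symm ⁻¹' U) (fun x => f (d.symm x)) (fun x => d (r (d.symm x))) where
  isOpen := h.isOpen.preimage d.symm.continuous
  subset := by
    rintro _ ⟨x, hx, rfl⟩
    rw [mem_preimage, d.symm_apply_apply]
    exact h.subset hx
  smooth_f := h.smooth_f.comp d.symm.contMDiff.contMDiffOn fun x hx => hx
  smooth_r := d.contMDiff.comp_contMDiffOn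
    (h.smooth_r.comp d.symm.contMDiff.contMDiffOn fun x hx => hx)
  mapsTo x hx := mem_image_of_mem d (h.mapsTo _ hx)
  eq_self := by
    rintro _ ⟨x, hx, rfl⟩
    rw [d.symm_apply_apply, h.eq_self x hx]
  zero_iff x hx := by
    rw [h.zero_iff _ hx]
    refine ⟨fun hx => ⟨_, hx, d.apply_symm_apply x⟩, ?_⟩
    rintro ⟨y, hy, rfl⟩
    rwa [d.symm_apply_apply]
  adapted := by
    rintro _ ⟨x, hx, rfl⟩
    obtain ⟨ψ, hψ⟩ := h.adapted x hx
    refine ⟨ψ.transDiffeo d, hψ.zero_mem, congrArg d hψ.map_zero, fun v hv => ?_⟩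
    rw [← hψ.apply_eq v hv]
    exact congrArg f (d.symm_apply_apply _)

/-! ### Gluing retractions -/

/-- The retractions `r` and `q` are interpolated linearly in `ℝ⁴`, and the result is projected
radially to the sphere and then by `r` to `F`. Where the cutoff is `1` the outcome is `r (q x) = q
x`, as `q x` already lies on `F`. -/
theorem IsTube.glue {F U : Set S3} {f : S3 → ℝ} {r : S3 → S3} (h : IsTube F U f r) {C A : Set S3}
    (hC : IsCompact C) (hA : IsOpen A) (hCA : C ⊆ A) {q : S3 → S3}
    (hq : ContMDiffOn (𝓡 3) (𝓡 3) ∞ q A) (hqF : ∀ x ∈ A, q x ∈ F) (hqid : ∀ x ∈ F ∩ A, q x = x) :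
    ∃ (U' : Set S3) (r' : S3 → S3) (W : Set S3), IsTube F U' f r' ∧ IsOpen W ∧ C ⊆ W ∧ W ⊆ A ∧
      ∀ x ∈ W, r' x = q x := by
  obtain ⟨χ, hχ, hχ1, hχA, -⟩ := exists_smooth_bump hC hA hCA
  set w : S3 → E 4 := fun x => (r x : E 4) + χ x • ((q x : E 4) - r x) with hw
  have hws : ContMDiffOn (𝓡 3) 𝓘(ℝ, E 4) ∞ w U := by
    intro x hx
    refine ContMDiffAt.contMDiffWithinAt ?_
    have hr : ContMDiffAt (𝓡 3) 𝓘(ℝ, E 4) ∞ (fun x => (r x : E 4)) x :=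
      contMDiff_coe.contMDiffAt.comp x (h.smooth_r.contMDiffAt (h.isOpen.mem_nhds hx))
    by_cases hxs : x ∈ tsupport χ
    · have hqx : ContMDiffAt (𝓡 3) 𝓘(ℝ, E 4) ∞ (fun x => (q x : E 4)) x :=
        contMDiff_coe.contMDiffAt.comp x (hq.contMDiffAt (hA.mem_nhds (hχA hxs)))
      exact hr.add ((hχ x).smul (hqx.sub hr))
    · refine hr.congr_of_eventuallyEq ?_
      filter_upwards [(isClosed_tsupport χ).isOpen_compl.mem_nhds hxs] with y hy
      rw [hw]
      simp only
      rw [image_eq_zero_of_notMem_tsupport hy, zero_smul, add_zero]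
  have hwF : ∀ x ∈ F, w x = x := by
    intro x hx
    have h1 : χ x • ((q x : E 4) - r x) = 0 := by
      by_cases hxA : x ∈ A
      · rw [hqid x ⟨hx, hxA⟩, h.eq_self x hx, sub_self, smul_zero]
      · rw [image_eq_zero_of_notMem_tsupport fun h' => hxA (hχA h'), zero_smul]
    rw [hw]
    simp only
    rw [h1, h.eq_self x hx, add_zero]
  set U₁ : Set S3 := U ∩ w ⁻¹' {0}ᶜ with hU₁
  have hU₁o : IsOpen U₁ := hws.continuousOn.isOpen_inter_preimage h.isOpen isOpen_compl_singleton
  have hns : ContMDiffOn (𝓡 3) (𝓡 3) ∞ (fun x => normS (w x)) U₁ := fun x hx =>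
    (contMDiffAt_normS hx.2).comp_contMDiffWithinAt x ((hws x hx.1).mono inter_subset_left)
  set U₂ : Set S3 := U₁ ∩ (fun x => normS (w x)) ⁻¹' U with hU₂
  have hU₂o : IsOpen U₂ := hns.continuousOn.isOpen_inter_preimage hU₁o h.isOpen
  refine ⟨U₂, fun x => r (normS (w x)), interior {x | χ x = 1} ∩ A, ⟨hU₂o, fun x hx => ?_,
    h.smooth_f.mono fun x hx => hx.1.1, h.smooth_r.comp (hns.mono inter_subset_left) fun x hx => hx.2,
    fun x hx => h.mapsTo _ hx.2, fun x hx => ?_, fun x hx => h.zero_iff x hx.1.1, h.adapted⟩,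
    isOpen_interior.inter hA, ?_, inter_subset_right, ?_⟩
  · refine ⟨⟨h.subset hx, ?_⟩, ?_⟩
    · rw [mem_preimage, hwF x hx]
      exact coe_ne_zero x
    · rw [mem_preimage, hwF x hx, normS_coe]
      exact h.subset hx
  · rw [hwF x hx, normS_coe, h.eq_self x hx]
  · exact subset_inter (subset_interior_iff_mem_nhdsSet.2 hχ1) hCA
  · rintro x ⟨hx1, hxA⟩
    have h1 : χ x = 1 := (interior_subset hx1 : x ∈ {x | χ x = 1})
    have h2 : w x = q x := by
      rw [hw]
      simp only
      rw [h1, one_smul, add_sub_cancel]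
    change r (normS (w x)) = q x
    rw [h2, normS_coe, h.eq_self _ (hqF x hxA)]

/-! ### Diagrams and surfaces that agree near the diagram -/

theorem exists_pos_lt_of_isCompact {X : Type*} [TopologicalSpace X] {D : Set X} (hD : IsCompact D)
    {g : X → ℝ} (hg : ContinuousOn g D) (h : ∀ x ∈ D, 0 < g x) :
    ∃ δ, 0 < δ ∧ δ < 1 ∧ ∀ x ∈ D, δ < g x := by
  obtain ⟨a, ha, hle⟩ := hD.exists_forall_le' hg h
  refine ⟨min (a / 2) (1 / 2), by positivity, ?_, fun x hx => ?_⟩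
  · exact (min_le_right _ _).trans_lt (by norm_num)
  · exact ((min_le_left _ _).trans_lt (half_lt_self ha)).trans_le (hle x hx)

/-- If the diagram lies where the surfaces agree, the tube of `F` can be altered so that its
retraction is `N.proj` near the diagram. Shrinking the knot along the fibres of `N` brings it into
the new neighbourhood without changing its shadow. -/
theorem surfaceCrossingNumber_le_of_agree (K : Knot) {F F' O : Set S3} (hO : IsOpen O)
    (hFO : F ∩ O = F' ∩ O) (hF : IsCompact F) {U : Set S3} {f : S3 → ℝ} {r : S3 → S3}
    (h : IsTube F U f r) (hF' : LocallyFlat F') (N : RegularNeighborhood F') (Φ : AmbientIsotopy)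
    (hN : N.InRegularPosition (Φ.final ∘ K.toFun)) (hsO : ∀ z, N.proj (Φ.final (K.toFun z)) ∈ O) :
    surfaceCrossingNumber K F ≤ (crossings (N.shadow (Φ.final ∘ K.toFun))).encard := by
  set c : Circle → S3 := Φ.final ∘ K.toFun with hc
  have hcs : SmoothLoop c := Φ.smoothLoop K.smoothLoop
  have hcc : Continuous c := Φ.contMDiff_final.continuous.comp K.smooth.continuous
  obtain ⟨hint, hreg⟩ := hN
  have hcar : ∀ z, c z ∈ N.carrier := fun z => interior_subset (hint z)
  have hpc : ContinuousOn N.proj N.carrier := N.smooth_proj.continuousOn.mono N.carrier_subset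
  have hhc : ContinuousOn N.height N.carrier := N.smooth_height.continuousOn.mono N.carrier_subset
  set C : Set S3 := range fun z => N.proj (c z) with hC
  have hCc : IsCompact C := isCompact_range (hpc.comp_continuous hcc hcar)
  have hmem : ∀ x ∈ O, x ∈ F ↔ x ∈ F' := fun x hx => by
    have := congrArg (fun s => x ∈ s) hFO
    simpa only [mem_inter_iff, hx, and_true, eq_iff_iff] using this
  -- On this open set `N.proj` takes values in `F' ∩ O ⊆ F`, and it fixes the points of `F`, which
  -- there belong to `F'`; so it can be glued into the tube of `F`.
  set A : Set S3 := (interior N.carrier ∩ N.proj ⁻¹' O) ∩ O with hA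
  have hAo : IsOpen A :=
    ((hpc.mono interior_subset).isOpen_inter_preimage isOpen_interior hO).inter hO
  have hF'int : ∀ x ∈ F', x ∈ interior N.carrier := fun x hx =>
    RegularNeighborhood.mem_interior_of_height hF' (N.core x hx).1 (by
      rw [(N.core x hx).2.2, abs_zero]; exact one_pos)
  have hCF' : C ⊆ F' := by rintro _ ⟨z, rfl⟩; exact N.proj_mem (hcar z)
  have hCO : C ⊆ O := by rintro _ ⟨z, rfl⟩; exact hsO z
  have hCA : C ⊆ A := fun x hx => ⟨⟨hF'int x (hCF' hx), by
    rw [mem_preimage, (N.core x (hCF' hx)).2.1]; exact hCO hx⟩, hCO hx⟩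
  obtain ⟨U', r', W, hT, hWo, hCW, hWA, hW⟩ := h.glue hCc hAo hCA (q := N.proj)
    (N.smooth_proj.mono fun x hx => N.carrier_subset (interior_subset hx.1.1))
    (fun x hx => (hmem _ hx.1.2).2 (N.proj_mem (interior_subset hx.1.1)))
    fun x hx => (N.core x ((hmem x hx.2.2).1 hx.1)).2.1
  obtain ⟨N₁, hN₁p, hN₁F⟩ := hT.exists_regularNeighborhood hF
  set V : Set S3 := W ∩ interior N₁.carrier with hV
  have hVo : IsOpen V := hWo.inter isOpen_interior
  have hCV : C ⊆ V := fun x hx => ⟨hCW hx, hN₁F ((hmem x (hCO hx)).2 (hCF' hx))⟩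
  -- points over `C` of small height lie in `V`
  set M : Set S3 := N.carrier ∩ N.proj ⁻¹' C with hM
  have hMc : IsCompact M := by
    have h1 := hpc.preimage_isClosed_of_isClosed N.compact.isClosed hCc.isClosed
    exact N.compact.of_isClosed_subset h1 inter_subset_left
  -- A point over `C` of height zero lies in `C`, hence in `V`. On the compact rest the height is
  -- bounded away from zero, so heights below `η` guarantee membership in `V`.
  obtain ⟨η, hη, -, hηV⟩ := exists_pos_lt_of_isCompact (hMc.diff hVo)
    (hhc.abs.mono fun x hx => hx.1.1) fun x hx => by
      refine abs_pos.2 fun h0 => hx.2 (hCV ?_)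
      have h1 : N.proj x ∈ F' := N.proj_mem hx.1.1
      have h2 : N.proj x = x := RegularNeighborhood.eq_of_proj_height (N.core _ h1).1 hx.1.1
        (N.core _ h1).2.1 ((N.core _ h1).2.2.trans h0.symm)
      rw [← h2]
      exact hx.1.2
  -- the knot has heights bounded away from one
  obtain ⟨δ, hδ, -, hδc⟩ := exists_pos_lt_of_isCompact (isCompact_univ (X := Circle))
    (g := fun z => 1 - |N.height (c z)|)
    (continuous_const.sub (hhc.comp_continuous hcc hcar).abs).continuousOn fun z _ => by
      have := RegularNeighborhood.height_lt_of_mem_interior hF' (hint z)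
      linarith
  obtain ⟨S, hS⟩ := RegularNeighborhood.exists_ambientIsotopy_shrink N hF'
    (h₀ := 1 - δ) (by linarith) hη
  have hS' : ∀ z, S.final (c z) ∈ V ∧ N.proj (S.final (c z)) = N.proj (c z) := by
    intro z
    obtain ⟨h1, h2, h3⟩ := hS (c z) (hcar z) (by have := hδc z (mem_univ z); linarith)
    refine ⟨?_, h2⟩
    by_contra hnV
    have := hηV _ ⟨⟨h1, by rw [mem_preimage, h2]; exact mem_range_self z⟩, hnV⟩
    linarith
  have hsh : N₁.shadow (S.final ∘ c) = N.shadow c := by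
    funext z
    rw [RegularNeighborhood.shadow, Function.comp_apply, hN₁p, hW _ (hS' z).1.1, (hS' z).2]
    rfl
  have hfin : (Φ.trans S).final ∘ K.toFun = S.final ∘ c := by
    funext z
    simp only [Function.comp_apply, AmbientIsotopy.trans_final, hc]
  refine iInf_le_of_le N₁ (iInf_le_of_le (Φ.trans S) (iInf_le_of_le ?_ ?_))
  · rw [hfin]
    exact ⟨fun z => (hS' z).1.2, by rw [hsh]; exact hreg⟩
  · rw [hfin, hsh]

/-! ### Pushing a diagram off a point -/

theorem AmbientIsotopy.image_eq_of_mem_iff (Φ : AmbientIsotopy) {F : Set S3}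
    (h : ∀ x, Φ.final x ∈ F ↔ x ∈ F) : Φ.final '' F = F := by
  ext y
  refine ⟨?_, fun hy => ⟨Φ.symm.final y, ?_, Φ.final_symm_final y⟩⟩
  · rintro ⟨x, hx, rfl⟩
    exact (h x).2 hx
  · rw [← h, Φ.final_symm_final]
    exact hy

/-- Arbitrarily close to `p` there is a point `v` of the surface missed by the curve. A cut-off
horizontal translation carries `v` to `p`. It preserves the surface, and its support is chosen away
from `p'`. -/
theorem exists_push {F : Set S3} {p p' : S3} (hF : LocallyFlat F) (hp : p ∈ F) (hpp' : p' ≠ p)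
    {γ : ℝ → S3} (hγ : ContMDiff 𝓘(ℝ, ℝ) (𝓡 3) ∞ γ) :
    ∃ Φ : AmbientIsotopy, Φ.final '' F = F ∧ (∀ t, Φ.final (γ t) ≠ p) ∧ Φ.final p' = p' := by
  obtain ⟨θ, h0, hθp, hθ⟩ := hF p hp
  set O : Set (E 3) := θ.source ∩ θ ⁻¹' {p'}ᶜ with hO
  have hOo : IsOpen O :=
    θ.contMDiffOn.continuousOn.isOpen_inter_preimage θ.open_source isOpen_compl_singleton
  have h0O : (0 : E 3) ∈ O := ⟨h0, by rw [mem_preimage, hθp]; exact hpp'.symm⟩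
  obtain ⟨ε, hε, hεO⟩ := Metric.isOpen_iff.1 hOo 0 h0O
  obtain ⟨β, Q, hβ, hQ, hQO, hβ0, -, hβ1⟩ := exists_cutoff
    (isCompact_closedBall (0 : E 3) (ε / 2)) hOo
    ((closedBall_subset_ball (by linarith)).trans hεO)
  obtain ⟨k, hk⟩ := exists_lipschitzWith_of_hasCompactSupport hβ (hasCompactSupport_of_zero hQ hβ0)
  -- The first bound puts `v` where the cutoff is `1`; the second makes the translation field
  -- contracting.
  have hr : 0 < min (ε / 2) (1 / (k + 1 : ℝ)) := by positivity
  obtain ⟨v, hv, hv2, hvγ⟩ := exists_notMem_curve θ hγ (ball_mem_nhds (0 : E 3) hr)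
  rw [mem_ball_zero_iff, lt_min_iff] at hv
  have hvO : v ∈ O := hεO (by rw [mem_ball_zero_iff]; linarith)
  have hlip : LipschitzWith (k * ‖v‖₊) fun y => β y • (-v) := by
    refine LipschitzWith.of_dist_le_mul fun x y => ?_
    rw [dist_eq_norm, ← sub_smul, norm_smul, norm_neg]
    have h1 := hk.dist_le_mul x y
    rw [Real.dist_eq] at h1
    rw [Real.norm_eq_abs]
    calc |β x - β y| * ‖v‖ ≤ (k * dist x y) * ‖v‖ := by gcongr
      _ = ((k * ‖v‖₊ : NNReal) : ℝ) * dist x y := by push_cast; ring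
  have hk1 : k * ‖v‖₊ < 1 := by
    rw [← NNReal.coe_lt_coe]
    push_cast
    have h1 := hv.2
    rw [lt_div_iff₀ (by positivity)] at h1
    nlinarith [norm_nonneg v, k.coe_nonneg]
  obtain ⟨Φ, hΦ, hΦid⟩ := exists_ambientIsotopy_id_add θ hQ (fun y hy => (hQO hy).1)
    (g := fun y => β y • (-v)) (hβ.smul contDiff_const)
    (fun y hy => by simp only [hβ0 y hy, zero_smul]) hk1 hlip
  refine ⟨Φ, Φ.image_eq_of_mem_iff fun x => ?_, fun t ht => ?_, hΦid _ ?_⟩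
  · by_cases hx : x ∈ θ '' Q
    · obtain ⟨y, hy, rfl⟩ := hx
      have hys := (hQO hy).1
      rw [(hΦ y hys).2, hθ _ (hΦ y hys).1, hθ y hys]
      simp [hv2]
    · rw [hΦid x hx]
  · refine hvγ hvO.1 t (Φ.injective_final ?_)
    rw [ht, (hΦ v hvO.1).2, hβ1 v (by rw [mem_closedBall_zero_iff]; exact hv.1.le), one_smul,
      add_neg_cancel, hθp]
  · rintro ⟨y, hy, hyp⟩
    exact (hQO hy).2 hyp

/-- The neighbourhood and the knot are transported together by the push, which maps `F` to itself.
The last clause allows a second push without losing what the first one achieved. -/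
theorem RegularNeighborhood.exists_avoiding {F : Set S3} (hF : LocallyFlat F)
    (N : RegularNeighborhood F) {c : Circle → S3} (hc : SmoothLoop c) (hN : N.InRegularPosition c)
    {p p' : S3} (hp : p ∈ F) (hpp' : p' ≠ p) :
    ∃ (Φ : AmbientIsotopy) (N' : RegularNeighborhood F), N'.InRegularPosition (Φ.final ∘ c) ∧
      (crossings (N'.shadow (Φ.final ∘ c))).encard = (crossings (N.shadow c)).encard ∧
      (∀ z, N'.proj (Φ.final (c z)) ≠ p) ∧
      ((∀ z, N.proj (c z) ≠ p') → ∀ z, N'.proj (Φ.final (c z)) ≠ p') := by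
  have hcar : ∀ z, c z ∈ N.carrier := fun z => interior_subset (hN.1 z)
  obtain ⟨Φ, hΦF, hΦp, hΦp'⟩ := exists_push hF hp hpp'
    (γ := fun t : ℝ => N.proj (c (Circle.exp t)))
    (fun t => (N.contMDiffAt_proj (hcar _)).comp t (hc t))
  have hproj : ∀ x, (N.map Φ.diffeo).proj (Φ.final x) = Φ.final (N.proj x) := fun x => by
    simp only [map, Function.comp_apply, AmbientIsotopy.final_eq, Diffeomorph.symm_apply_apply]
  obtain ⟨h1, h2⟩ := N.map_inRegularPosition (Φ := Φ) hc hN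
  have key : ∀ (F₂ : Set S3) (N₂ : RegularNeighborhood F₂), F₂ = F →
      ∃ N' : RegularNeighborhood F, N'.proj = N₂.proj ∧ N'.carrier = N₂.carrier := by
    rintro F₂ N₂ rfl
    exact ⟨N₂, rfl, rfl⟩
  obtain ⟨N', hp1, hp2⟩ := key _ (N.map Φ.diffeo) hΦF
  have hsh : N'.shadow (Φ.final ∘ c) = (N.map Φ.diffeo).shadow (Φ.final ∘ c) := by
    funext z
    rw [shadow, shadow, hp1]
  refine ⟨Φ, N', ⟨by rw [hp2]; exact h1.1, by rw [hsh]; exact h1.2⟩, by rw [hsh, h2],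
    fun z => ?_, fun h z => ?_⟩
  · obtain ⟨t, rfl⟩ := Circle.exp_surjective z
    rw [hp1, hproj]
    exact hΦp t
  · rw [hp1, hproj, ← hΦp']
    exact fun h' => h z (Φ.injective_final h')

/-! ### The profile of the surgery -/

theorem contDiff_capProfile : ContDiff ℝ ∞ capProfile :=
  (contDiff_const.mul (Real.smoothTransition.contDiff.comp (contDiff_id.pow 2))).sub contDiff_const

theorem capProfile_le_one (t : ℝ) : capProfile t ≤ 1 := by
  have := Real.smoothTransition.le_one (t ^ 2)
  rw [capProfile]; linarith

theorem capProfile_eq_one {t : ℝ} (ht : 1 ≤ |t|) : capProfile t = 1 := by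
  have h : 1 ≤ t ^ 2 := by rw [← sq_abs]; nlinarith
  rw [capProfile, Real.smoothTransition.one_of_one_le h]; norm_num

theorem smoothTransition_eq_half_iff (x : ℝ) : Real.smoothTransition x = 1 / 2 ↔ x = 1 / 2 := by
  have hpos := Real.smoothTransition.pos_denom x
  have h1 : Real.smoothTransition x = 1 / 2 ↔ expNegInvGlue x = expNegInvGlue (1 - x) := by
    rw [Real.smoothTransition, div_eq_iff hpos.ne']
    constructor <;> intro h <;> linarith
  rw [h1]
  constructor
  · intro h
    rcases le_or_gt x 0 with hx | hx
    · rw [expNegInvGlue.zero_of_nonpos hx] at h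
      exact absurd h (expNegInvGlue.pos_of_pos (by linarith)).ne
    rcases le_or_gt 1 x with hx1 | hx1
    · rw [expNegInvGlue.zero_of_nonpos (x := 1 - x) (by linarith)] at h
      exact absurd h (expNegInvGlue.pos_of_pos hx).ne'
    · rw [expNegInvGlue, expNegInvGlue, if_neg (by linarith), if_neg (by linarith)] at h
      have h2 := inv_injective (neg_injective (Real.exp_injective h))
      linarith
  · rintro rfl
    norm_num

theorem capProfile_eq_zero_iff (t : ℝ) : capProfile t = 0 ↔ t ^ 2 = 1 / 2 := by
  rw [← smoothTransition_eq_half_iff, capProfile]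
  constructor <;> intro h <;> linarith

/-- A positive smooth function that is the identity on `[δ, ∞)` and at most `δ` on `(-∞, δ]`. -/
def truncate (δ s : ℝ) : ℝ :=
  δ / 2 + Real.smoothTransition ((s - δ / 2) / (δ / 2)) * (s - δ / 2)

theorem contDiff_truncate (δ : ℝ) : ContDiff ℝ ∞ (truncate δ) :=
  contDiff_const.add ((Real.smoothTransition.contDiff.comp
    ((contDiff_id.sub contDiff_const).div_const _)).mul (contDiff_id.sub contDiff_const))

theorem truncate_of_le {δ s : ℝ} (hδ : 0 < δ) (hs : δ ≤ s) : truncate δ s = s := by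
  rw [truncate, Real.smoothTransition.one_of_one_le]
  · ring
  · rw [le_div_iff₀ (by positivity)]; linarith

theorem truncate_pos {δ : ℝ} (hδ : 0 < δ) (s : ℝ) : 0 < truncate δ s := by
  rw [truncate]
  rcases le_or_gt s (δ / 2) with h | h
  · rw [Real.smoothTransition.zero_of_nonpos (div_nonpos_of_nonpos_of_nonneg (by linarith)
      (by positivity))]
    simpa using hδ
  · have := mul_nonneg (Real.smoothTransition.nonneg ((s - δ / 2) / (δ / 2)))
      (sub_nonneg.2 h.le)
    linarith

theorem truncate_le {δ s : ℝ} (hδ : 0 < δ) (hs : s ≤ δ) : truncate δ s ≤ δ := by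
  rw [truncate]
  rcases le_or_gt s (δ / 2) with h | h
  · rw [Real.smoothTransition.zero_of_nonpos (div_nonpos_of_nonpos_of_nonneg (by linarith)
      (by positivity))]
    linarith
  · have := mul_le_mul_of_nonneg_right (Real.smoothTransition.le_one ((s - δ / 2) / (δ / 2)))
      (sub_nonneg.2 h.le)
    linarith

/-! ### Squeezing a cylinder -/

theorem isOpen_box : IsOpen box := by
  have h := fun i => (contDiff_apply3 i).continuous
  exact (isOpen_lt (((h 0).pow 2).add ((h 1).pow 2)) continuous_const).inter
    (isOpen_lt (h 2).abs continuous_const)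

theorem isCompact_cylinder (a : ℝ) (hC : IsClosed {x : E 3 | a ≤ x 0 ^ 2 + x 1 ^ 2}) :
    IsCompact {x : E 3 | a ≤ x 0 ^ 2 + x 1 ^ 2 ∧ x 0 ^ 2 + x 1 ^ 2 ≤ 1 ∧ |x 2| ≤ 1} := by
  have h := fun i => (contDiff_apply3 i).continuous
  refine Metric.isCompact_of_isClosed_isBounded (hC.inter ((isClosed_le
    (((h 0).pow 2).add ((h 1).pow 2)) continuous_const).inter
    (isClosed_le (h 2).abs continuous_const))) ?_
  refine (isBounded_closedBall (x := (0 : E 3)) (r := 2)).subset fun x hx => ?_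
  obtain ⟨-, h1, h2⟩ := hx
  rw [mem_closedBall_zero_iff]
  refine abs_le_of_sq_le_sq' ?_ (by norm_num) |>.2
  rw [EuclideanSpace.norm_sq_eq]
  simp only [Fin.sum_univ_three, Real.norm_eq_abs, sq_abs]
  have h3 : x 2 ^ 2 ≤ 1 := by rw [← sq_abs]; nlinarith [abs_nonneg (x 2)]
  linarith

/-- The perturbation points towards the axis and has length `(1 - κ) / n` at each level,
independently of the current radius `s`. The number `n` of steps is chosen larger than the Lipschitz
constant of the undivided field. -/
theorem exists_squeeze_step (ψ : Chart) (hψ : ψ.source = box) {κ : ℝ → ℝ} (hκ : ContDiff ℝ ∞ κ)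
    (hpos : ∀ t, 0 < κ t) (hone : ∀ t, 1 ≤ |t| → κ t = 1) :
    ∃ (Φ : AmbientIsotopy) (n : ℕ), (0 : ℝ) < n ∧ (∀ (x : E 3) (s : ℝ), x 0 ^ 2 + x 1 ^ 2 = 1 →
      |x 2| < 2 → s ≤ 1 → κ (x 2) ≤ s → Φ.final (ψ (vec3 (s * x 0) (s * x 1) (x 2))) =
        ψ (vec3 ((s - (1 - κ (x 2)) / n) * x 0) ((s - (1 - κ (x 2)) / n) * x 1) (x 2))) ∧
      ∀ y ∉ ψ.target, Φ.final y = y := by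
  have hcont := fun i => (contDiff_apply3 i).continuous
  -- The circles being moved keep radius at least `δ`, so the radial field may be cut off near the
  -- axis, where it is singular. At levels beyond `1` nothing moves, because `κ = 1`.
  obtain ⟨δ, hδ, -, hδκ⟩ := exists_pos_lt_of_isCompact (isCompact_Icc (a := (-1 : ℝ)) (b := 1))
    hκ.continuous.continuousOn fun t _ => hpos t
  have hRc : Continuous fun x : E 3 => x 0 ^ 2 + x 1 ^ 2 := ((hcont 0).pow 2).add ((hcont 1).pow 2)
  set O : Set (E 3) := box ∩ {x | 0 < x 0 ^ 2 + x 1 ^ 2} with hO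
  have hOo : IsOpen O := isOpen_box.inter (isOpen_lt continuous_const hRc)
  have hDO : {x : E 3 | δ ^ 2 ≤ x 0 ^ 2 + x 1 ^ 2 ∧ x 0 ^ 2 + x 1 ^ 2 ≤ 1 ∧ |x 2| ≤ 1} ⊆ O := by
    rintro x ⟨h1, h2, h3⟩
    exact ⟨⟨by linarith, by linarith⟩, lt_of_lt_of_le (by positivity) h1⟩
  obtain ⟨β, Q, hβ, hQ, hQO, hβ0, -, hβ1⟩ := exists_cutoff
    (isCompact_cylinder (δ ^ 2) (isClosed_le continuous_const hRc)) hOo hDO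
  set g₁ : E 3 → E 3 := fun x =>
    (β x * (1 - κ (x 2)) * (√(x 0 ^ 2 + x 1 ^ 2))⁻¹) • flat x with hg₁
  have hg₁0 : ∀ x ∉ Q, g₁ x = 0 := fun x hx => by
    simp only [hg₁, hβ0 x hx, zero_mul, zero_smul]
  have hg₁s : ContDiff ℝ ∞ g₁ := by
    refine contDiff_iff_contDiffAt.2 fun x => ?_
    by_cases hx : x ∈ Q
    · have hR : x 0 ^ 2 + x 1 ^ 2 ≠ 0 := (hQO hx).2.ne'
      have h1 : ContDiffAt ℝ ∞ (fun x : E 3 => √(x 0 ^ 2 + x 1 ^ 2)) x :=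
        ((((contDiff_apply3 0).pow 2).add ((contDiff_apply3 1).pow 2)).contDiffAt).sqrt hR
      exact ((hβ.contDiffAt.mul (contDiffAt_const.sub
        (hκ.contDiffAt.comp x (contDiff_apply3 2).contDiffAt))).mul
        (h1.inv (Real.sqrt_ne_zero'.2 (hQO hx).2))).smul contDiff_flat.contDiffAt
    · refine (contDiffAt_const (c := (0 : E 3))).congr_of_eventuallyEq ?_
      filter_upwards [hQ.isClosed.isOpen_compl.mem_nhds hx] with y hy using hg₁0 y hy
  obtain ⟨k, hk⟩ := exists_lipschitzWith_of_hasCompactSupport hg₁s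
    (hasCompactSupport_of_zero hQ hg₁0)
  obtain ⟨n, hn⟩ := exists_nat_gt (k : ℝ)
  have hn0 : (0 : ℝ) < n := k.coe_nonneg.trans_lt hn
  have hgs : ContDiff ℝ ∞ fun x => (-(n : ℝ)⁻¹) • g₁ x := hg₁s.const_smul _
  have hlip : LipschitzWith (‖-(n : ℝ)⁻¹‖₊ * k) fun x => (-(n : ℝ)⁻¹) • g₁ x :=
    (lipschitzWith_smul (-(n : ℝ)⁻¹)).comp hk
  have hk1 : ‖-(n : ℝ)⁻¹‖₊ * k < 1 := by
    rw [← NNReal.coe_lt_coe]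
    push_cast
    rw [norm_neg, norm_inv, Real.norm_of_nonneg hn0.le, inv_mul_lt_iff₀ hn0, mul_one]
    exact hn
  obtain ⟨Φ, hΦ, hΦid⟩ := exists_ambientIsotopy_id_add ψ hQ
    (fun y hy => by rw [hψ]; exact (hQO hy).1) hgs
    (fun y hy => by simp only [hg₁0 y hy, smul_zero]) hk1 hlip
  refine ⟨Φ, n, hn0, fun x s hx hx2 hs1 hκs => ?_, fun y hy => hΦid y ?_⟩
  · have hs0 : 0 < s := (hpos _).trans_le hκs
    have hsδ : |x 2| ≤ 1 → δ ≤ s := fun h => (hδκ (x 2) (abs_le.1 h)).le.trans hκs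
    have hR : (s * x 0) ^ 2 + (s * x 1) ^ 2 = s ^ 2 := by
      rw [mul_pow, mul_pow, ← mul_add, hx, mul_one]
    have hmem : vec3 (s * x 0) (s * x 1) (x 2) ∈ ψ.source := by
      rw [hψ]
      refine ⟨?_, hx2⟩
      simp only [vec3_zero, vec3_one, hR]
      nlinarith
    rw [(hΦ _ hmem).2]
    congr 1
    have hcoef : β (vec3 (s * x 0) (s * x 1) (x 2)) * (1 - κ (x 2)) = 1 - κ (x 2) := by
      rcases le_or_gt (|x 2|) 1 with h | h
      · rw [hβ1, one_mul]
        refine ⟨?_, ?_, h⟩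
        · simp only [vec3_zero, vec3_one, hR]
          exact pow_le_pow_left₀ hδ.le (hsδ h) 2
        · simp only [vec3_zero, vec3_one, hR]
          nlinarith
      · rw [hone _ h.le, sub_self, mul_zero]
    have hval : g₁ (vec3 (s * x 0) (s * x 1) (x 2)) =
        ((1 - κ (x 2)) * s⁻¹) • vec3 (s * x 0) (s * x 1) 0 := by
      simp only [hg₁, vec3_zero, vec3_one, vec3_two, hR, hcoef, Real.sqrt_sq hs0.le]
      rfl
    rw [hval]
    refine ext3 ?_ ?_ ?_
    · change s * x 0 + -(n : ℝ)⁻¹ * ((1 - κ (x 2)) * s⁻¹ * (s * x 0)) = (s - (1 - κ (x 2)) / n) * x 0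
      field_simp
      ring
    · change s * x 1 + -(n : ℝ)⁻¹ * ((1 - κ (x 2)) * s⁻¹ * (s * x 1)) = (s - (1 - κ (x 2)) / n) * x 1
      field_simp
      ring
    · change x 2 + -(n : ℝ)⁻¹ * ((1 - κ (x 2)) * s⁻¹ * 0) = x 2
      ring
  · rintro ⟨w, hw, rfl⟩
    exact hy (ψ.map_source (by rw [hψ]; exact (hQO hw).1))

/-- The isotopy that moves the circle of radius `1` at level `t` to the one of radius `κ t`. -/
theorem exists_squeeze (ψ : Chart) (hψ : ψ.source = box) {κ : ℝ → ℝ} (hκ : ContDiff ℝ ∞ κ)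
    (hpos : ∀ t, 0 < κ t) (hle : ∀ t, κ t ≤ 1) (hone : ∀ t, 1 ≤ |t| → κ t = 1) :
    ∃ Θ : AmbientIsotopy, (∀ x, x 0 ^ 2 + x 1 ^ 2 = 1 → |x 2| < 2 →
      Θ.final (ψ x) = ψ (vec3 (κ (x 2) * x 0) (κ (x 2) * x 1) (x 2))) ∧
      ∀ y ∉ ψ.target, Θ.final y = y := by
  obtain ⟨Φ, n, hn0, hstep, hΦid⟩ := exists_squeeze_step ψ hψ hκ hpos hone
  -- All steps have equal length, so the radius after `j` of them is `1 - j (1 - κ) / n`, which lies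
  -- between `κ` and `1`.
  have hind : ∀ j : ℕ, j ≤ n → ∃ Θ : AmbientIsotopy,
      (∀ x, x 0 ^ 2 + x 1 ^ 2 = 1 → |x 2| < 2 → Θ.final (ψ x) =
        ψ (vec3 ((1 - j * ((1 - κ (x 2)) / n)) * x 0) ((1 - j * ((1 - κ (x 2)) / n)) * x 1) (x 2))) ∧
      ∀ y ∉ ψ.target, Θ.final y = y := by
    intro j
    induction j with
    | zero =>
      intro _
      refine ⟨AmbientIsotopy.refl, fun x _ _ => ?_, fun y _ => rfl⟩
      simp only [Nat.cast_zero, zero_mul, sub_zero, one_mul, vec3_eta]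
      rfl
    | succ j ih =>
      intro hj
      obtain ⟨Θ, h1, h2⟩ := ih (by omega)
      refine ⟨Θ.trans Φ, fun x hx hx2 => ?_, fun y hy => ?_⟩
      · have hjn : (j : ℝ) ≤ n := by exact_mod_cast (by omega : j ≤ n)
        have hκ1 : 0 ≤ 1 - κ (x 2) := sub_nonneg.2 (hle _)
        have hfrac : 0 ≤ (j : ℝ) * ((1 - κ (x 2)) / n) := by positivity
        have hfrac' : (j : ℝ) * ((1 - κ (x 2)) / n) ≤ 1 - κ (x 2) := by
          rw [← mul_div_assoc, div_le_iff₀ hn0, mul_comm]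
          exact mul_le_mul_of_nonneg_left hjn hκ1
        rw [AmbientIsotopy.trans_final, h1 x hx hx2, hstep x _ hx hx2 (by linarith) (by linarith)]
        have : 1 - (j : ℝ) * ((1 - κ (x 2)) / n) - (1 - κ (x 2)) / n =
            1 - ((j + 1 : ℕ) : ℝ) * ((1 - κ (x 2)) / n) := by push_cast; ring
        rw [this]
      · rw [AmbientIsotopy.trans_final, h2 y hy]
        exact hΦid y hy
  obtain ⟨Θ, h1, h2⟩ := hind n le_rfl
  refine ⟨Θ, fun x hx hx2 => ?_, h2⟩
  rw [h1 x hx hx2]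
  have : 1 - (n : ℝ) * ((1 - κ (x 2)) / n) = κ (x 2) := by
    field_simp; ring
  rw [this]

/-! ### Compressions -/

section Compression

variable {F : Set S3} {φ : E 3 → S3}

theorem IsCompressingDisk.mem_iff (h : IsCompressingDisk F φ) {x : E 3} (hx : x ∈ box) :
    φ x ∈ F ↔ x 0 ^ 2 + x 1 ^ 2 = 1 := by
  constructor
  · intro hF
    have h1 : φ x ∈ F ∩ φ '' box := ⟨hF, mem_image_of_mem φ hx⟩
    rw [h.inter_eq] at h1
    obtain ⟨y, ⟨hy, hy1⟩, hyx⟩ := h1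
    rwa [← h.injOn hy hx hyx]
  · intro hR
    have h1 : φ x ∈ F ∩ φ '' box := by
      rw [h.inter_eq]
      exact mem_image_of_mem φ ⟨hx, hR⟩
    exact h1.1

theorem IsCompressingDisk.mem_surgery_iff (h : IsCompressingDisk F φ) {x : E 3} (hx : x ∈ box) :
    φ x ∈ surgery F φ ↔ x 0 ^ 2 + x 1 ^ 2 = capProfile (x 2) := by
  constructor
  · rintro (h1 | ⟨y, ⟨hy, hy1⟩, hyx⟩)
    · exact absurd (mem_image_of_mem φ hx) h1.2
    · rwa [← h.injOn hy hx hyx]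
  · exact fun hR => Or.inr (mem_image_of_mem φ ⟨hx, hR⟩)

theorem mem_surgery_iff_of_notMem {y : S3} (hy : y ∉ φ '' box) : y ∈ surgery F φ ↔ y ∈ F := by
  constructor
  · rintro (h1 | h1)
    · exact h1.1
    · exact absurd (image_mono (fun x hx => hx.1) h1) hy
  · exact fun h => Or.inl ⟨h, hy⟩

theorem IsCompressingDisk.exists_chart (h : IsCompressingDisk F φ) :
    ∃ ψ : Chart, ψ.source = box ∧ ψ.target = φ '' box ∧ ∀ x, ψ x = φ x := by
  obtain ⟨ψ, h1, h2, h3⟩ := exists_partialDiffeomorph isOpen_box h.injOn fun x hx =>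
    isLocalDiffeomorphAt_of_injective_mfderiv isOpen_box h.smooth hx rfl (h.immersion x hx)
  exact ⟨ψ, h1, h3, h2⟩

/-- Squeezing the cylinder makes the surface agree with the result of the surgery away from a
thin solid cylinder. -/
theorem IsCompressingDisk.exists_squeeze (h : IsCompressingDisk F φ) {δ : ℝ} (hδ : 0 < δ)
    (hδ1 : δ < 1) : ∃ Θ : AmbientIsotopy, ∀ y : S3,
      (∀ x ∈ box, φ x = y → δ < x 0 ^ 2 + x 1 ^ 2 ∨ 1 < |x 2|) →
      (y ∈ Θ.final '' F ↔ y ∈ surgery F φ) := by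
  obtain ⟨ψ, hψs, hψt, hψ⟩ := h.exists_chart
  -- The cap profile becomes nonpositive, so it is not a squared radius throughout. Truncation keeps
  -- it positive and changes it only at values below `δ`, that is, inside the excluded thin
  -- cylinder.
  set κ : ℝ → ℝ := fun t => √(truncate δ (capProfile t)) with hκ
  have htp : ∀ t, 0 < truncate δ (capProfile t) := fun t => truncate_pos hδ _
  have hκsq : ∀ t, κ t ^ 2 = truncate δ (capProfile t) := fun t => Real.sq_sqrt (htp t).le
  have hκpos : ∀ t, 0 < κ t := fun t => Real.sqrt_pos.2 (htp t)
  have hone : truncate δ 1 = 1 := truncate_of_le hδ hδ1.le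
  have hκ1 : ∀ t, 1 ≤ |t| → κ t = 1 := fun t ht => by
    simp only [hκ, capProfile_eq_one ht, hone, Real.sqrt_one]
  have hκle : ∀ t, κ t ≤ 1 := fun t => by
    rw [hκ]
    refine Real.sqrt_le_one.2 ?_
    rcases le_total (capProfile t) δ with h1 | h1
    · exact (truncate_le hδ h1).trans hδ1.le
    · rw [truncate_of_le hδ h1]; exact capProfile_le_one t
  obtain ⟨Θ, hΘ, hΘid⟩ := SurfaceCrossing.exists_squeeze ψ hψs
    (((contDiff_truncate δ).comp contDiff_capProfile).sqrt fun t => (htp t).ne') hκpos hκle hκ1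
  refine ⟨Θ, fun y hy => ?_⟩
  by_cases hyt : y ∈ φ '' box
  · obtain ⟨x, hx, rfl⟩ := hyt
    have hmem : φ x ∈ Θ.final '' F ↔ x 0 ^ 2 + x 1 ^ 2 = truncate δ (capProfile (x 2)) := by
      rw [← hκsq]
      constructor
      · rintro ⟨z, hzF, hz⟩
        by_cases hzt : z ∈ ψ.target
        · rw [hψt] at hzt
          obtain ⟨w, hw, rfl⟩ := hzt
          have hwR := (h.mem_iff hw).1 hzF
          have h1 := hΘ w hwR hw.2
          rw [hψ, hψ, hz] at h1
          have h2 : vec3 (κ (w 2) * w 0) (κ (w 2) * w 1) (w 2) ∈ box := by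
            refine ⟨?_, hw.2⟩
            simp only [vec3_zero, vec3_one, mul_pow, ← mul_add, hwR, mul_one]
            nlinarith [hκpos (w 2), hκle (w 2)]
          rw [h.injOn hx h2 h1]
          simp only [vec3_zero, vec3_one, vec3_two, mul_pow, ← mul_add, hwR, mul_one]
        · rw [hΘid z hzt] at hz
          rw [hz, hψt] at hzt
          exact absurd (mem_image_of_mem φ hx) hzt
      · intro hR
        have hk := (hκpos (x 2)).ne'
        set w : E 3 := vec3 ((κ (x 2))⁻¹ * x 0) ((κ (x 2))⁻¹ * x 1) (x 2) with hw
        have hwR : w 0 ^ 2 + w 1 ^ 2 = 1 := by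
          simp only [hw, vec3_zero, vec3_one, mul_pow, ← mul_add, hR, inv_pow]
          exact inv_mul_cancel₀ (pow_ne_zero 2 hk)
        have hwb : w ∈ box := ⟨by rw [hwR]; norm_num, hx.2⟩
        refine ⟨φ w, (h.mem_iff hwb).2 hwR, ?_⟩
        rw [← hψ, hΘ w hwR hwb.2, hψ]
        congr 1
        refine ext3 ?_ ?_ rfl
        · change κ (x 2) * ((κ (x 2))⁻¹ * x 0) = x 0
          rw [mul_inv_cancel_left₀ hk]
        · change κ (x 2) * ((κ (x 2))⁻¹ * x 1) = x 1
          rw [mul_inv_cancel_left₀ hk]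
    rw [hmem, h.mem_surgery_iff hx]
    -- If the squared radius exceeds `δ`, either equation forces the profile above `δ`, where
    -- truncation does nothing. At levels beyond `1` both surfaces are the original cylinder.
    rcases hy x hx rfl with h1 | h1
    · constructor
      · intro hR
        have h2 : δ < capProfile (x 2) := by
          by_contra! hcon
          have := truncate_le hδ hcon
          linarith
        rwa [truncate_of_le hδ h2.le] at hR
      · intro hR
        rw [truncate_of_le hδ (by linarith), hR]
    · rw [capProfile_eq_one h1.le, hone]
  · rw [mem_surgery_iff_of_notMem hyt]
    have hyt' : y ∉ ψ.target := by rwa [hψt]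
    refine ⟨?_, fun hyF => ⟨y, hyF, hΘid y hyt'⟩⟩
    rintro ⟨z, hz, hzy⟩
    have : z = y := Θ.injective_final (hzy.trans (hΘid y hyt').symm)
    rwa [← this]

/-- The caps are the only obstacle to viewing a diagram on the surgered surface as one on `F`. Once
the diagram misses their centres, each cap matters only outside a small disk, and that part is
shared with a squeezed copy of `F`. -/
theorem IsCompressingDisk.surfaceCrossingNumber_le (K : Knot) (hF : IsClosedSurface F)
    (h : IsCompressingDisk F φ) (hflat : LocallyFlat (surgery F φ)) :
    surfaceCrossingNumber K F ≤ surfaceCrossingNumber K (surgery F φ) := by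
  refine le_iInf fun N => le_iInf fun Φ => le_iInf fun hN => ?_
  -- the centers of the two parallel disks
  set s : ℝ := √(1 / 2) with hs
  have hs2 : s ^ 2 = 1 / 2 := Real.sq_sqrt (by norm_num)
  have hs0 : 0 < s := Real.sqrt_pos.2 (by norm_num)
  have hs1 : |s| < 2 := by rw [abs_of_pos hs0]; nlinarith
  have hbox : ∀ t : ℝ, |t| < 2 → vec3 0 0 t ∈ box := fun t ht => ⟨by
    simp only [vec3_zero, vec3_one]; norm_num, ht⟩
  have hp : ∀ t : ℝ, |t| < 2 → t ^ 2 = 1 / 2 → φ (vec3 0 0 t) ∈ surgery F φ := fun t ht ht2 => by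
    rw [h.mem_surgery_iff (hbox t ht)]
    simp only [vec3_zero, vec3_one, vec3_two, (capProfile_eq_zero_iff t).2 ht2]
    norm_num
  have hs1' : |-s| < 2 := by rwa [abs_neg]
  have hne : φ (vec3 0 0 (-s)) ≠ φ (vec3 0 0 s) := fun heq => by
    have h1 := congrArg (fun v : E 3 => v 2) (h.injOn (hbox _ hs1') (hbox _ hs1) heq)
    simp only [vec3_two] at h1
    linarith
  obtain ⟨Φ₁, N₁, hN₁, hcr₁, hav₁, -⟩ := N.exists_avoiding hflat
    (Φ.smoothLoop K.smoothLoop) hN (hp s hs1 hs2) hne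
  -- The roles of the two centres are exchanged; the second push fixes the centre treated first.
  obtain ⟨Φ₂, N₂, hN₂, hcr₂, hav₂, hav₂'⟩ := N₁.exists_avoiding hflat
    (Φ₁.smoothLoop (Φ.smoothLoop K.smoothLoop)) hN₁ (hp (-s) hs1' (by rw [neg_sq, hs2])) hne.symm
  have hfin : ((Φ.trans Φ₁).trans Φ₂).final ∘ K.toFun = Φ₂.final ∘ Φ₁.final ∘ Φ.final ∘ K.toFun := by
    funext z
    simp only [Function.comp_apply, AmbientIsotopy.trans_final]
  set c : Circle → S3 := Φ₂.final ∘ Φ₁.final ∘ Φ.final ∘ K.toFun with hc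
  have hcc : Continuous c := (Φ₂.contMDiff_final.continuous.comp
    (Φ₁.contMDiff_final.continuous.comp Φ.contMDiff_final.continuous)).comp K.smooth.continuous
  have hcar : ∀ z, c z ∈ N₂.carrier := fun z => interior_subset (hN₂.1 z)
  set C : Set S3 := range fun z => N₂.proj (c z) with hC
  have hCc : IsCompact C := isCompact_range
    ((N₂.smooth_proj.continuousOn.mono N₂.carrier_subset).comp_continuous hcc hcar)
  have hCF : C ⊆ surgery F φ := by rintro _ ⟨z, rfl⟩; exact N₂.proj_mem (hcar z)
  have hRc : Continuous fun x : E 3 => x 0 ^ 2 + x 1 ^ 2 :=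
    (((contDiff_apply3 0).continuous).pow 2).add (((contDiff_apply3 1).continuous).pow 2)
  set Q : Set (E 3) := {x | 0 ≤ x 0 ^ 2 + x 1 ^ 2 ∧ x 0 ^ 2 + x 1 ^ 2 ≤ 1 ∧ |x 2| ≤ 1} with hQ
  have hQc : IsCompact Q := isCompact_cylinder 0 (isClosed_le continuous_const hRc)
  have hQb : Q ⊆ box := fun x hx => ⟨by linarith [hx.2.1], by linarith [hx.2.2]⟩
  have hφc : ContinuousOn φ Q := h.smooth.continuousOn.mono hQb
  have hDc : IsCompact (Q ∩ φ ⁻¹' C) := hQc.of_isClosed_subset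
    (hφc.preimage_isClosed_of_isClosed hQc.isClosed hCc.isClosed) inter_subset_left
  -- A shadow point on the axis would satisfy `capProfile t = 0`, so it would be one of the two
  -- centres. Hence the squared radius is positive on the compact set in question.
  obtain ⟨δ, hδ, hδ1, hδD⟩ := exists_pos_lt_of_isCompact hDc hRc.continuousOn fun x hx => by
    refine lt_of_le_of_ne hx.1.1 fun h0 => ?_
    have hcap := (h.mem_surgery_iff (hQb hx.1)).1 (hCF hx.2)
    rw [← h0, eq_comm, capProfile_eq_zero_iff, ← hs2] at hcap
    have hx0 : x 0 = 0 := by nlinarith [sq_nonneg (x 0), sq_nonneg (x 1)]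
    have hx1 : x 1 = 0 := by nlinarith [sq_nonneg (x 0), sq_nonneg (x 1)]
    obtain ⟨z, hz⟩ := hx.2
    rcases sq_eq_sq_iff_eq_or_eq_neg.1 hcap with h2 | h2
    · have h3 : x = vec3 0 0 s := ext3 hx0 hx1 h2
      rw [h3] at hz
      exact hav₂' hav₁ z hz
    · have h3 : x = vec3 0 0 (-s) := ext3 hx0 hx1 h2
      rw [h3] at hz
      exact hav₂ z hz
  obtain ⟨Θ, hΘ⟩ := h.exists_squeeze hδ hδ1
  set Z : Set (E 3) := Q ∩ {x | x 0 ^ 2 + x 1 ^ 2 ≤ δ} with hZ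
  have hZc : IsCompact Z := hQc.inter_right (isClosed_le hRc continuous_const)
  have hZφ : IsClosed (φ '' Z) :=
    (hZc.image_of_continuousOn (hφc.mono inter_subset_left)).isClosed
  obtain ⟨U, f, r, htube⟩ := hF.exists_isTube
  refine (surfaceCrossingNumber_le_image K F Θ).trans ?_
  have key := surfaceCrossingNumber_le_of_agree K (F := Θ.final '' F) (F' := surgery F φ)
    hZφ.isOpen_compl ?_ (hF.compact.image Θ.contMDiff_final.continuous) (htube.image Θ.diffeo) hflat
    N₂ ((Φ.trans Φ₁).trans Φ₂) (by rw [hfin]; exact hN₂) ?_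
  · rw [hfin, hcr₂, hcr₁] at key
    exact key
  · ext y
    simp only [mem_inter_iff, mem_compl_iff]
    refine and_congr_left fun hy => hΘ y fun x hx hxy => ?_
    by_contra! hcon
    exact hy ⟨x, ⟨⟨by positivity, by linarith [hcon.1], hcon.2⟩, hcon.1⟩, hxy⟩
  · rintro z ⟨x, hx, hxz⟩
    have h1 : N₂.proj (((Φ.trans Φ₁).trans Φ₂).final (K.toFun z)) = N₂.proj (c z) :=
      congrArg N₂.proj (congrFun hfin z)
    have h2 := hδD x ⟨hx.1, by rw [mem_preimage, hxz, h1]; exact mem_range_self z⟩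
    exact absurd hx.2 (not_le.2 h2)

theorem IsCompression.surfaceCrossingNumber_le (K : Knot) {F' : Set S3} (hF : IsClosedSurface F)
    (hF' : IsClosedSurface F') (h : IsCompression F F') :
    surfaceCrossingNumber K F ≤ surfaceCrossingNumber K F' := by
  obtain ⟨φ, Ψ, hφ, rfl⟩ := h
  refine (hφ.surfaceCrossingNumber_le K hF ?_).trans (surfaceCrossingNumber_le_image K _ Ψ)
  have h1 := hF'.locallyFlat.image Ψ.diffeo.symm
  have h2 : Ψ.diffeo.symm '' (Ψ.final '' surgery F φ) = surgery F φ := by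
    rw [image_image]
    simp only [AmbientIsotopy.final_eq, Diffeomorph.symm_apply_apply, image_id']
  rwa [h2] at h1

end Compression

end SurfaceCrossing

end

/-! ### The proposition -/

theorem mainTheorem7 (K : SurfaceCrossing.Knot) :
    (∀ F F' : Set SurfaceCrossing.S3,
      SurfaceCrossing.IsClosedSurface F → SurfaceCrossing.IsClosedSurface F' →
      SurfaceCrossing.IsCompression F F' →
      SurfaceCrossing.surfaceCrossingNumber K F ≤ SurfaceCrossing.surfaceCrossingNumber K F') ∧
    (∀ F : Set SurfaceCrossing.S3, SurfaceCrossing.IsClosedSurface F →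
      SurfaceCrossing.surfaceCrossingNumber K F ≤ SurfaceCrossing.crossingNumber K) ∧
    SurfaceCrossing.surfaceCrossingNumber K SurfaceCrossing.standardSphere =
      SurfaceCrossing.crossingNumber K := by
  refine ⟨fun F F' hF hF' h => h.surfaceCrossingNumber_le K hF hF', fun F hF => ?_,
    le_antisymm ?_ (SurfaceCrossing.crossingNumber_le_surfaceCrossingNumber K)⟩
  · obtain ⟨U, f, r, h⟩ := hF.exists_isTube
    exact SurfaceCrossing.surfaceCrossingNumber_le_crossingNumber K hF.nonempty hF.compact
      hF.locallyFlat h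
  -- For the standard sphere the last coordinate of `ℝ⁴` is a global defining function, so the tube
  -- is available without a transverse field.
  · obtain ⟨U, r, h⟩ := SurfaceCrossing.exists_isTube_standardSphere
    exact SurfaceCrossing.surfaceCrossingNumber_le_crossingNumber K
      SurfaceCrossing.standardSphere_nonempty SurfaceCrossing.isCompact_standardSphere
      SurfaceCrossing.locallyFlat_standardSphere h
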